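/- **Setting.** Let $L,T>0$, $0<\alpha<1$, $\beta(t)=t^{\alpha-1}/\Gamma(\alpha)$ and $\mathcal I^{(\alpha)}v(t)=\int_0^t\beta(t-\zeta)v(\zeta)\,d\zeta$. Let $u$ be continuous on $[0,L]\times[0,T]$, differentiable in $t$ on $(0,T]$ for each $x\in(0,L)$, with $u(\cdot,t)\in C^4([0,L])$ for every $t\in[0,T]$ and $\partial_x^4u$ bounded on $[0,L]\times[0,T]$, and suppose that $$u_t+u\,u_x-\mathcal I^{(\alpha)}u_{xx}=f\ \text{ on }(0,L)\times(0,T],\qquad u(0,t)=u(L,t)=0\ (0<t\le T),\qquad u(x,0)=u_0(x)\ (0\le x\le L).$$ For $J\ge1$ put $h=L/J$, $x_j=jh$, and $\|w\|=\big(h\sum_{j=1}^{J-1}w_j^2\big)^{1/2}$; for a function on $[0,L]$, $\|\cdot\|$ is the norm of its nodal values. Let $\sigma>0$ and $\mathcal M$ be constants. With primes denoting time derivatives, suppose that $u_{xx}(x,\cdot)$ and $f(x,\cdot)$ are twice differentiable on $(0,T]$ for every $x\in(0,L)$ and that, for all $J\ge1$ and $0<t\le T$, $$t\|u_{xx}'(\cdot,t)\|+t^2\|u_{xx}''(\cdot,t)\|\le\mathcal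 M t^{\sigma-1},\qquad t\|f'(\cdot,t)\|+t^2\|f''(\cdot,t)\|\le\mathcal M t^{\sigma-1}.$$ Let $\gamma\ge1$ and let $c>0$, $\widetilde C$, $C$ be constants. A time mesh $0=t_0<t_1<\dots<t_N\le T$ $(N\ge1)$ with steps $k_n=t_n-t_{n-1}$ is called *admissible with parameter* $k>0$ if $$k_n\le\widetilde C k\min\{1,t_n^{1-1/\gamma}\}\ (1\le n\le N),\qquad t_1\ge c\,k^\gamma,\qquad t_n\le\widetilde C t_{n-1}\ (2\le n\le N),$$ $$0\le k_{n+1}-k_n\le\widetilde C k^2t_n^{1-2/\gamma}\ (2\le n\le N-1).$$ Source values $f_j^{n-1/2}$ $(1\le n\le N,\ 1\le j\le J-1)$ are called *admissible* if $$\Big\|f^{1/2}k_1-\int_{t_0}^{t_1}f(\cdot,t)\,dt\Big\|\le C\int_{t_0}^{t_1}t\|f'(\cdot,t)\|\,dt,\qquad \Big\|f^{n-1/2}k_n-\int_{t_{n-1}}^{t_n}f(\cdot,t)\,dt\Big\|\le Ck_n^2\int_{t_{n-1}}^{t_n}\|f''(\cdot,t)\|\,dt\ \ (2\le n\le N).$$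 **The scheme.** Write $W^{n-1/2}=\tfrac12(W^n+W^{n-1})$, $\delta_tW^{n-1/2}=(W^n-W^{n-1})/k_n$, $\Delta_xw_j=(w_{j+1}-w_{j-1})/(2h)$, $\nabla w_j=\tfrac13(w_{j-1}+w_j+w_{j+1})$, $\delta_x^2w_j=(w_{j+1}-2w_j+w_{j-1})/h^2$ and $$I^{(\alpha)}W^{n-1/2}=\widehat w_{n1}W^1k_1+\sum_{s=2}^n\widehat w_{ns}W^{s-1/2}k_s,\qquad \widehat w_{ns}=\frac1{k_nk_s}\int_{t_{n-1}}^{t_n}\int_{t_{s-1}}^{\min\{t,t_s\}}\beta(t-\zeta)\,d\zeta\,dt.$$ The implicit difference scheme for $U_j^n$ is $$\delta_tU_j^{1/2}+\nabla U_j^1\,\Delta_xU_j^1=I^{(\alpha)}\delta_x^2U_j^{1/2}+f_j^{1/2}\qquad(1\le j\le J-1),$$ $$\delta_tU_j^{n-1/2}+\nabla U_j^{n-1/2}\,\Delta_xU_j^{n-1/2}=I^{(\alpha)}\delta_x^2U_j^{n-1/2}+f_j^{n-1/2}\qquad(1\le j\le J-1,\ 2\le n\le N),$$ $$U_j^0=u_0(x_j)\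 (1\le j\le J-1),\qquad U_0^n=U_J^n=0\ (1\le n\le N).$$ **Theorem.** Suppose that $\gamma=2/\sigma\ (\ge1)$, and let $\kappa$ be any real function with $\kappa(h)=o(h^{1/2})$ as $h\to0^+$. Then there is $h_0>0$ such that, whenever $h=L/J\le h_0$ and $0<k\le\kappa(h)$, for every time mesh that is admissible with parameter $k$ and all admissible source values, the implicit difference scheme has a solution, and the values $U_j^n$ $(0\le n\le N,\ 1\le j\le J-1)$ are uniquely determined by it. -/

import Mathlib

open Set Filter Topology Asymptotics

namespace PIDE

noncomputable section

/-! ### The continuous problem -/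

/-- The Abel kernel `β(t) = t^(α-1) / Γ(α)`. -/
def abelKernel (α t : ℝ) : ℝ := t ^ (α - 1) / Real.Gamma α

/-- The Riemann-Liouville fractional integral `∫₀ᵗ β(t - ζ) v(ζ) dζ`. -/
def fracIntegral (α : ℝ) (v : ℝ → ℝ) (t : ℝ) : ℝ :=
  ∫ ζ in (0 : ℝ)..t, abelKernel α (t - ζ) * v ζ

/-- The `m`-th partial derivative in the space variable of `v : (x, t) ↦ v x t`
on `[0, L]` (one-sided at the two end points). -/
def spaceDeriv (L : ℝ) (m : ℕ) (v : ℝ → ℝ → ℝ) (x t : ℝ) : ℝ :=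
  iteratedDerivWithin m (fun y => v y t) (Icc 0 L) x

/-- The `m`-th partial derivative in the time variable of `v : (x, t) ↦ v x t`
on `(0, T]` (left-sided at `t = T`). -/
def timeDeriv (T : ℝ) (m : ℕ) (v : ℝ → ℝ → ℝ) (x t : ℝ) : ℝ :=
  iteratedDerivWithin m (fun s => v x s) (Ioc 0 T) t

/-- `v(x, ·)` is twice differentiable on `(0, T]` for every `x ∈ (0, L)`. -/
def TwiceDiffInTime (L T : ℝ) (v : ℝ → ℝ → ℝ) : Prop :=
  ∀ x ∈ Ioo 0 L,
    DifferentiableOn ℝ (fun s => v x s) (Ioc 0 T) ∧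
    DifferentiableOn ℝ (fun s => timeDeriv T 1 v x s) (Ioc 0 T)

/-- `u` is a classical solution of `u_t + u u_x - I^(α) u_xx = f` on `(0, L) × (0, T]` with
homogeneous Dirichlet boundary values and initial value `u₀`. The function `u` is continuous up
to the boundary and up to `t = 0`, and it belongs to `C⁴([0, L])` in space, with a fourth space
derivative that is bounded on `[0, L] × [0, T]`. -/
structure IsSolution (L T α : ℝ) (f : ℝ → ℝ → ℝ) (u₀ : ℝ → ℝ) (u : ℝ → ℝ → ℝ) : Prop where
  continuous : ContinuousOn (fun p : ℝ × ℝ => u p.1 p.2) (Icc 0 L ×ˢ Icc 0 T)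
  space_smooth : ∀ t ∈ Icc 0 T, ContDiffOn ℝ 4 (fun x => u x t) (Icc 0 L)
  space_bound : ∃ K : ℝ, ∀ x ∈ Icc 0 L, ∀ t ∈ Icc 0 T, |spaceDeriv L 4 u x t| ≤ K
  time_diff : ∀ x ∈ Ioo 0 L, DifferentiableOn ℝ (fun t => u x t) (Ioc 0 T)
  equation : ∀ x ∈ Ioo 0 L, ∀ t ∈ Ioc 0 T,
    timeDeriv T 1 u x t + u x t * spaceDeriv L 1 u x t
      - fracIntegral α (fun ζ => spaceDeriv L 2 u x ζ) t = f x t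
  boundary : ∀ t ∈ Ioc 0 T, u 0 t = 0 ∧ u L t = 0
  initial : ∀ x ∈ Icc 0 L, u x 0 = u₀ x

/-! ### Space grid -/

/-- The space step `h = L / J`. -/
def hStep (L : ℝ) (J : ℕ) : ℝ := L / J

/-- The node `x_j = j h`. -/
def node (L : ℝ) (J j : ℕ) : ℝ := j * hStep L J

/-- The discrete norm `‖w‖ = (h ∑_{s=1}^{J-1} w_s²)^(1/2)`. -/
def gridNorm (L : ℝ) (J : ℕ) (w : ℕ → ℝ) : ℝ :=
  √(hStep L J * ∑ s ∈ Finset.Ico 1 J, w s ^ 2)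

/-- The discrete norm of the restriction of a function on `[0, L]` to the nodes. -/
def nodalNorm (L : ℝ) (J : ℕ) (g : ℝ → ℝ) : ℝ := gridNorm L J (fun j => g (node L J j))

/-- The central difference `(w_{j+1} - w_{j-1}) / (2h)`, for `j ≥ 1`. -/
def centralDiff (h : ℝ) (w : ℕ → ℝ) (j : ℕ) : ℝ := (w (j + 1) - w (j - 1)) / (2 * h)

/-- The local mean `(w_{j-1} + w_j + w_{j+1}) / 3`, for `j ≥ 1`. -/
def localMean (w : ℕ → ℝ) (j : ℕ) : ℝ := (w (j - 1) + w j + w (j + 1)) / 3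

/-- The second difference `(w_{j+1} - 2 w_j + w_{j-1}) / h²`, for `j ≥ 1`. -/
def secondDiff (h : ℝ) (w : ℕ → ℝ) (j : ℕ) : ℝ := (w (j + 1) - 2 * w j + w (j - 1)) / h ^ 2

/-! ### Time grid -/

/-- The time step `k_n = t_n - t_{n-1}`, for `n ≥ 1`. -/
def tStep (t : ℕ → ℝ) (n : ℕ) : ℝ := t n - t (n - 1)

/-- The mean `W^{n-1/2} = (W^n + W^{n-1}) / 2`, for `n ≥ 1`. -/
def tMean (W : ℕ → ℝ) (n : ℕ) : ℝ := (W n + W (n - 1)) / 2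

/-- The time mesh `0 = t_0 < t_1 < ⋯ < t_N ≤ T` is graded with mesh parameter `k > 0`, grading
exponent `γ` and constants `c`, `C`. -/
structure IsGradedMesh (T γ c C k : ℝ) (N : ℕ) (t : ℕ → ℝ) : Prop where
  k_pos : 0 < k
  zero : t 0 = 0
  increasing : ∀ n, 1 ≤ n → n ≤ N → t (n - 1) < t n
  le_final : t N ≤ T
  step_le : ∀ n, 1 ≤ n → n ≤ N → tStep t n ≤ C * k * min 1 (t n ^ (1 - 1 / γ))
  first_ge : c * k ^ γ ≤ t 1
  ratio_le : ∀ n, 2 ≤ n → n ≤ N → t n ≤ C * t (n - 1)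
  step_mono : ∀ n, 2 ≤ n → n + 1 ≤ N → tStep t n ≤ tStep t (n + 1)
  step_diff_le : ∀ n, 2 ≤ n → n + 1 ≤ N →
    tStep t (n + 1) - tStep t n ≤ C * k ^ 2 * t n ^ (1 - 2 / γ)

/-- The product-integration weight
`(k_n k_s)⁻¹ ∫_{t_{n-1}}^{t_n} ∫_{t_{s-1}}^{min(τ, t_s)} β(τ - ζ) dζ dτ`, for `1 ≤ s ≤ n`. -/
def quadWeight (α : ℝ) (t : ℕ → ℝ) (n s : ℕ) : ℝ :=
  (∫ τ in (t (n - 1))..(t n), ∫ ζ in (t (s - 1))..(min τ (t s)), abelKernel α (τ - ζ))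
    / (tStep t n * tStep t s)

/-- The discrete fractional integral
`I^(α) W^{n-1/2} = ŵ_{n1} W^1 k_1 + ∑_{s=2}^n ŵ_{ns} W^{s-1/2} k_s`. -/
def discFracIntegral (α : ℝ) (t : ℕ → ℝ) (W : ℕ → ℝ) (n : ℕ) : ℝ :=
  quadWeight α t n 1 * W 1 * tStep t 1
    + ∑ s ∈ Finset.Icc 2 n, quadWeight α t n s * tMean W s * tStep t s

/-- The grid values `F n j` (standing for `f_j^{n-1/2}`) approximate the time means of the
forcing term `f` over `(t_{n-1}, t_n)`, with constant `C`. -/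
structure IsSourceApprox (L T C : ℝ) (f : ℝ → ℝ → ℝ) (J N : ℕ) (t : ℕ → ℝ)
    (F : ℕ → ℕ → ℝ) : Prop where
  first :
    gridNorm L J (fun j => F 1 j * tStep t 1 - ∫ s in (t 0)..(t 1), f (node L J j) s)
      ≤ C * ∫ s in (t 0)..(t 1), s * nodalNorm L J (fun x => timeDeriv T 1 f x s)
  later : ∀ n, 2 ≤ n → n ≤ N →
    gridNorm L J (fun j => F n j * tStep t n - ∫ s in (t (n - 1))..(t n), f (node L J j) s)
      ≤ C * tStep t n ^ 2
        * ∫ s in (t (n - 1))..(t n), nodalNorm L J (fun x => timeDeriv T 2 f x s)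

/-! ### The implicit difference scheme -/

/-- `U n j` (standing for `U_j^n`, `0 ≤ n ≤ N`, `0 ≤ j ≤ J`) solves the implicit difference scheme
with source values `F n j` and initial value `u₀`. -/
structure IsSchemeSolution (L α : ℝ) (u₀ : ℝ → ℝ) (J N : ℕ) (t : ℕ → ℝ) (F U : ℕ → ℕ → ℝ) :
    Prop where
  first : ∀ j, 1 ≤ j → j < J →
    (U 1 j - U 0 j) / tStep t 1 + localMean (U 1) j * centralDiff (hStep L J) (U 1) j
      = discFracIntegral α t (fun m => secondDiff (hStep L J) (U m) j) 1 + F 1 j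
  later : ∀ n, 2 ≤ n → n ≤ N → ∀ j, 1 ≤ j → j < J →
    (U n j - U (n - 1) j) / tStep t n
        + localMean (fun i => tMean (fun m => U m i) n) j
          * centralDiff (hStep L J) (fun i => tMean (fun m => U m i) n) j
      = discFracIntegral α t (fun m => secondDiff (hStep L J) (U m) j) n + F n j
  initial : ∀ j, 1 ≤ j → j < J → U 0 j = u₀ (node L J j)
  boundary : ∀ n, 1 ≤ n → n ≤ N → U n 0 = 0 ∧ U n J = 0

end

end PIDE

namespace PIDE

/-! ### Discrete calculus on the space grid -/

/-! The scheme is compared with the nodal values of the exact solution. In the equations for the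
error e = u - U the convective difference splits into a part linear in e and the quadratic term `∇e
Δ_x e`. That term is a difference of fluxes and is orthogonal to e (`gridInner_convec_self`). It
remains orthogonal after multiplication by any scalar, even one depending on e. This freedom carries
the proof.

Stability. Test the error equations with the stage value (`e^1` in the first step, the mean
afterwards). The quadratic term disappears whatever its weight `θ n`, and the linear part costs only
a multiple of ‖e‖², since the exact solution has bounded difference quotients. The memory term has a
favourable sign once summed in time: its weights are mixed second differences of a negative multiple
of |x|^(1+α), and these form a positive semidefinite matrix (`sum_sum_kernelMass_nonneg`). A
discrete Gronwall argument then bounds ‖e^n‖ by the sum of the residual norms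
(`IsErrorSolution.gridNorm_le`).

Consistency. Integrating the equation over each mesh interval avoids any assumption on the size of
u_t near t = 0. The grading γ = 2/σ balances the singular time derivatives, and the residuals sum to
O(h + k) (`IsRegularSolution.exists_sum_residual_le`). For k ≤ √h and h ≤ 1 this is O(√h), so every
error lies in a ball of radius K₁√h. Since h w_j² ≤ ‖w‖², functions in that ball have nodal values
at most K₁, uniformly in h.

Solvability. Replace the argument of the quadratic term by its radial retraction onto this ball.
Because the retraction only multiplies by a scalar, the stability bound is unaffected, and the
truncated quadratic term is globally Lipschitz with a constant independent of h. The map to be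
inverted in one step is then strongly monotone: convection is absorbed by half of the mass term and
by the diagonal memory weight k_n^(1+α)/Γ(α+2), which dominates k_n² for small k_n because α < 1
(`stepMap_monotone`). So the truncated error system has exactly one solution. By stability the
truncation is inactive on that solution, and equally on the error of any solution of the scheme, so
the two systems have the same solutions. -/

theorem hStep_pos {L : ℝ} {J : ℕ} (hL : 0 < L) (hJ : 1 ≤ J) : 0 < hStep L J :=
  div_pos hL (by exact_mod_cast hJ)

theorem mul_hStep {L : ℝ} {J : ℕ} (hJ : 1 ≤ J) : (J : ℝ) * hStep L J = L := by
  have : (J : ℝ) ≠ 0 := by exact_mod_cast (by omega : J ≠ 0)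
  unfold hStep; field_simp

/-- The discrete inner product `h ∑_{j=1}^{J-1} v_j w_j`. -/
noncomputable def gridInner (L : ℝ) (J : ℕ) (v w : ℕ → ℝ) : ℝ :=
  hStep L J * ∑ j ∈ Finset.Ico 1 J, v j * w j

/-- The discrete `H¹` seminorm. -/
noncomputable def gridSemi (L : ℝ) (J : ℕ) (w : ℕ → ℝ) : ℝ :=
  √(hStep L J * ∑ j ∈ Finset.range J, ((w (j + 1) - w j) / hStep L J) ^ 2)

/-- The convective term `∇w_j Δ_x w_j`. -/
noncomputable def convec (h : ℝ) (w : ℕ → ℝ) (j : ℕ) : ℝ := localMean w j * centralDiff h w j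

/-- The flux of the convective term. -/
def cflux (w : ℕ → ℝ) (j : ℕ) : ℝ := w (j + 1) ^ 2 + w j * w (j + 1) + w j ^ 2

theorem gridNorm_nonneg (L : ℝ) (J : ℕ) (w : ℕ → ℝ) : 0 ≤ gridNorm L J w := Real.sqrt_nonneg _

theorem gridSemi_nonneg (L : ℝ) (J : ℕ) (w : ℕ → ℝ) : 0 ≤ gridSemi L J w := Real.sqrt_nonneg _

theorem gridNorm_congr {L : ℝ} {J : ℕ} {v w : ℕ → ℝ} (H : ∀ j ∈ Finset.Ico 1 J, v j = w j) :
    gridNorm L J v = gridNorm L J w := by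
  unfold gridNorm
  rw [Finset.sum_congr rfl fun j hj => by rw [H j hj]]

section

variable {L : ℝ} {J : ℕ}

theorem gridNorm_sq (hL : 0 < L) (hJ : 1 ≤ J) (w : ℕ → ℝ) :
    gridNorm L J w ^ 2 = gridInner L J w w := by
  unfold gridNorm gridInner
  rw [Real.sq_sqrt (mul_nonneg (hStep_pos hL hJ).le (Finset.sum_nonneg fun _ _ => sq_nonneg _))]
  simp only [sq]

theorem gridSemi_sq (hL : 0 < L) (hJ : 1 ≤ J) (w : ℕ → ℝ) :
    gridSemi L J w ^ 2
      = hStep L J * ∑ j ∈ Finset.range J, ((w (j + 1) - w j) / hStep L J) ^ 2 :=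
  Real.sq_sqrt (mul_nonneg (hStep_pos hL hJ).le (Finset.sum_nonneg fun _ _ => sq_nonneg _))

theorem abs_gridInner_le (hL : 0 < L) (hJ : 1 ≤ J) (v w : ℕ → ℝ) :
    |gridInner L J v w| ≤ gridNorm L J v * gridNorm L J w := by
  have hh := (hStep_pos hL hJ).le
  rw [gridNorm, gridNorm, ← Real.sqrt_mul (mul_nonneg hh (Finset.sum_nonneg fun _ _ => sq_nonneg _))]
  apply Real.abs_le_sqrt
  rw [gridInner, mul_pow]
  have := Finset.sum_mul_sq_le_sq_mul_sq (Finset.Ico 1 J) v w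
  calc _ ≤ hStep L J ^ 2 * ((∑ i ∈ Finset.Ico 1 J, v i ^ 2) * ∑ i ∈ Finset.Ico 1 J, w i ^ 2) := by
        gcongr
    _ = _ := by ring

theorem gridInner_le (hL : 0 < L) (hJ : 1 ≤ J) (v w : ℕ → ℝ) :
    gridInner L J v w ≤ gridNorm L J v * gridNorm L J w :=
  (le_abs_self _).trans (abs_gridInner_le hL hJ v w)

/-- Duality. Norms of time integrals are estimated by pairing with a fixed grid function, which
reduces them to integrals of scalar functions. -/
theorem gridNorm_le_of_inner (hL : 0 < L) (hJ : 1 ≤ J) {v : ℕ → ℝ} {b : ℝ} (hb : 0 ≤ b)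
    (H : ∀ w, gridInner L J v w ≤ b * gridNorm L J w) : gridNorm L J v ≤ b := by
  have h1 := H v
  rw [← gridNorm_sq hL hJ] at h1
  by_contra! hc
  nlinarith

theorem gridInner_add_left (v v' w : ℕ → ℝ) :
    gridInner L J (fun j => v j + v' j) w = gridInner L J v w + gridInner L J v' w := by
  simp only [gridInner, add_mul, Finset.sum_add_distrib, mul_add]

theorem gridInner_sub_left (v v' w : ℕ → ℝ) :
    gridInner L J (fun j => v j - v' j) w = gridInner L J v w - gridInner L J v' w := by
  simp only [gridInner, sub_mul, Finset.sum_sub_distrib, mul_sub]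

theorem gridInner_smul_left (c : ℝ) (v w : ℕ → ℝ) :
    gridInner L J (fun j => c * v j) w = c * gridInner L J v w := by
  simp only [gridInner, mul_assoc, ← Finset.mul_sum]; ring

theorem gridInner_sum_left {ι : Type*} (s : Finset ι) (v : ι → ℕ → ℝ) (w : ℕ → ℝ) :
    gridInner L J (fun j => ∑ i ∈ s, v i j) w = ∑ i ∈ s, gridInner L J (v i) w := by
  simp only [gridInner, Finset.sum_mul, ← Finset.mul_sum]
  rw [Finset.sum_comm]

theorem gridInner_congr {v v' w : ℕ → ℝ} (H : ∀ j ∈ Finset.Ico 1 J, v j = v' j) :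
    gridInner L J v w = gridInner L J v' w := by
  unfold gridInner
  rw [Finset.sum_congr rfl fun j hj => by rw [H j hj]]

theorem gridNorm_add_le (hL : 0 < L) (hJ : 1 ≤ J) (v w : ℕ → ℝ) :
    gridNorm L J (fun j => v j + w j) ≤ gridNorm L J v + gridNorm L J w := by
  refine gridNorm_le_of_inner hL hJ (add_nonneg (gridNorm_nonneg ..) (gridNorm_nonneg ..)) fun x => ?_
  rw [gridInner_add_left, add_mul]
  exact add_le_add (gridInner_le hL hJ _ _) (gridInner_le hL hJ _ _)

theorem gridNorm_smul (c : ℝ) (v : ℕ → ℝ) :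
    gridNorm L J (fun j => c * v j) = |c| * gridNorm L J v := by
  unfold gridNorm
  rw [← Real.sqrt_sq_eq_abs, ← Real.sqrt_mul (sq_nonneg c)]
  simp only [mul_pow, ← Finset.mul_sum]
  congr 1; ring

theorem gridNorm_sub_le (hL : 0 < L) (hJ : 1 ≤ J) (v w : ℕ → ℝ) :
    gridNorm L J (fun j => v j - w j) ≤ gridNorm L J v + gridNorm L J w := by
  have := gridNorm_add_le hL hJ v (fun j => (-1) * w j)
  rw [gridNorm_smul] at this
  simpa [sub_eq_add_neg] using this

theorem gridNorm_mono (hL : 0 < L) (hJ : 1 ≤ J) {v w : ℕ → ℝ}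
    (H : ∀ j ∈ Finset.Ico 1 J, |v j| ≤ |w j|) : gridNorm L J v ≤ gridNorm L J w := by
  refine Real.sqrt_le_sqrt (mul_le_mul_of_nonneg_left ?_ (hStep_pos hL hJ).le)
  exact Finset.sum_le_sum fun j hj => sq_le_sq.2 (H j hj)

theorem gridNorm_le_of_abs_le (hL : 0 < L) (hJ : 1 ≤ J) {v : ℕ → ℝ} {b : ℝ} (hb : 0 ≤ b)
    (H : ∀ j ∈ Finset.Ico 1 J, |v j| ≤ b) : gridNorm L J v ≤ √L * b := by
  have h1 : ∑ j ∈ Finset.Ico 1 J, v j ^ 2 ≤ J * b ^ 2 := by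
    calc _ ≤ ∑ j ∈ Finset.Ico 1 J, b ^ 2 := Finset.sum_le_sum fun j hj =>
          sq_le_sq.2 (by rw [abs_of_nonneg hb]; exact H j hj)
      _ = ((J - 1 : ℕ) : ℝ) * b ^ 2 := by simp
      _ ≤ _ := by gcongr; omega
  rw [gridNorm, ← Real.sqrt_sq hb, ← Real.sqrt_mul hL.le]
  apply Real.sqrt_le_sqrt
  calc _ ≤ hStep L J * (J * b ^ 2) := by gcongr; exact (hStep_pos hL hJ).le
    _ = (J * hStep L J) * b ^ 2 := by ring
    _ = _ := by rw [mul_hStep hJ]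

theorem hStep_mul_sq_le (hL : 0 < L) (hJ : 1 ≤ J) (w : ℕ → ℝ) {j : ℕ} (hj : j ∈ Finset.Ico 1 J) :
    hStep L J * w j ^ 2 ≤ gridNorm L J w ^ 2 := by
  rw [gridNorm_sq hL hJ, gridInner]
  gcongr
  · exact (hStep_pos hL hJ).le
  · simp only [← sq]
    exact Finset.single_le_sum (f := fun j => w j ^ 2) (fun _ _ => sq_nonneg _) hj

/-- Inverse inequality: a single node contributes h w_j² to the squared norm. It explains why
truncation radii are multiples of √h. -/
theorem abs_le_of_gridNorm_le (hL : 0 < L) (hJ : 1 ≤ J) {w : ℕ → ℝ} {K : ℝ} (hK : 0 ≤ K)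
    (H : gridNorm L J w ≤ K * √(hStep L J)) {j : ℕ} (hj : j ∈ Finset.Ico 1 J) : |w j| ≤ K := by
  have hh := hStep_pos hL hJ
  have h1 := hStep_mul_sq_le hL hJ w hj
  have h2 : gridNorm L J w ^ 2 ≤ (K * √(hStep L J)) ^ 2 :=
    pow_le_pow_left₀ (gridNorm_nonneg ..) H 2
  rw [mul_pow, Real.sq_sqrt hh.le] at h2
  have h3 : w j ^ 2 ≤ K ^ 2 := by
    by_contra! hc
    nlinarith
  exact abs_le_of_sq_le_sq h3 hK

theorem sum_range_succ_mul_sub (φ x : ℕ → ℝ) (M : ℕ) :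
    ∑ j ∈ Finset.range (M + 1), φ j * (x (j + 1) - x j)
      = φ M * x (M + 1) - φ 0 * x 0
        - ∑ j ∈ Finset.Ico 1 (M + 1), (φ j - φ (j - 1)) * x j := by
  induction M with
  | zero => simp; ring
  | succ m ih =>
    rw [Finset.sum_range_succ, ih, Finset.sum_Ico_succ_top (by omega : 1 ≤ m + 1)]
    simp only [Nat.add_sub_cancel]
    ring

theorem sum_diff_mul (hJ : 1 ≤ J) (φ x : ℕ → ℝ) (x0 : x 0 = 0) (xJ : x J = 0) :
    ∑ j ∈ Finset.Ico 1 J, (φ j - φ (j - 1)) * x j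
      = -∑ j ∈ Finset.range J, φ j * (x (j + 1) - x j) := by
  obtain ⟨M, rfl⟩ : ∃ M, J = M + 1 := ⟨J - 1, by omega⟩
  rw [sum_range_succ_mul_sub, x0, xJ]; ring

theorem sum_range_eq_sum_Ico (hJ : 1 ≤ J) (d : ℕ → ℝ) (d0 : d 0 = 0) :
    ∑ j ∈ Finset.range J, d j = ∑ j ∈ Finset.Ico 1 J, d j := by
  rw [Finset.range_eq_Ico, Finset.sum_eq_sum_Ico_succ_bot (by omega), d0]; simp

theorem sum_range_succ_eq_sum_Ico (hJ : 1 ≤ J) (d : ℕ → ℝ) (dJ : d J = 0) :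
    ∑ j ∈ Finset.range J, d (j + 1) = ∑ j ∈ Finset.Ico 1 J, d j := by
  obtain ⟨M, rfl⟩ : ∃ M, J = M + 1 := ⟨J - 1, by omega⟩
  rw [Finset.sum_range_succ, dJ, add_zero, Finset.range_eq_Ico, Finset.sum_Ico_add' d 0 M 1]

/-- Summation by parts for operators written as differences of a flux; the boundary terms vanish
with `x`. The divisor `c` is free because it is h² for the second difference and 6h for convection.
-/
theorem gridInner_div_diff (hL : 0 < L) (hJ : 1 ≤ J) (c : ℝ) (φ x : ℕ → ℝ) (x0 : x 0 = 0)
    (xJ : x J = 0) :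
    gridInner L J (fun j => (φ j - φ (j - 1)) / c) x
      = -(hStep L J ^ 2 / c *
          ∑ j ∈ Finset.range J, φ j * ((x (j + 1) - x j) / hStep L J)) := by
  have hh := (hStep_pos hL hJ).ne'
  have h1 : ∀ j, (φ j - φ (j - 1)) / c * x j = c⁻¹ * ((φ j - φ (j - 1)) * x j) := fun j => by
    ring
  have h2 : ∀ j, φ j * ((x (j + 1) - x j) / hStep L J)
      = (hStep L J)⁻¹ * (φ j * (x (j + 1) - x j)) := fun j => by ring
  simp only [gridInner, h1, h2, ← Finset.mul_sum, sum_diff_mul hJ φ x x0 xJ]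
  field_simp

/-! ### Second difference and convection as differences of fluxes -/

theorem secondDiff_eq (h : ℝ) (v : ℕ → ℝ) {j : ℕ} (hj : 1 ≤ j) :
    secondDiff h v j = ((fun i => v (i + 1) - v i) j - (fun i => v (i + 1) - v i) (j - 1)) / h ^ 2 := by
  obtain ⟨i, rfl⟩ : ∃ i, j = i + 1 := ⟨j - 1, by omega⟩
  simp only [secondDiff, Nat.add_sub_cancel]
  ring

theorem gridInner_secondDiff (hL : 0 < L) (hJ : 1 ≤ J) (v w : ℕ → ℝ) (w0 : w 0 = 0)
    (wJ : w J = 0) :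
    gridInner L J (secondDiff (hStep L J) v) w
      = -(hStep L J * ∑ j ∈ Finset.range J,
          (v (j + 1) - v j) / hStep L J * ((w (j + 1) - w j) / hStep L J)) := by
  have hh := (hStep_pos hL hJ).ne'
  rw [gridInner_congr (fun j hj => secondDiff_eq (hStep L J) v (Finset.mem_Ico.1 hj).1),
    gridInner_div_diff hL hJ _ (fun i => v (i + 1) - v i) w w0 wJ, Finset.mul_sum, Finset.mul_sum]
  congr 1
  refine Finset.sum_congr rfl fun j _ => ?_
  field_simp

theorem gridInner_secondDiff_self (hL : 0 < L) (hJ : 1 ≤ J) (w : ℕ → ℝ) (w0 : w 0 = 0)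
    (wJ : w J = 0) :
    gridInner L J (secondDiff (hStep L J) w) w = -gridSemi L J w ^ 2 := by
  rw [gridInner_secondDiff hL hJ w w w0 wJ, gridSemi_sq hL hJ]
  simp only [sq]

/-- This is what the three-point mean is for: (a + b + c)(c - a) = (c² + bc + b²) - (b² + ab + a²).
The factor 6h collects 3 from the mean and 2h from the central difference. -/
theorem convec_eq (h : ℝ) (w : ℕ → ℝ) {j : ℕ} (hj : 1 ≤ j) :
    convec h w j = (cflux w j - cflux w (j - 1)) / (6 * h) := by
  obtain ⟨i, rfl⟩ : ∃ i, j = i + 1 := ⟨j - 1, by omega⟩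
  simp only [convec, localMean, centralDiff, cflux, Nat.add_sub_cancel]
  by_cases hh : h = 0
  · simp [hh]
  field_simp
  ring

/-- The flux times the forward difference is a difference of cubes, so the sum telescopes to
boundary values, which are zero. -/
theorem gridInner_convec_self (hL : 0 < L) (hJ : 1 ≤ J) (w : ℕ → ℝ) (w0 : w 0 = 0)
    (wJ : w J = 0) : gridInner L J (convec (hStep L J) w) w = 0 := by
  have hh := (hStep_pos hL hJ).ne'
  rw [gridInner_congr (fun j hj => convec_eq (hStep L J) w (Finset.mem_Ico.1 hj).1),
    gridInner_div_diff hL hJ _ (cflux w) w w0 wJ]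
  have : ∀ j, cflux w j * ((w (j + 1) - w j) / hStep L J)
      = (hStep L J)⁻¹ * ((fun i => w i ^ 3) (j + 1) - (fun i => w i ^ 3) j) := fun j => by
    simp only [cflux]; ring
  simp only [this]
  rw [← Finset.mul_sum, Finset.sum_range_sub fun i => w i ^ 3]
  simp [w0, wJ]

/-- A flux that is Lipschitz-bounded by `d` is bounded in the dual of the discrete `H¹` seminorm. -/
theorem abs_gridInner_flux_le (hL : 0 < L) (hJ : 1 ≤ J) {φ d x : ℕ → ℝ} {K : ℝ} (hK : 0 ≤ K)
    (x0 : x 0 = 0) (xJ : x J = 0) (d0 : d 0 = 0) (dJ : d J = 0)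
    (H : ∀ j < J, |φ j| ≤ 3 * K * (|d j| + |d (j + 1)|)) :
    |gridInner L J (fun j => (φ j - φ (j - 1)) / (6 * hStep L J)) x|
      ≤ K * gridNorm L J d * gridSemi L J x := by
  have hh := hStep_pos hL hJ
  rw [gridInner_div_diff hL hJ _ φ x x0 xJ, abs_neg]
  -- The factor 36 is (3K)² times 2 from squaring a sum of two terms, times 2 because each node
  -- belongs to two cells. It cancels the 1/6² coming from the divisor 6h.
  have hφ : ∑ j ∈ Finset.range J, φ j ^ 2 ≤ 36 * K ^ 2 * ∑ j ∈ Finset.Ico 1 J, d j ^ 2 := by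
    calc _ ≤ ∑ j ∈ Finset.range J, 18 * K ^ 2 * (d j ^ 2 + d (j + 1) ^ 2) := by
          refine Finset.sum_le_sum fun j hj => ?_
          have h1 := H j (Finset.mem_range.1 hj)
          have h2 : φ j ^ 2 ≤ (3 * K * (|d j| + |d (j + 1)|)) ^ 2 := by
            rw [← sq_abs]; exact pow_le_pow_left₀ (abs_nonneg _) h1 2
          refine h2.trans ?_
          have h3 : (|d j| + |d (j + 1)|) ^ 2 ≤ 2 * (d j ^ 2 + d (j + 1) ^ 2) := by
            rw [← sq_abs (d j), ← sq_abs (d (j + 1))]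
            nlinarith [sq_nonneg (|d j| - |d (j + 1)|)]
          calc _ = 9 * K ^ 2 * (|d j| + |d (j + 1)|) ^ 2 := by ring
            _ ≤ 9 * K ^ 2 * (2 * (d j ^ 2 + d (j + 1) ^ 2)) := by gcongr
            _ = _ := by ring
      _ = _ := by
          rw [← Finset.mul_sum, Finset.sum_add_distrib,
            sum_range_eq_sum_Ico hJ (fun j => d j ^ 2) (by simp [d0]),
            sum_range_succ_eq_sum_Ico hJ (fun j => d j ^ 2) (by simp [dJ])]
          ring
  rw [gridNorm, gridSemi, mul_assoc, ← Real.sqrt_mul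
    (mul_nonneg hh.le (Finset.sum_nonneg fun _ _ => sq_nonneg _)), ← Real.sqrt_sq hK,
    ← Real.sqrt_mul (sq_nonneg K)]
  apply Real.abs_le_sqrt
  have hcs := Finset.sum_mul_sq_le_sq_mul_sq (Finset.range J) φ
    (fun j => (x (j + 1) - x j) / hStep L J)
  have hc : hStep L J ^ 2 / (6 * hStep L J) = hStep L J / 6 := by field_simp
  rw [hc, mul_pow]
  set S := ∑ j ∈ Finset.range J, ((x (j + 1) - x j) / hStep L J) ^ 2
  have hS : 0 ≤ S := Finset.sum_nonneg fun _ _ => sq_nonneg _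
  calc _ ≤ (hStep L J / 6) ^ 2 * ((∑ j ∈ Finset.range J, φ j ^ 2) * S) := by gcongr
    _ ≤ (hStep L J / 6) ^ 2 * ((36 * K ^ 2 * ∑ j ∈ Finset.Ico 1 J, d j ^ 2) * S) := by gcongr
    _ = _ := by ring

/-- The flux difference is linear in the values of a - b at the two ends of a cell, with
coefficients that are sums of three numbers of size at most K. Putting the derivative on the test
function gives a Lipschitz constant without negative powers of h. -/
theorem abs_gridInner_convec_sub_le (hL : 0 < L) (hJ : 1 ≤ J) {a b x : ℕ → ℝ} {K : ℝ} (hK : 0 ≤ K)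
    (x0 : x 0 = 0) (xJ : x J = 0) (a0 : a 0 = 0) (aJ : a J = 0) (b0 : b 0 = 0) (bJ : b J = 0)
    (Ha : ∀ j ∈ Finset.Ico 1 J, |a j| ≤ K) (Hb : ∀ j ∈ Finset.Ico 1 J, |b j| ≤ K) :
    |gridInner L J (fun j => convec (hStep L J) a j - convec (hStep L J) b j) x|
      ≤ K * gridNorm L J (fun j => a j - b j) * gridSemi L J x := by
  have ext : ∀ w : ℕ → ℝ, w 0 = 0 → w J = 0 → (∀ j ∈ Finset.Ico 1 J, |w j| ≤ K) →
      ∀ j ≤ J, |w j| ≤ K := fun w w0 wJ H j hj => by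
    by_cases h0 : j = 0
    · simp [h0, w0, hK]
    by_cases h1 : j = J
    · simp [h1, wJ, hK]
    exact H j (Finset.mem_Ico.2 ⟨by omega, by omega⟩)
  have Ha' := ext a a0 aJ Ha
  have Hb' := ext b b0 bJ Hb
  rw [gridInner_congr (v' := fun j => ((fun i => cflux a i - cflux b i) j
    - (fun i => cflux a i - cflux b i) (j - 1)) / (6 * hStep L J))]
  · refine abs_gridInner_flux_le hL hJ hK x0 xJ (by simp [a0, b0]) (by simp [aJ, bJ]) fun j hj => ?_
    have e : cflux a j - cflux b j
        = (a j - b j) * (a j + b j + a (j + 1))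
          + (a (j + 1) - b (j + 1)) * (a (j + 1) + b (j + 1) + b j) := by
      simp only [cflux]; ring
    have h1 := Ha' j hj.le
    have h2 := Ha' (j + 1) hj
    have h3 := Hb' j hj.le
    have h4 := Hb' (j + 1) hj
    have h5 : |a j + b j + a (j + 1)| ≤ 3 * K := by
      have := abs_add_three (a j) (b j) (a (j + 1)); linarith
    have h6 : |a (j + 1) + b (j + 1) + b j| ≤ 3 * K := by
      have := abs_add_three (a (j + 1)) (b (j + 1)) (b j); linarith
    rw [e]
    refine (abs_add_le _ _).trans ?_
    rw [abs_mul, abs_mul]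
    have h7 := mul_le_mul_of_nonneg_left h5 (abs_nonneg (a j - b j))
    have h8 := mul_le_mul_of_nonneg_left h6 (abs_nonneg (a (j + 1) - b (j + 1)))
    linarith
  · intro j hj
    simp only [convec_eq _ _ (Finset.mem_Ico.1 hj).1]
    ring

/-! ### Linearisation of the convective term -/

/-- The linearisation at `a` of the convective term, in the direction `e`. -/
noncomputable def convecLin (h : ℝ) (a e : ℕ → ℝ) (j : ℕ) : ℝ :=
  convec h a j - convec h (fun i => a i - e i) j + convec h e j

/-- Since convection is a quadratic form, adding its value at e cancels the second-order remainder
and leaves twice the polar form of (a, e), which is linear in e. -/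
theorem convecLin_sub (h : ℝ) (a e e' : ℕ → ℝ) (j : ℕ) :
    convecLin h a e j - convecLin h a e' j = convecLin h a (fun i => e i - e' i) j := by
  simp only [convecLin, convec, localMean, centralDiff]
  ring

/-- The flux of the linearised convective term. -/
def cfluxLin (a e : ℕ → ℝ) (j : ℕ) : ℝ :=
  2 * a (j + 1) * e (j + 1) + a j * e (j + 1) + a (j + 1) * e j + 2 * a j * e j

theorem convecLin_eq (h : ℝ) (a e : ℕ → ℝ) {j : ℕ} (hj : 1 ≤ j) :
    convecLin h a e j = (cfluxLin a e j - cfluxLin a e (j - 1)) / (6 * h) := by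
  rw [convecLin, convec_eq h _ hj, convec_eq h _ hj, convec_eq h _ hj]
  obtain ⟨i, rfl⟩ : ∃ i, j = i + 1 := ⟨j - 1, by omega⟩
  simp only [cflux, cfluxLin, Nat.add_sub_cancel]
  ring

/-- Used for the solvability of one step, where the diagonal memory weight controls the H¹ seminorm
of the test function; only bounds on the values of `a` are needed. -/
theorem abs_gridInner_convecLin_le (hL : 0 < L) (hJ : 1 ≤ J) {a e x : ℕ → ℝ} {K : ℝ} (hK : 0 ≤ K)
    (x0 : x 0 = 0) (xJ : x J = 0) (e0 : e 0 = 0) (eJ : e J = 0)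
    (Ha : ∀ j ≤ J, |a j| ≤ K) :
    |gridInner L J (convecLin (hStep L J) a e) x| ≤ K * gridNorm L J e * gridSemi L J x := by
  rw [gridInner_congr (fun j hj => convecLin_eq (hStep L J) a e (Finset.mem_Ico.1 hj).1)]
  refine abs_gridInner_flux_le hL hJ hK x0 xJ e0 eJ fun j hj => ?_
  have h1 := Ha j hj.le
  have h2 := Ha (j + 1) hj
  have e1 : cfluxLin a e j = e j * (a j + a j + a (j + 1))
      + e (j + 1) * (a (j + 1) + a (j + 1) + a j) := by
    simp only [cfluxLin]; ring
  have h5 : |a j + a j + a (j + 1)| ≤ 3 * K := by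
    have := abs_add_three (a j) (a j) (a (j + 1)); linarith
  have h6 : |a (j + 1) + a (j + 1) + a j| ≤ 3 * K := by
    have := abs_add_three (a (j + 1)) (a (j + 1)) (a j); linarith
  rw [e1]
  refine (abs_add_le _ _).trans ?_
  rw [abs_mul, abs_mul]
  have h7 := mul_le_mul_of_nonneg_left h5 (abs_nonneg (e j))
  have h8 := mul_le_mul_of_nonneg_left h6 (abs_nonneg (e (j + 1)))
  linarith

/-- Used for stability, where the memory term is merely nonnegative and gives no H¹ control. Tested
with e itself, the flux pairing is a telescoping difference of 3 a e² minus differences of `a` times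
the quadratic flux of e, so the derivative falls on `a` and the L² norm suffices. -/
theorem abs_gridInner_convecLin_self_le (hL : 0 < L) (hJ : 1 ≤ J) {a e : ℕ → ℝ} {K : ℝ}
    (e0 : e 0 = 0) (eJ : e J = 0) (hK : 0 ≤ K)
    (Ha : ∀ j < J, |a (j + 1) - a j| ≤ K * hStep L J) :
    |gridInner L J (convecLin (hStep L J) a e) e| ≤ K / 2 * gridNorm L J e ^ 2 := by
  have hh := hStep_pos hL hJ
  rw [gridInner_congr (fun j hj => convecLin_eq (hStep L J) a e (Finset.mem_Ico.1 hj).1),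
    gridInner_div_diff hL hJ _ (cfluxLin a e) e e0 eJ, abs_neg]
  have h1 : ∀ j, cfluxLin a e j * ((e (j + 1) - e j) / hStep L J)
      = (hStep L J)⁻¹ * (((fun i => 3 * a i * e i ^ 2) (j + 1) - (fun i => 3 * a i * e i ^ 2) j)
        - (a (j + 1) - a j) * cflux e j) := fun j => by
    simp only [cfluxLin, cflux]; ring
  simp only [h1]
  rw [← Finset.mul_sum, Finset.sum_sub_distrib, Finset.sum_range_sub fun i => 3 * a i * e i ^ 2]
  simp only [e0, eJ]
  have h2 : |∑ j ∈ Finset.range J, (a (j + 1) - a j) * cflux e j|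
      ≤ 3 * K * hStep L J * ∑ j ∈ Finset.Ico 1 J, e j ^ 2 := by
    calc _ ≤ ∑ j ∈ Finset.range J, |(a (j + 1) - a j) * cflux e j| :=
          Finset.abs_sum_le_sum_abs _ _
      _ ≤ ∑ j ∈ Finset.range J, K * hStep L J * (3 / 2 * (e j ^ 2 + e (j + 1) ^ 2)) := by
          refine Finset.sum_le_sum fun j hj => ?_
          rw [abs_mul]
          refine mul_le_mul (Ha j (Finset.mem_range.1 hj)) ?_ (abs_nonneg _) (by positivity)
          rw [abs_le]
          simp only [cflux]
          constructor <;> nlinarith [sq_nonneg (e j - e (j + 1)), sq_nonneg (e j + e (j + 1)),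
            sq_nonneg (e j), sq_nonneg (e (j + 1))]
      _ = _ := by
          rw [← Finset.mul_sum, ← Finset.mul_sum, Finset.sum_add_distrib,
            sum_range_eq_sum_Ico hJ (fun j => e j ^ 2) (by simp [e0]),
            sum_range_succ_eq_sum_Ico hJ (fun j => e j ^ 2) (by simp [eJ])]
          ring
  rw [gridNorm_sq hL hJ, gridInner]
  simp only [← sq]
  set S := ∑ j ∈ Finset.Ico 1 J, e j ^ 2
  set Q := ∑ j ∈ Finset.range J, (a (j + 1) - a j) * cflux e j
  have h3 : hStep L J ^ 2 / (6 * hStep L J) * ((hStep L J)⁻¹ *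
      (3 * a J * 0 ^ 2 - 3 * a 0 * 0 ^ 2 - Q)) = -(Q / 6) := by
    field_simp; ring
  rw [h3, abs_neg, abs_div, abs_of_pos (by norm_num : (0 : ℝ) < 6)]
  linarith

/-! ### Inverse, Poincaré and elliptic estimates -/

theorem gridSemi_le (hL : 0 < L) (hJ : 1 ≤ J) {w : ℕ → ℝ} (w0 : w 0 = 0) (wJ : w J = 0) :
    gridSemi L J w ≤ 2 / hStep L J * gridNorm L J w := by
  have hh := hStep_pos hL hJ
  refine abs_le_of_sq_le_sq' ?_ (by have := gridNorm_nonneg L J w; positivity) |>.2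
  rw [gridSemi_sq hL hJ, mul_pow, gridNorm_sq hL hJ, gridInner]
  have : ∑ j ∈ Finset.range J, ((w (j + 1) - w j) / hStep L J) ^ 2
      ≤ ∑ j ∈ Finset.range J, 2 / hStep L J ^ 2 * (w j ^ 2 + w (j + 1) ^ 2) := by
    refine Finset.sum_le_sum fun j _ => ?_
    rw [div_pow, div_mul_eq_mul_div]
    gcongr
    nlinarith [sq_nonneg (w j + w (j + 1))]
  rw [← Finset.mul_sum, Finset.sum_add_distrib,
    sum_range_eq_sum_Ico hJ (fun j => w j ^ 2) (by simp [w0]),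
    sum_range_succ_eq_sum_Ico hJ (fun j => w j ^ 2) (by simp [wJ])] at this
  simp only [← sq]
  calc _ ≤ hStep L J * _ := mul_le_mul_of_nonneg_left this hh.le
    _ = _ := by ring

/-- Discrete Poincaré inequality: each value telescopes from the left end, followed by
Cauchy-Schwarz. -/
theorem gridNorm_le_gridSemi (hL : 0 < L) (hJ : 1 ≤ J) {w : ℕ → ℝ} (w0 : w 0 = 0) :
    gridNorm L J w ≤ L * gridSemi L J w := by
  have hh := hStep_pos hL hJ
  refine abs_le_of_sq_le_sq' ?_ (mul_nonneg hL.le (gridSemi_nonneg ..)) |>.2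
  rw [gridNorm_sq hL hJ, mul_pow, gridSemi_sq hL hJ, gridInner]
  simp only [← sq]
  set S := ∑ j ∈ Finset.range J, (w (j + 1) - w j) ^ 2 with hS
  have hSn : 0 ≤ S := Finset.sum_nonneg fun _ _ => sq_nonneg _
  have h1 : ∀ j ∈ Finset.Ico 1 J, w j ^ 2 ≤ J * S := fun j hj => by
    have hj2 := (Finset.mem_Ico.1 hj).2
    have e : w j = ∑ i ∈ Finset.range j, (w (i + 1) - w i) := by
      rw [Finset.sum_range_sub, w0, sub_zero]
    rw [e]
    refine (sq_sum_le_card_mul_sum_sq (s := Finset.range j)).trans ?_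
    rw [Finset.card_range]
    refine mul_le_mul (by exact_mod_cast hj2.le) ?_ (Finset.sum_nonneg fun _ _ => sq_nonneg _)
      (by positivity)
    exact Finset.sum_le_sum_of_subset_of_nonneg (Finset.range_mono hj2.le)
      fun _ _ _ => sq_nonneg _
  have h2 : ∑ j ∈ Finset.Ico 1 J, w j ^ 2 ≤ J * (J * S) := by
    calc _ ≤ ∑ j ∈ Finset.Ico 1 J, (J * S : ℝ) := Finset.sum_le_sum h1
      _ = ((J - 1 : ℕ) : ℝ) * (J * S) := by simp
      _ ≤ _ := by gcongr; omega
  have h3 : ∑ j ∈ Finset.range J, ((w (j + 1) - w j) / hStep L J) ^ 2 = S / hStep L J ^ 2 := by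
    simp only [div_pow, ← Finset.sum_div, hS]
  rw [h3]
  have h4 : L ^ 2 * (hStep L J * (S / hStep L J ^ 2)) = hStep L J * (J * (J * S)) := by
    have h5 : (J * hStep L J) ^ 2 = L ^ 2 := by rw [mul_hStep hJ]
    rw [← h5]
    field_simp
  rw [h4]
  gcongr

/-- Combines the energy identity with Poincaré. The time regularity is assumed for u_xx only;
through this bound it also controls lower-order differences, hence convection. -/
theorem gridSemi_le_secondDiff (hL : 0 < L) (hJ : 1 ≤ J) {w : ℕ → ℝ} (w0 : w 0 = 0)
    (wJ : w J = 0) :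
    gridSemi L J w ≤ L * gridNorm L J (secondDiff (hStep L J) w) := by
  have h1 := abs_gridInner_le hL hJ (secondDiff (hStep L J) w) w
  rw [gridInner_secondDiff_self hL hJ w w0 wJ, abs_neg, abs_of_nonneg (sq_nonneg _)] at h1
  have h2 := gridNorm_le_gridSemi hL hJ w0
  have h3 := gridSemi_nonneg L J w
  have h4 := gridNorm_nonneg L J (secondDiff (hStep L J) w)
  by_contra! hc
  have h5 := mul_le_mul_of_nonneg_left h2 h4
  have h6 : 0 ≤ L * gridNorm L J (secondDiff (hStep L J) w) := by positivity
  nlinarith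

theorem gridNorm_localMean_le (hL : 0 < L) (hJ : 1 ≤ J) {w : ℕ → ℝ} (w0 : w 0 = 0)
    (wJ : w J = 0) : gridNorm L J (localMean w) ≤ gridNorm L J w := by
  have hh := hStep_pos hL hJ
  refine Real.sqrt_le_sqrt (mul_le_mul_of_nonneg_left ?_ hh.le)
  have h1 : ∑ j ∈ Finset.Ico 1 J, localMean w j ^ 2
      ≤ ∑ j ∈ Finset.Ico 1 J, (w (j - 1) ^ 2 + w j ^ 2 + w (j + 1) ^ 2) / 3 := by
    refine Finset.sum_le_sum fun j _ => ?_
    simp only [localMean]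
    nlinarith [sq_nonneg (w (j - 1) - w j), sq_nonneg (w (j - 1) - w (j + 1)),
      sq_nonneg (w j - w (j + 1))]
  rw [← Finset.sum_div, Finset.sum_add_distrib, Finset.sum_add_distrib] at h1
  have h2 : ∑ j ∈ Finset.Ico 1 J, w (j - 1) ^ 2 ≤ ∑ j ∈ Finset.Ico 1 J, w j ^ 2 := by
    rw [← sum_range_eq_sum_Ico hJ (fun j => w j ^ 2) (by simp [w0])]
    obtain ⟨M, rfl⟩ : ∃ M, J = M + 1 := ⟨J - 1, by omega⟩
    have : ∑ j ∈ Finset.Ico 1 (M + 1), w (j - 1) ^ 2 = ∑ j ∈ Finset.range M, w j ^ 2 := by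
      rw [Finset.range_eq_Ico]
      have := Finset.sum_Ico_add' (fun j => w (j - 1) ^ 2) 0 M 1
      simpa using this.symm
    rw [this]
    exact Finset.sum_le_sum_of_subset_of_nonneg (Finset.range_mono (by omega))
      fun _ _ _ => sq_nonneg _
  have h3 : ∑ j ∈ Finset.Ico 1 J, w (j + 1) ^ 2 ≤ ∑ j ∈ Finset.Ico 1 J, w j ^ 2 := by
    rw [← sum_range_succ_eq_sum_Ico hJ (fun j => w j ^ 2) (by simp [wJ])]
    refine Finset.sum_le_sum_of_subset_of_nonneg (fun j hj => ?_) fun _ _ _ => sq_nonneg _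
    simp at hj ⊢; omega
  linarith

theorem gridNorm_centralDiff_le (hL : 0 < L) (hJ : 1 ≤ J) (w : ℕ → ℝ) :
    gridNorm L J (centralDiff (hStep L J) w) ≤ gridSemi L J w := by
  have hh := hStep_pos hL hJ
  refine Real.sqrt_le_sqrt (mul_le_mul_of_nonneg_left ?_ hh.le)
  set d : ℕ → ℝ := fun j => (w (j + 1) - w j) / hStep L J with hd
  have h1 : ∑ j ∈ Finset.Ico 1 J, centralDiff (hStep L J) w j ^ 2
      ≤ ∑ j ∈ Finset.Ico 1 J, (d (j - 1) ^ 2 + d j ^ 2) / 2 := by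
    refine Finset.sum_le_sum fun j hj => ?_
    obtain ⟨i, rfl⟩ : ∃ i, j = i + 1 := ⟨j - 1, by have := Finset.mem_Ico.1 hj; omega⟩
    have : centralDiff (hStep L J) w (i + 1) = (d i + d (i + 1)) / 2 := by
      simp only [centralDiff, hd, Nat.add_sub_cancel]; field_simp; ring
    rw [this, Nat.add_sub_cancel]
    nlinarith [sq_nonneg (d i - d (i + 1))]
  rw [← Finset.sum_div, Finset.sum_add_distrib] at h1
  have h2 : ∑ j ∈ Finset.Ico 1 J, d (j - 1) ^ 2 ≤ ∑ j ∈ Finset.range J, d j ^ 2 := by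
    obtain ⟨M, rfl⟩ : ∃ M, J = M + 1 := ⟨J - 1, by omega⟩
    have : ∑ j ∈ Finset.Ico 1 (M + 1), d (j - 1) ^ 2 = ∑ j ∈ Finset.range M, d j ^ 2 := by
      rw [Finset.range_eq_Ico]
      have := Finset.sum_Ico_add' (fun j => d (j - 1) ^ 2) 0 M 1
      simpa using this.symm
    rw [this]
    exact Finset.sum_le_sum_of_subset_of_nonneg (Finset.range_mono (by omega))
      fun _ _ _ => sq_nonneg _
  have h3 : ∑ j ∈ Finset.Ico 1 J, d j ^ 2 ≤ ∑ j ∈ Finset.range J, d j ^ 2 := by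
    refine Finset.sum_le_sum_of_subset_of_nonneg (fun j hj => ?_) fun _ _ _ => sq_nonneg _
    simp at hj ⊢; omega
  linarith

/-- The convective term is Lipschitz with respect to the second difference, at grid functions
with bounded values and difference quotients. -/
theorem gridNorm_convec_sub_le (hL : 0 < L) (hJ : 1 ≤ J) {a b : ℕ → ℝ} {K₀ K₁ : ℝ}
    (hK₀ : 0 ≤ K₀) (hK₁ : 0 ≤ K₁) (h0 : a 0 = b 0) (hJJ : a J = b J)
    (Ha : ∀ j ∈ Finset.Ico 1 J, |centralDiff (hStep L J) a j| ≤ K₁)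
    (Hb : ∀ j ∈ Finset.Ico 1 J, |localMean b j| ≤ K₀) :
    gridNorm L J (fun j => convec (hStep L J) a j - convec (hStep L J) b j)
      ≤ (K₁ * L + K₀) * L * gridNorm L J (secondDiff (hStep L J) fun j => a j - b j) := by
  set v : ℕ → ℝ := fun j => a j - b j with hv
  have v0 : v 0 = 0 := by simp [hv, h0]
  have vJ : v J = 0 := by simp [hv, hJJ]
  have e : ∀ j, convec (hStep L J) a j - convec (hStep L J) b j
      = localMean v j * centralDiff (hStep L J) a j
        + localMean b j * centralDiff (hStep L J) v j := fun j => by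
    simp only [convec, localMean, centralDiff, hv]; ring
  simp only [e]
  have h1 : gridNorm L J (fun j => localMean v j * centralDiff (hStep L J) a j)
      ≤ K₁ * gridNorm L J v := by
    calc _ ≤ gridNorm L J (fun j => K₁ * localMean v j) := by
          refine gridNorm_mono hL hJ fun j hj => ?_
          rw [abs_mul, abs_mul, abs_of_nonneg hK₁, mul_comm]
          gcongr
          exact Ha j hj
      _ = K₁ * gridNorm L J (localMean v) := by rw [gridNorm_smul, abs_of_nonneg hK₁]
      _ ≤ _ := by gcongr; exact gridNorm_localMean_le hL hJ v0 vJ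
  have h2 : gridNorm L J (fun j => localMean b j * centralDiff (hStep L J) v j)
      ≤ K₀ * gridSemi L J v := by
    calc _ ≤ gridNorm L J (fun j => K₀ * centralDiff (hStep L J) v j) := by
          refine gridNorm_mono hL hJ fun j hj => ?_
          rw [abs_mul, abs_mul, abs_of_nonneg hK₀]
          gcongr
          exact Hb j hj
      _ = K₀ * gridNorm L J (centralDiff (hStep L J) v) := by
          rw [gridNorm_smul, abs_of_nonneg hK₀]
      _ ≤ _ := by gcongr; exact gridNorm_centralDiff_le hL hJ v
  have h3 := gridNorm_le_gridSemi hL hJ v0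
  have h4 := gridSemi_le_secondDiff hL hJ v0 vJ
  calc _ ≤ _ := gridNorm_add_le hL hJ _ _
    _ ≤ K₁ * (L * gridSemi L J v) + K₀ * gridSemi L J v := by
        refine add_le_add (h1.trans ?_) h2
        gcongr
    _ = (K₁ * L + K₀) * gridSemi L J v := by ring
    _ ≤ (K₁ * L + K₀) * (L * gridNorm L J (secondDiff (hStep L J) v)) := by gcongr
    _ = _ := by ring

end

/-! ### The weights of the product integration rule -/

/-- The unnormalised weight `∫_{t_{n-1}}^{t_n} ∫_{t_{s-1}}^{min(τ, t_s)} β(τ - ζ) dζ dτ`. -/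
noncomputable def kernelMass (α : ℝ) (t : ℕ → ℝ) (n s : ℕ) : ℝ :=
  ∫ τ in (t (n - 1))..(t n), ∫ ζ in (t (s - 1))..(min τ (t s)), abelKernel α (τ - ζ)

/-- The first primitive of the Abel kernel, extended by zero. -/
noncomputable def abelPrim (α x : ℝ) : ℝ := max x 0 ^ α / Real.Gamma (α + 1)

/-- The second primitive of the Abel kernel, extended by zero. -/
noncomputable def abelPrim₂ (α x : ℝ) : ℝ := max x 0 ^ (α + 1) / Real.Gamma (α + 2)

theorem abelPrim_nonneg {α : ℝ} (hα : 0 < α) (x : ℝ) : 0 ≤ abelPrim α x :=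
  div_nonneg (Real.rpow_nonneg (le_max_right _ _) _) (Real.Gamma_pos_of_pos (by linarith)).le

theorem abelPrim_mono {α : ℝ} (hα : 0 < α) : Monotone (abelPrim α) := fun x y hxy =>
  div_le_div_of_nonneg_right (Real.rpow_le_rpow (le_max_right _ _) (max_le_max_right _ hxy) hα.le)
    (Real.Gamma_pos_of_pos (by linarith)).le

theorem abelPrim_of_nonpos {α : ℝ} (hα : 0 < α) {x : ℝ} (hx : x ≤ 0) : abelPrim α x = 0 := by
  rw [abelPrim, max_eq_right hx, Real.zero_rpow hα.ne', zero_div]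

theorem abelPrim₂_of_nonpos {α : ℝ} (hα : 0 < α) {x : ℝ} (hx : x ≤ 0) : abelPrim₂ α x = 0 := by
  rw [abelPrim₂, max_eq_right hx, Real.zero_rpow (by linarith), zero_div]

theorem continuous_abelPrim {α : ℝ} (hα : 0 < α) : Continuous (abelPrim α) := by
  unfold abelPrim
  exact ((continuous_id.max continuous_const).rpow_const fun x => Or.inr hα.le).div_const _

theorem abelKernel_nonneg {α x : ℝ} (hα : 0 < α) (hx : 0 ≤ x) : 0 ≤ abelKernel α x :=
  div_nonneg (Real.rpow_nonneg hx _) (Real.Gamma_pos_of_pos hα).le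

theorem intervalIntegrable_abelKernel_sub {α : ℝ} (hα : 0 < α) (τ a b : ℝ) :
    IntervalIntegrable (fun ζ => abelKernel α (τ - ζ)) MeasureTheory.volume a b := by
  have h1 : IntervalIntegrable (fun x : ℝ => abelKernel α x) MeasureTheory.volume (τ - a) (τ - b) :=
    (intervalIntegral.intervalIntegrable_rpow' (by linarith)).div_const _
  simpa using h1.comp_sub_left τ

theorem integral_abelKernel_sub {α : ℝ} (hα : 0 < α) {τ a b : ℝ} (ha : a ≤ τ) (hb : b ≤ τ) :
    ∫ ζ in a..b, abelKernel α (τ - ζ) = abelPrim α (τ - a) - abelPrim α (τ - b) := by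
  rw [intervalIntegral.integral_comp_sub_left (fun x => abelKernel α x)]
  simp only [abelKernel, abelPrim, intervalIntegral.integral_div]
  rw [integral_rpow (Or.inl (by linarith)), max_eq_left (by linarith), max_eq_left (by linarith),
    Real.Gamma_add_one hα.ne', sub_add_cancel]
  have := (Real.Gamma_pos_of_pos hα).ne'
  field_simp

/-- Extending the primitive by zero absorbs the minimum: for τ ≤ b the second term vanishes. A
single formula then serves the diagonal and the off-diagonal weights. -/
theorem integral_abelKernel_sub_min {α : ℝ} (hα : 0 < α) {τ a b : ℝ} (ha : a ≤ τ) :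
    ∫ ζ in a..(min τ b), abelKernel α (τ - ζ) = abelPrim α (τ - a) - abelPrim α (τ - b) := by
  rw [integral_abelKernel_sub hα ha (min_le_left _ _)]
  rcases le_total τ b with h | h
  · rw [min_eq_left h, abelPrim_of_nonpos hα (by linarith : τ - τ ≤ 0),
      abelPrim_of_nonpos hα (by linarith : τ - b ≤ 0)]
  · rw [min_eq_right h]

theorem integral_abelPrim {α : ℝ} (hα : 0 < α) {c d : ℝ} (hc : 0 ≤ c) (hcd : c ≤ d) :
    ∫ x in c..d, abelPrim α x = abelPrim₂ α d - abelPrim₂ α c := by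
  have h1 : ∫ x in c..d, abelPrim α x = ∫ x in c..d, x ^ α / Real.Gamma (α + 1) := by
    refine intervalIntegral.integral_congr fun x hx => ?_
    rw [uIcc_of_le hcd] at hx
    simp only [abelPrim, max_eq_left (hc.trans hx.1)]
  rw [h1, intervalIntegral.integral_div, integral_rpow (Or.inl (by linarith)), abelPrim₂, abelPrim₂,
    max_eq_left hc, max_eq_left (hc.trans hcd), show α + 2 = α + 1 + 1 by ring,
    Real.Gamma_add_one (by linarith : α + 1 ≠ 0)]
  have := (Real.Gamma_pos_of_pos (by linarith : 0 < α + 1)).ne'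
  field_simp

theorem integral_abelPrim_sub {α : ℝ} (hα : 0 < α) {a c d : ℝ} (hcd : c ≤ d)
    (h : a ≤ c ∨ d ≤ a) :
    ∫ τ in c..d, abelPrim α (τ - a) = abelPrim₂ α (d - a) - abelPrim₂ α (c - a) := by
  rcases h with h | h
  · rw [intervalIntegral.integral_comp_sub_right (abelPrim α), integral_abelPrim hα (by linarith)
      (by linarith)]
  · rw [abelPrim₂_of_nonpos hα (by linarith), abelPrim₂_of_nonpos hα (by linarith), sub_zero]
    apply intervalIntegral.integral_zero_ae
    filter_upwards with τ hτ
    rw [uIoc_of_le hcd] at hτ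
    exact abelPrim_of_nonpos hα (by linarith [hτ.2])

theorem abelPrim₂_sub_le {α : ℝ} (hα : 0 < α) {c d T : ℝ} (hc : 0 ≤ c) (hcd : c ≤ d) (hd : d ≤ T) :
    abelPrim₂ α d - abelPrim₂ α c ≤ abelPrim α T * (d - c) := by
  rw [← integral_abelPrim hα hc hcd]
  have := intervalIntegral.norm_integral_le_of_norm_le_const (a := c) (b := d) (f := abelPrim α)
    (C := abelPrim α T) fun x hx => by
      rw [uIoc_of_le hcd] at hx
      rw [Real.norm_of_nonneg (abelPrim_nonneg hα x)]
      exact abelPrim_mono hα (hx.2.trans hd)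
  rw [abs_of_nonneg (by linarith : 0 ≤ d - c)] at this
  exact (le_abs_self _).trans this

section

variable {t : ℕ → ℝ} {N : ℕ}

theorem mesh_mono (ht : ∀ n, 1 ≤ n → n ≤ N → t (n - 1) < t n) {i j : ℕ} (hij : i ≤ j)
    (hj : j ≤ N) : t i ≤ t j := by
  induction j, hij using Nat.le_induction with
  | base => exact le_rfl
  | succ j hij ih => exact (ih (by omega)).trans (ht (j + 1) (by omega) hj).le

/-- The weight is a mixed second difference of the second primitive in n and s. The row and column
sums therefore telescope, and positivity becomes a property of the function x^(α+1). -/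
theorem kernelMass_eq {α : ℝ} (hα : 0 < α) (ht : ∀ n, 1 ≤ n → n ≤ N → t (n - 1) < t n) {n s : ℕ}
    (hs : 1 ≤ s) (hsn : s ≤ n) (hn : n ≤ N) :
    kernelMass α t n s = (abelPrim₂ α (t n - t (s - 1)) - abelPrim₂ α (t n - t s))
      - (abelPrim₂ α (t (n - 1) - t (s - 1)) - abelPrim₂ α (t (n - 1) - t s)) := by
  have h1 : t (s - 1) ≤ t (n - 1) := mesh_mono ht (by omega) (by omega)
  have h2 : t (n - 1) ≤ t n := (ht n (by omega) hn).le
  have h3 : kernelMass α t n s = ∫ τ in (t (n - 1))..(t n),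
      (abelPrim α (τ - t (s - 1)) - abelPrim α (τ - t s)) := by
    refine intervalIntegral.integral_congr fun τ hτ => ?_
    rw [uIcc_of_le h2] at hτ
    exact integral_abelKernel_sub_min hα (h1.trans hτ.1)
  have h4 : t s ≤ t (n - 1) ∨ t n ≤ t s := by
    rcases eq_or_lt_of_le hsn with h | h
    · right; rw [h]
    · left; exact mesh_mono ht (by omega) (by omega)
  have hc : ∀ a, IntervalIntegrable (fun τ => abelPrim α (τ - a)) MeasureTheory.volume
      (t (n - 1)) (t n) := fun a =>
    ((continuous_abelPrim hα).comp (continuous_id.sub continuous_const)).intervalIntegrable _ _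
  rw [h3, intervalIntegral.integral_sub (hc _) (hc _), integral_abelPrim_sub hα h2 (Or.inl h1),
    integral_abelPrim_sub hα h2 h4]
  ring

theorem kernelMass_nonneg {α : ℝ} (hα : 0 < α) (ht : ∀ n, 1 ≤ n → n ≤ N → t (n - 1) < t n)
    {n s : ℕ} (hs : 1 ≤ s) (hsn : s ≤ n) (hn : n ≤ N) : 0 ≤ kernelMass α t n s := by
  have h1 : t (s - 1) ≤ t (n - 1) := mesh_mono ht (by omega) (by omega)
  have h2 : t (n - 1) ≤ t n := (ht n (by omega) hn).le
  refine intervalIntegral.integral_nonneg h2 fun τ hτ => ?_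
  rw [integral_abelKernel_sub_min hα (h1.trans hτ.1)]
  have := abelPrim_mono hα
    (sub_le_sub_left (ht s hs (hsn.trans hn)).le τ : τ - t s ≤ τ - t (s - 1))
  linarith

/-- On the diagonal three of the four terms vanish. This is the coefficient of the elliptic part in
the one-step problem. -/
theorem kernelMass_self {α : ℝ} (hα : 0 < α) (ht : ∀ n, 1 ≤ n → n ≤ N → t (n - 1) < t n)
    {n : ℕ} (h1 : 1 ≤ n) (hn : n ≤ N) :
    kernelMass α t n n = tStep t n ^ (α + 1) / Real.Gamma (α + 2) := by
  have h2 := ht n h1 hn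
  rw [kernelMass_eq hα ht h1 le_rfl hn, abelPrim₂_of_nonpos hα (by linarith : t n - t n ≤ 0),
    abelPrim₂_of_nonpos hα (by linarith : t (n - 1) - t n ≤ 0),
    abelPrim₂_of_nonpos hα (by linarith : t (n - 1) - t (n - 1) ≤ 0), abelPrim₂,
    max_eq_left (by linarith), tStep]
  ring

theorem sum_Icc_sub (g : ℕ → ℝ) {a b : ℕ} (hab : a ≤ b) :
    ∑ i ∈ Finset.Icc a b, (g i - g (i - 1)) = g b - g (a - 1) := by
  induction b, hab using Nat.le_induction with
  | base => simp
  | succ b hab ih =>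
    rw [Finset.sum_Icc_succ_top (by omega), ih]
    simp only [Nat.add_sub_cancel]
    ring

theorem sum_kernelMass_row_le {α T : ℝ} (hα : 0 < α)
    (ht : ∀ n, 1 ≤ n → n ≤ N → t (n - 1) < t n) (h0 : t 0 = 0) (hT : t N ≤ T) {n : ℕ}
    (h1 : 1 ≤ n) (hn : n ≤ N) :
    ∑ s ∈ Finset.Icc 1 n, kernelMass α t n s ≤ abelPrim α T * tStep t n := by
  have h2 := ht n h1 hn
  have h3 : ∑ s ∈ Finset.Icc 1 n, kernelMass α t n s = ∑ s ∈ Finset.Icc 1 n,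
      ((fun s => abelPrim₂ α (t (n - 1) - t s) - abelPrim₂ α (t n - t s)) s
        - (fun s => abelPrim₂ α (t (n - 1) - t s) - abelPrim₂ α (t n - t s)) (s - 1)) := by
    refine Finset.sum_congr rfl fun s hs => ?_
    rw [kernelMass_eq hα ht (Finset.mem_Icc.1 hs).1 (Finset.mem_Icc.1 hs).2 hn]
    ring
  rw [h3, sum_Icc_sub _ h1]
  simp only [Nat.sub_self, h0, sub_zero]
  rw [abelPrim₂_of_nonpos hα (by linarith : t (n - 1) - t n ≤ 0),
    abelPrim₂_of_nonpos hα (by linarith : t n - t n ≤ 0), tStep]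
  have h4 : 0 ≤ t (n - 1) := by rw [← h0]; exact mesh_mono ht (by omega) (by omega)
  have := abelPrim₂_sub_le hα h4 h2.le ((mesh_mono ht hn le_rfl).trans hT)
  linarith

/-- Telescoping in n for fixed s. It bounds the total influence of the s-th interval on all later
steps, so local quadrature errors can be summed without loss. -/
theorem sum_kernelMass_col_le {α T : ℝ} (hα : 0 < α)
    (ht : ∀ n, 1 ≤ n → n ≤ N → t (n - 1) < t n) (h0 : t 0 = 0) (hT : t N ≤ T) {s m : ℕ}
    (hs : 1 ≤ s) (hsm : s ≤ m) (hm : m ≤ N) :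
    ∑ n ∈ Finset.Icc s m, kernelMass α t n s ≤ abelPrim α T * tStep t s := by
  have h2 := ht s hs (hsm.trans hm)
  have h3 : ∑ n ∈ Finset.Icc s m, kernelMass α t n s = ∑ n ∈ Finset.Icc s m,
      ((fun n => abelPrim₂ α (t n - t (s - 1)) - abelPrim₂ α (t n - t s)) n
        - (fun n => abelPrim₂ α (t n - t (s - 1)) - abelPrim₂ α (t n - t s)) (n - 1)) := by
    refine Finset.sum_congr rfl fun n hn => ?_
    rw [kernelMass_eq hα ht hs (Finset.mem_Icc.1 hn).1 ((Finset.mem_Icc.1 hn).2.trans hm)]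
  rw [h3, sum_Icc_sub _ hsm]
  rw [abelPrim₂_of_nonpos hα (by linarith : t (s - 1) - t (s - 1) ≤ 0),
    abelPrim₂_of_nonpos hα (by linarith : t (s - 1) - t s ≤ 0), tStep]
  have h4 : 0 ≤ t (s - 1) := by rw [← h0]; exact mesh_mono ht (by omega) (by omega)
  have h5 : t s ≤ t m := mesh_mono ht hsm hm
  have h6 : t m ≤ T := (mesh_mono ht hm le_rfl).trans hT
  have := abelPrim₂_sub_le hα (by linarith : 0 ≤ t m - t s) (by linarith : t m - t s ≤ t m - t (s - 1))
    (by linarith : t m - t (s - 1) ≤ T)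
  linarith

end

/-! ### Positivity of the discrete fractional integral -/

/-- Near 0 the bound 1 - cos y ≤ y²/2 leaves r^(1-p), integrable as p < 2; at infinity the integrand
is at most 2 r^(-1-p). -/
theorem integrableOn_one_sub_cos_mul_rpow {p : ℝ} (hp : 1 < p) (hp2 : p < 2) (x : ℝ) :
    MeasureTheory.IntegrableOn (fun r : ℝ => (1 - Real.cos (x * r)) * r ^ (-1 - p)) (Ioi 0) := by
  have hm : Measurable fun r : ℝ => (1 - Real.cos (x * r)) * r ^ (-1 - p) := by fun_prop
  rw [← Ioc_union_Ioi_eq_Ioi (zero_le_one (α := ℝ))]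
  refine MeasureTheory.IntegrableOn.union ?_ ?_
  · have h1 : MeasureTheory.IntegrableOn (fun r : ℝ => x ^ 2 / 2 * r ^ (1 - p)) (Ioc 0 1) := by
      have := intervalIntegral.intervalIntegrable_rpow' (a := 0) (b := 1) (r := 1 - p) (by linarith)
      rw [intervalIntegrable_iff_integrableOn_Ioc_of_le zero_le_one] at this
      exact this.const_mul _
    refine h1.mono' hm.aestronglyMeasurable ?_
    filter_upwards [MeasureTheory.ae_restrict_mem measurableSet_Ioc] with r hr
    have h2 := Real.one_sub_sq_div_two_le_cos (x := x * r)
    have h3 := Real.cos_le_one (x * r)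
    have h4 : r ^ (1 - p) = r ^ 2 * r ^ (-1 - p) := by
      rw [← Real.rpow_natCast, ← Real.rpow_add hr.1]; congr 1; push_cast; ring
    have h5 : 0 ≤ r ^ (-1 - p) := Real.rpow_nonneg hr.1.le _
    rw [Real.norm_of_nonneg (mul_nonneg (by linarith) h5), h4, ← mul_assoc]
    gcongr
    nlinarith
  · have h1 : MeasureTheory.IntegrableOn (fun r : ℝ => 2 * r ^ (-1 - p)) (Ioi 1) :=
      (integrableOn_Ioi_rpow_of_lt (by linarith) one_pos).const_mul _
    refine h1.mono' hm.aestronglyMeasurable ?_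
    filter_upwards [MeasureTheory.ae_restrict_mem measurableSet_Ioi] with r hr
    have h3 := Real.cos_le_one (x * r)
    have h6 := Real.neg_one_le_cos (x * r)
    have h5 : 0 ≤ r ^ (-1 - p) := Real.rpow_nonneg (zero_le_one.trans (le_of_lt hr)) _
    rw [Real.norm_of_nonneg (mul_nonneg (by linarith) h5)]
    gcongr
    linarith

/-- The substitution r ↦ |x| r. It represents |x|^p as a superposition of the functions 1 - cos(xr),
for which the sign of mixed differences is explicit. -/
theorem integral_one_sub_cos_mul_rpow {p : ℝ} (hp : 1 < p) (x : ℝ) :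
    ∫ r in Ioi (0 : ℝ), (1 - Real.cos (x * r)) * r ^ (-1 - p)
      = |x| ^ p * ∫ r in Ioi (0 : ℝ), (1 - Real.cos r) * r ^ (-1 - p) := by
  rcases eq_or_ne x 0 with rfl | hx
  · simp [Real.zero_rpow (by linarith : p ≠ 0)]
  have hx' : 0 < |x| := abs_pos.2 hx
  have h1 := MeasureTheory.integral_comp_mul_left_Ioi
    (fun r : ℝ => (1 - Real.cos r) * r ^ (-1 - p)) 0 hx'
  rw [mul_zero] at h1
  have h2 : ∫ r in Ioi (0 : ℝ), (1 - Real.cos (x * r)) * r ^ (-1 - p)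
      = |x| ^ (1 + p) * ∫ r in Ioi (0 : ℝ), (1 - Real.cos (|x| * r)) * (|x| * r) ^ (-1 - p) := by
    rw [← MeasureTheory.integral_const_mul]
    refine MeasureTheory.setIntegral_congr_fun measurableSet_Ioi fun r hr => ?_
    have hr0 : 0 ≤ r := le_of_lt hr
    rw [Real.mul_rpow hx'.le hr0, show |x| * r = |x * r| by rw [abs_mul, abs_of_nonneg hr0],
      Real.cos_abs]
    have : |x| ^ (1 + p) * |x| ^ (-1 - p) = 1 := by
      rw [← Real.rpow_add hx']; simp
    linear_combination (-(1 - Real.cos (x * r)) * r ^ (-1 - p)) * this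
  rw [h2, h1, smul_eq_mul, Real.rpow_add hx', Real.rpow_one]
  field_simp

theorem integral_one_sub_cos_mul_rpow_pos {p : ℝ} (hp : 1 < p) (hp2 : p < 2) :
    0 < ∫ r in Ioi (0 : ℝ), (1 - Real.cos r) * r ^ (-1 - p) := by
  have hi : MeasureTheory.IntegrableOn (fun r : ℝ => (1 - Real.cos r) * r ^ (-1 - p)) (Ioi 0) := by
    simpa using integrableOn_one_sub_cos_mul_rpow hp hp2 1
  have hnn : ∀ r ∈ Ioi (0 : ℝ), 0 ≤ (1 - Real.cos r) * r ^ (-1 - p) := fun r hr =>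
    mul_nonneg (by linarith [Real.cos_le_one r]) (Real.rpow_nonneg (le_of_lt hr) _)
  rw [MeasureTheory.setIntegral_pos_iff_support_of_nonneg_ae
    ((MeasureTheory.ae_restrict_mem measurableSet_Ioi).mono hnn) hi]
  refine lt_of_lt_of_le ?_ (MeasureTheory.measure_mono (s := Ioo 0 1) fun r hr => ⟨?_, hr.1⟩)
  · simp
  · have h1 : Real.cos r < 1 := by
      have := Real.cos_lt_cos_of_nonneg_of_le_pi_div_two le_rfl
        (by linarith [Real.two_le_pi, hr.2] : r ≤ Real.pi / 2) hr.1
      simpa using this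
    exact (mul_pos (by linarith) (Real.rpow_pos_of_pos hr.1 _)).ne'

theorem sum_sum_symm (b : ℕ → ℕ → ℝ) (hb : ∀ i j, b i j = b j i) (m : ℕ) :
    ∑ n ∈ Finset.Icc 1 m, ∑ s ∈ Finset.Icc 1 m, b n s
      = ∑ n ∈ Finset.Icc 1 m, (2 * ∑ s ∈ Finset.Ico 1 n, b n s + b n n) := by
  induction m with
  | zero => simp
  | succ m ih =>
    rw [Finset.sum_Icc_succ_top (by omega), Finset.sum_Icc_succ_top (by omega)]
    simp only [Finset.sum_Icc_succ_top (show 1 ≤ m + 1 by omega), Finset.sum_add_distrib]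
    rw [ih]
    have h1 : ∑ x ∈ Finset.Icc 1 m, b x (m + 1) = ∑ x ∈ Finset.Ico 1 (m + 1), b (m + 1) x :=
      Finset.sum_congr (by ext; simp) fun x _ => hb _ _
    have h2 : ∑ x ∈ Finset.Icc 1 m, b (m + 1) x = ∑ x ∈ Finset.Ico 1 (m + 1), b (m + 1) x :=
      Finset.sum_congr (by ext; simp) fun x _ => rfl
    rw [h1, h2, ← Finset.sum_add_distrib]
    ring

/-- Mixed second differences of `-|x|^p`, `1 < p < 2`, form a positive semidefinite matrix. -/
theorem sum_sum_abs_rpow_nonneg {p : ℝ} (hp : 1 < p) (hp2 : p < 2) (t V : ℕ → ℝ) (m : ℕ) :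
    0 ≤ ∑ n ∈ Finset.Icc 1 m, ∑ s ∈ Finset.Icc 1 m,
      (|t n - t (s - 1)| ^ p + |t (n - 1) - t s| ^ p - |t n - t s| ^ p
        - |t (n - 1) - t (s - 1)| ^ p) * (V n * V s) := by
  set K := ∫ r in Ioi (0 : ℝ), (1 - Real.cos r) * r ^ (-1 - p) with hK
  have hKpos : 0 < K := integral_one_sub_cos_mul_rpow_pos hp hp2
  set c : ℝ → ℝ → ℝ := fun x r => (1 - Real.cos (x * r)) * r ^ (-1 - p) with hc
  have hci : ∀ x, MeasureTheory.Integrable (c x) (MeasureTheory.volume.restrict (Ioi 0)) :=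
    fun x => integrableOn_one_sub_cos_mul_rpow hp hp2 x
  have hcv : ∀ x, |x| ^ p * K = ∫ r in Ioi (0 : ℝ), c x r := fun x =>
    (integral_one_sub_cos_mul_rpow hp x).symm
  set F : ℕ → ℕ → ℝ → ℝ := fun n s r =>
    (c (t n - t (s - 1)) r + c (t (n - 1) - t s) r - c (t n - t s) r
      - c (t (n - 1) - t (s - 1)) r) * (V n * V s) with hF
  have hFi : ∀ n s, MeasureTheory.Integrable (F n s) (MeasureTheory.volume.restrict (Ioi 0)) :=
    fun n s => ((((hci _).add (hci _)).sub (hci _)).sub (hci _)).mul_const _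
  have hFv : ∀ n s, (|t n - t (s - 1)| ^ p + |t (n - 1) - t s| ^ p - |t n - t s| ^ p
        - |t (n - 1) - t (s - 1)| ^ p) * (V n * V s) * K = ∫ r in Ioi (0 : ℝ), F n s r := by
    intro n s
    have h1 : ∫ r in Ioi (0 : ℝ), F n s r = ((∫ r in Ioi (0 : ℝ), c (t n - t (s - 1)) r)
        + (∫ r in Ioi (0 : ℝ), c (t (n - 1) - t s) r) - (∫ r in Ioi (0 : ℝ), c (t n - t s) r)
        - ∫ r in Ioi (0 : ℝ), c (t (n - 1) - t (s - 1)) r) * (V n * V s) := by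
      have i1 : ∀ x y, MeasureTheory.Integrable (fun r => c x r + c y r)
          (MeasureTheory.volume.restrict (Ioi 0)) := fun x y => (hci x).add (hci y)
      have i2 : ∀ x y z, MeasureTheory.Integrable (fun r => c x r + c y r - c z r)
          (MeasureTheory.volume.restrict (Ioi 0)) := fun x y z => (i1 x y).sub (hci z)
      simp only [hF]
      rw [MeasureTheory.integral_mul_const, MeasureTheory.integral_sub (i2 _ _ _) (hci _),
        MeasureTheory.integral_sub (i1 _ _) (hci _), MeasureTheory.integral_add (hci _) (hci _)]
    rw [h1, ← hcv, ← hcv, ← hcv, ← hcv]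
    ring
  refine nonneg_of_mul_nonneg_left ?_ hKpos
  simp only [Finset.sum_mul, hFv]
  have h2 : ∑ n ∈ Finset.Icc 1 m, ∑ s ∈ Finset.Icc 1 m, ∫ r in Ioi (0 : ℝ), F n s r
      = ∫ r in Ioi (0 : ℝ), ∑ n ∈ Finset.Icc 1 m, ∑ s ∈ Finset.Icc 1 m, F n s r := by
    rw [MeasureTheory.integral_finsetSum _ fun n _ =>
      MeasureTheory.integrable_finsetSum _ fun s _ => hFi n s]
    refine Finset.sum_congr rfl fun n _ => ?_
    rw [MeasureTheory.integral_finsetSum _ fun s _ => hFi n s]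
  rw [h2]
  refine MeasureTheory.setIntegral_nonneg measurableSet_Ioi fun r hr => ?_
  -- In the mixed difference the constants 1 cancel, and the addition formula for cos(t_n r - t_s r)
  -- factors the rest into a cosine product and a sine product. Summing over n and s therefore gives
  -- two squares.
  have h3 : ∀ n s, F n s r = r ^ (-1 - p) *
      ((V n * (Real.cos (t n * r) - Real.cos (t (n - 1) * r)))
          * (V s * (Real.cos (t s * r) - Real.cos (t (s - 1) * r)))
        + (V n * (Real.sin (t n * r) - Real.sin (t (n - 1) * r)))
          * (V s * (Real.sin (t s * r) - Real.sin (t (s - 1) * r)))) := fun n s => by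
    simp only [hF, hc, sub_mul (t _) (t _) r, Real.cos_sub]
    ring
  simp only [h3, ← Finset.mul_sum, Finset.sum_add_distrib, ← Finset.sum_mul]
  exact mul_nonneg (Real.rpow_nonneg (le_of_lt hr) _)
    (add_nonneg (mul_self_nonneg _) (mul_self_nonneg _))

/-- The symmetric matrix of mixed differences of -|x|^(α+1) is Γ(α+2) times the weights below the
diagonal. On the diagonal it is twice that, since the two off-centre terms coincide. Its full
quadratic form is thus 2Γ(α+2) times the triangular sum. -/
theorem sum_sum_kernelMass_nonneg {α : ℝ} {t : ℕ → ℝ} {N : ℕ} (hα : 0 < α) (hα1 : α < 1)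
    (ht : ∀ n, 1 ≤ n → n ≤ N → t (n - 1) < t n) (V : ℕ → ℝ) {m : ℕ} (hm : m ≤ N) :
    0 ≤ ∑ n ∈ Finset.Icc 1 m, ∑ s ∈ Finset.Icc 1 n, kernelMass α t n s * (V n * V s) := by
  have hΓ : 0 < Real.Gamma (α + 2) := Real.Gamma_pos_of_pos (by linarith)
  have h1 := sum_sum_abs_rpow_nonneg (by linarith : 1 < α + 1) (by linarith) t V m
  set b : ℕ → ℕ → ℝ := fun n s => (|t n - t (s - 1)| ^ (α + 1) + |t (n - 1) - t s| ^ (α + 1)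
    - |t n - t s| ^ (α + 1) - |t (n - 1) - t (s - 1)| ^ (α + 1)) * (V n * V s) with hb
  have hsymm : ∀ i j, b i j = b j i := fun i j => by
    simp only [hb]
    rw [abs_sub_comm (t i) (t (j - 1)), abs_sub_comm (t (i - 1)) (t j), abs_sub_comm (t i) (t j),
      abs_sub_comm (t (i - 1)) (t (j - 1))]
    ring
  rw [sum_sum_symm b hsymm m] at h1
  have h2 : ∀ x, 0 ≤ x → abelPrim₂ α x * Real.Gamma (α + 2) = |x| ^ (α + 1) := fun x hx => by
    rw [abelPrim₂, max_eq_left hx, abs_of_nonneg hx, div_mul_cancel₀ _ hΓ.ne']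
  have h3 : ∑ n ∈ Finset.Icc 1 m, (2 * ∑ s ∈ Finset.Ico 1 n, b n s + b n n)
      = 2 * Real.Gamma (α + 2) * ∑ n ∈ Finset.Icc 1 m, ∑ s ∈ Finset.Icc 1 n,
        kernelMass α t n s * (V n * V s) := by
    rw [Finset.mul_sum]
    refine Finset.sum_congr rfl fun n hn => ?_
    obtain ⟨hn1, hnm⟩ := Finset.mem_Icc.1 hn
    have e : ∑ s ∈ Finset.Icc 1 n, kernelMass α t n s * (V n * V s)
        = ∑ s ∈ Finset.Ico 1 n, kernelMass α t n s * (V n * V s)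
          + kernelMass α t n n * (V n * V n) := by
      obtain ⟨q, rfl⟩ : ∃ q, n = q + 1 := ⟨n - 1, by omega⟩
      rw [Finset.sum_Icc_succ_top (by omega),
        show Finset.Ico 1 (q + 1) = Finset.Icc 1 q by ext; simp]
    rw [e, mul_add]
    have hd : b n n = 2 * Real.Gamma (α + 2) * (kernelMass α t n n * (V n * V n)) := by
      have h4 := ht n hn1 (hnm.trans hm)
      rw [kernelMass_eq hα ht hn1 le_rfl (hnm.trans hm),
        abelPrim₂_of_nonpos hα (by linarith : t n - t n ≤ 0),
        abelPrim₂_of_nonpos hα (by linarith : t (n - 1) - t n ≤ 0),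
        abelPrim₂_of_nonpos hα (by linarith : t (n - 1) - t (n - 1) ≤ 0)]
      have h5 := h2 (t n - t (n - 1)) (by linarith)
      have h6 : |t (n - 1) - t n| = |t n - t (n - 1)| := abs_sub_comm _ _
      simp only [hb, h6, sub_self, abs_zero, Real.zero_rpow (by linarith : α + 1 ≠ 0)]
      rw [← h5]
      ring
    rw [hd]
    congr 1
    rw [mul_assoc 2]
    congr 1
    rw [Finset.mul_sum]
    refine Finset.sum_congr rfl fun s hs => ?_
    obtain ⟨hs1, hsn⟩ := Finset.mem_Ico.1 hs
    have h4 : t (s - 1) ≤ t s := (ht s hs1 (by omega)).le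
    have h5 : t s ≤ t (n - 1) := mesh_mono ht (by omega) (by omega)
    have h6 : t (n - 1) ≤ t n := (ht n hn1 (by omega)).le
    rw [kernelMass_eq hα ht hs1 hsn.le (hnm.trans hm)]
    simp only [hb]
    rw [← h2 (t n - t (s - 1)) (by linarith), ← h2 (t (n - 1) - t s) (by linarith),
      ← h2 (t n - t s) (by linarith), ← h2 (t (n - 1) - t (s - 1)) (by linarith)]
    ring
  rw [h3] at h1
  exact nonneg_of_mul_nonneg_right h1 (by linarith)

/-! ### Stability of the scheme -/

/-- The value at which the spatial operators are evaluated in the `n`-th step: `W^1` in the first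
step, and the mean `W^{n-1/2}` later. -/
noncomputable def stage (W : ℕ → ℝ) (n : ℕ) : ℝ := if n = 1 then W 1 else tMean W n

/-- The stage values of a family of grid functions. -/
noncomputable def stageGrid (e : ℕ → ℕ → ℝ) (n j : ℕ) : ℝ := stage (fun m => e m j) n

/-- The number of stage differences making up the time difference in the `n`-th step. -/
def stageMul (n : ℕ) : ℝ := if n = 1 then 1 else 2

theorem one_le_stageMul (n : ℕ) : 1 ≤ stageMul n := by
  unfold stageMul; split_ifs <;> norm_num

/-- Makes the stage value the only unknown of a step: the first step is of backward Euler type with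
factor 1, the later ones of midpoint type with factor 2. -/
theorem stageMul_mul_stage_sub (W : ℕ → ℝ) (n : ℕ) :
    stageMul n * (stage W n - W (n - 1)) = W n - W (n - 1) := by
  unfold stageMul stage tMean
  split_ifs with h
  · simp [h]
  · ring

theorem stage_sub (W W' : ℕ → ℝ) (n : ℕ) :
    stage (fun m => W m - W' m) n = stage W n - stage W' n := by
  unfold stage tMean; split_ifs <;> ring

/-- Index 0 enters no stage: the first one is `W 1`, and the means start at n = 2. Hence the
boundary values at time level 0, which the scheme leaves free, play no role. -/
theorem stage_congr {W W' : ℕ → ℝ} {n : ℕ} (hn : 1 ≤ n) (H : ∀ m, 1 ≤ m → m ≤ n → W m = W' m) :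
    stage W n = stage W' n := by
  unfold stage tMean
  split_ifs with h
  · exact H 1 le_rfl hn
  · rw [H n hn le_rfl, H (n - 1) (by omega) (by omega)]

theorem stageGrid_eq_zero {e : ℕ → ℕ → ℝ} {j : ℕ} (he : ∀ n, e n j = 0) (n : ℕ) :
    stageGrid e n j = 0 := by
  unfold stageGrid stage tMean; simp [he]

theorem tStep_mul_discFracIntegral {α : ℝ} {t : ℕ → ℝ} {N : ℕ}
    (ht : ∀ n, 1 ≤ n → n ≤ N → t (n - 1) < t n) (W : ℕ → ℝ) {n : ℕ} (h1 : 1 ≤ n) (hn : n ≤ N) :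
    tStep t n * discFracIntegral α t W n
      = ∑ s ∈ Finset.Icc 1 n, kernelMass α t n s * stage W s := by
  have hk : ∀ i, 1 ≤ i → i ≤ N → tStep t i ≠ 0 := fun i hi hi' => by
    have := ht i hi hi'; unfold tStep; linarith
  have hq : ∀ s, 1 ≤ s → s ≤ n → ∀ w,
      tStep t n * (quadWeight α t n s * w * tStep t s) = kernelMass α t n s * w := by
    intro s hs hsn w
    have h2 := hk n h1 hn
    have h3 := hk s hs (hsn.trans hn)
    change tStep t n * (kernelMass α t n s / (tStep t n * tStep t s) * w * tStep t s) = _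
    field_simp
  rw [discFracIntegral, mul_add, hq 1 le_rfl h1, Finset.mul_sum,
    ← Finset.add_sum_Ioc_eq_sum_Icc h1]
  congr 1
  refine Finset.sum_congr (by ext; simp; omega) fun s hs => ?_
  have hs' : 1 < s ∧ s ≤ n := by simpa using hs
  rw [hq s (by omega) hs'.2, stage, if_neg (by omega)]

/-- The error equations of the scheme, about the stage values `a n` of the exact solution, with
the quadratic term weighted by `θ n`, and with residual `R`. -/
structure IsErrorSolution (L α : ℝ) (J N : ℕ) (t : ℕ → ℝ) (a : ℕ → ℕ → ℝ) (θ : ℕ → ℝ)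
    (R e : ℕ → ℕ → ℝ) : Prop where
  initial : ∀ j, e 0 j = 0
  support : ∀ n, ∀ j ∉ Finset.Ico 1 J, e n j = 0
  equation : ∀ n, 1 ≤ n → n ≤ N → ∀ j ∈ Finset.Ico 1 J,
    e n j - e (n - 1) j + tStep t n * (convecLin (hStep L J) (a n) (stageGrid e n) j
        - θ n * convec (hStep L J) (stageGrid e n) j)
      = ∑ s ∈ Finset.Icc 1 n, kernelMass α t n s * secondDiff (hStep L J) (stageGrid e s) j + R n j

theorem discrete_gronwall {N : ℕ} {a v r t : ℕ → ℝ} {b R : ℝ} (hb : 0 ≤ b) (ht0 : t 0 = 0)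
    (ht : ∀ n, 1 ≤ n → n ≤ N → t (n - 1) < t n)
    (hk : ∀ n, 1 ≤ n → n ≤ N → 4 * b * tStep t n ≤ 1)
    (hv : ∀ n, 0 ≤ v n) (hr : ∀ n, 0 ≤ r n) (ha0 : a 0 = 0)
    (hva : ∀ n, 1 ≤ n → n ≤ N → v n ≤ max (a n) (a (n - 1)))
    (hR : ∑ n ∈ Finset.Icc 1 N, r n ≤ R)
    (H : ∀ m ≤ N, a m ^ 2 ≤ ∑ n ∈ Finset.Icc 1 m, (2 * b * tStep t n * v n ^ 2 + 2 * r n * v n))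
    {m : ℕ} (hm : m ≤ N) : a m ≤ 2 * R * Real.exp (4 * b * t m) := by
  set B : ℕ → ℝ := fun m => 2 * R * Real.exp (4 * b * t m) with hB
  have hR0 : 0 ≤ R := (Finset.sum_nonneg fun n _ => hr n).trans hR
  have hB0 : ∀ n, 0 ≤ B n := fun n => by positivity
  have hBmono : ∀ i j, i ≤ j → j ≤ N → B i ≤ B j := fun i j hij hj => by
    have := mesh_mono ht hij hj
    simp only [hB]; gcongr
  -- The exponential majorant B is a supersolution of the summed inequality. With x = b k_n ≤ 1/4
  -- one has e^(4x)(1 - 2x) ≥ (1 + 4x)(1 - 2x) ≥ 1, so each increment of B is at least 2x B.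
  have hsum : ∀ m ≤ N, 2 * R + ∑ n ∈ Finset.Icc 1 m, 2 * b * tStep t n * B n ≤ B m := by
    intro m
    induction m with
    | zero => intro _; simp [hB, ht0]
    | succ m ih =>
      intro hm
      have h1 := ih (by omega)
      have h2 := hk (m + 1) (by omega) hm
      have h3 : 0 < tStep t (m + 1) := by
        have := ht (m + 1) (by omega) hm
        unfold tStep; linarith
      rw [Finset.sum_Icc_succ_top (by omega), ← add_assoc]
      have h4 : B (m + 1) = B m * Real.exp (4 * b * tStep t (m + 1)) := by
        simp only [hB, tStep, Nat.add_sub_cancel]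
        rw [mul_assoc (2 * R), ← Real.exp_add]; congr 2; ring
      have h5 := Real.add_one_le_exp (4 * b * tStep t (m + 1))
      set x := b * tStep t (m + 1) with hx
      have hx0 : 0 ≤ x := by positivity
      have h6 : 1 ≤ Real.exp (4 * b * tStep t (m + 1)) * (1 - 2 * x) := by
        nlinarith
      have h7 : B m ≤ B (m + 1) * (1 - 2 * x) := by
        rw [h4, mul_assoc]; exact le_mul_of_one_le_right (hB0 m) h6
      nlinarith
  have main : ∀ m ≤ N, a m ≤ B m := by
    intro m
    induction m using Nat.strong_induction_on with
    | _ m ih =>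
      intro hm
      rcases Nat.eq_zero_or_pos m with rfl | hmpos
      · rw [ha0]; exact hB0 0
      -- At a first violation the value A = a(q+1) exceeds all earlier bounds, hence all stage norms
      -- up to this step. The quadratic inequality can then be divided by A.
      by_contra! hc
      obtain ⟨q, rfl⟩ : ∃ q, m = q + 1 := ⟨m - 1, by omega⟩
      have hv1 : ∀ n ∈ Finset.Icc 1 q, v n ≤ B n := fun n hn => by
        obtain ⟨h1, h2⟩ := Finset.mem_Icc.1 hn
        exact (hva n h1 (by omega)).trans (max_le (ih n (by omega) (by omega))
          ((ih (n - 1) (by omega) (by omega)).trans (hBmono _ _ (by omega) (by omega))))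
      have hv2 : v (q + 1) ≤ a (q + 1) := (hva _ (by omega) hm).trans (max_le le_rfl
        (((ih q (by omega) (by omega)).trans (hBmono _ _ (by omega) hm)).trans hc.le))
      have hv3 : ∀ n ∈ Finset.Icc 1 (q + 1), v n ≤ a (q + 1) := fun n hn => by
        obtain ⟨h1, h2⟩ := Finset.mem_Icc.1 hn
        rcases eq_or_lt_of_le h2 with h | h
        · rw [h]; exact hv2
        · exact (hv1 n (Finset.mem_Icc.2 ⟨h1, by omega⟩)).trans
            ((hBmono _ _ (by omega) hm).trans hc.le)
      have hkn : ∀ n ∈ Finset.Icc 1 (q + 1), 0 ≤ tStep t n := fun n hn => by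
        obtain ⟨h1, h2⟩ := Finset.mem_Icc.1 hn
        have := ht n h1 (by omega)
        unfold tStep; linarith
      set A := a (q + 1) with hA
      have hApos : 0 < A := (hB0 _).trans_lt hc
      have h1 : A ^ 2 ≤ (∑ n ∈ Finset.Icc 1 q, 2 * b * tStep t n * B n) * A
          + 2 * b * tStep t (q + 1) * A * A + 2 * R * A := by
        calc _ ≤ _ := H (q + 1) hm
          _ = ∑ n ∈ Finset.Icc 1 (q + 1), 2 * b * tStep t n * v n ^ 2
              + ∑ n ∈ Finset.Icc 1 (q + 1), 2 * r n * v n := Finset.sum_add_distrib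
          _ ≤ ((∑ n ∈ Finset.Icc 1 q, 2 * b * tStep t n * B n) * A
              + 2 * b * tStep t (q + 1) * A * A) + 2 * R * A := by
              refine add_le_add ?_ ?_
              · rw [Finset.sum_Icc_succ_top (by omega), Finset.sum_mul]
                refine add_le_add (Finset.sum_le_sum fun n hn => ?_) ?_
                · have hn' : n ∈ Finset.Icc 1 (q + 1) := by
                    simp at hn ⊢; omega
                  have h0 := hkn n hn'
                  rw [sq, ← mul_assoc]
                  have h5 := hv n
                  have h6 := hB0 n
                  gcongr
                  · exact hv1 n hn
                  · exact hv3 n hn'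
                · have h0 := hkn (q + 1) (by simp)
                  have h5 := hv (q + 1)
                  rw [sq, ← mul_assoc]
                  gcongr
              · calc _ ≤ ∑ n ∈ Finset.Icc 1 (q + 1), 2 * A * r n :=
                      Finset.sum_le_sum fun n hn => by
                        have := mul_le_mul_of_nonneg_left (hv3 n hn) (hr n)
                        linarith
                  _ = 2 * A * ∑ n ∈ Finset.Icc 1 (q + 1), r n := by rw [Finset.mul_sum]
                  _ ≤ 2 * A * R := by
                      gcongr
                      exact (Finset.sum_le_sum_of_subset_of_nonneg
                        (Finset.Icc_subset_Icc_right hm) fun n _ _ => hr n).trans hR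
                  _ = _ := by ring
      have h2 : A ≤ (∑ n ∈ Finset.Icc 1 q, 2 * b * tStep t n * B n)
          + 2 * b * tStep t (q + 1) * A + 2 * R := by
        by_contra! hcc
        nlinarith
      have h3 := hsum (q + 1) hm
      rw [Finset.sum_Icc_succ_top (by omega)] at h3
      have h4 := hk (q + 1) (by omega) hm
      -- With x = b k_{q+1} ≤ 1/4, comparison with the supersolution property gives (1 - 2x)(A - B)
      -- ≤ 0, contradicting A > B.
      nlinarith
  exact main m hm

section

variable {L α : ℝ} {J N : ℕ} {t θ : ℕ → ℝ} {a R e : ℕ → ℕ → ℝ}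

theorem stageGrid_support (he : ∀ n, ∀ j ∉ Finset.Ico 1 J, e n j = 0) (n : ℕ) {j : ℕ}
    (hj : j ∉ Finset.Ico 1 J) : stageGrid e n j = 0 :=
  stageGrid_eq_zero (fun m => he m j hj) n

theorem gridNorm_stageGrid_le (hL : 0 < L) (hJ : 1 ≤ J) (e : ℕ → ℕ → ℝ) (n : ℕ) :
    gridNorm L J (stageGrid e n) ≤ max (gridNorm L J (e n)) (gridNorm L J (e (n - 1))) := by
  by_cases h : n = 1
  · have : stageGrid e n = e n := by
      funext j; simp [stageGrid, stage, h]
    rw [this]; exact le_max_left _ _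
  · have : stageGrid e n = fun j => (1 / 2 : ℝ) * (e n j + e (n - 1) j) := by
      funext j; simp only [stageGrid, stage, h, if_false, tMean]; ring
    rw [this, gridNorm_smul (1 / 2 : ℝ) (fun j => e n j + e (n - 1) j)]
    have h1 := gridNorm_add_le hL hJ (e n) (e (n - 1))
    have h2 := le_max_left (gridNorm L J (e n)) (gridNorm L J (e (n - 1)))
    have h3 := le_max_right (gridNorm L J (e n)) (gridNorm L J (e (n - 1)))
    rw [abs_of_nonneg (by norm_num)]
    linarith

/-- For a mean this is the identity (x - y)(x + y) = x² - y². In the first step the backward Euler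
form leaves a nonnegative square over. -/
theorem sq_sub_sq_le_gridInner_stage (hL : 0 < L) (hJ : 1 ≤ J) (e : ℕ → ℕ → ℝ) (n : ℕ) :
    (gridNorm L J (e n) ^ 2 - gridNorm L J (e (n - 1)) ^ 2) / 2
      ≤ gridInner L J (fun j => e n j - e (n - 1) j) (stageGrid e n) := by
  rw [gridNorm_sq hL hJ, gridNorm_sq hL hJ]
  simp only [gridInner]
  rw [← mul_sub, mul_div_assoc, ← Finset.sum_sub_distrib, Finset.sum_div]
  refine mul_le_mul_of_nonneg_left (Finset.sum_le_sum fun j _ => ?_) (hStep_pos hL hJ).le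
  by_cases h : n = 1
  · simp only [stageGrid, stage, h, if_true]
    nlinarith [sq_nonneg (e 1 j - e (1 - 1) j)]
  · simp only [stageGrid, stage, h, if_false, tMean]
    nlinarith

/-- Testing with the stage value removes the quadratic term for every weight θ. After summation by
parts in space the memory term is a sum over cells of the positive triangular forms, so it can be
discarded; positivity holds only for the sum over n, not step by step. -/
theorem IsErrorSolution.energy (hL : 0 < L) (hJ : 1 ≤ J) (hα : 0 < α) (hα1 : α < 1)
    (ht : ∀ n, 1 ≤ n → n ≤ N → t (n - 1) < t n) {K : ℝ} (hK : 0 ≤ K)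
    (Ha : ∀ n, 1 ≤ n → n ≤ N → ∀ j < J, |a n (j + 1) - a n j| ≤ K * hStep L J)
    (he : IsErrorSolution L α J N t a θ R e) {m : ℕ} (hm : m ≤ N) :
    gridNorm L J (e m) ^ 2 ≤ ∑ n ∈ Finset.Icc 1 m,
      (2 * (K / 2) * tStep t n * gridNorm L J (stageGrid e n) ^ 2
        + 2 * gridNorm L J (R n) * gridNorm L J (stageGrid e n)) := by
  have V0 : ∀ n, stageGrid e n 0 = 0 := fun n => stageGrid_support he.support n (by simp)
  have VJ : ∀ n, stageGrid e n J = 0 := fun n => stageGrid_support he.support n (by simp)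
  set D : ℕ → ℕ → ℝ := fun j n => (stageGrid e n (j + 1) - stageGrid e n j) / hStep L J with hD
  have step : ∀ n ∈ Finset.Icc 1 m,
      gridNorm L J (e n) ^ 2 - gridNorm L J (e (n - 1)) ^ 2 ≤
        (2 * (K / 2) * tStep t n * gridNorm L J (stageGrid e n) ^ 2
        + 2 * gridNorm L J (R n) * gridNorm L J (stageGrid e n))
        - 2 * (hStep L J * ∑ j ∈ Finset.range J, ∑ s ∈ Finset.Icc 1 n,
          kernelMass α t n s * (D j n * D j s)) := by
    intro n hn
    obtain ⟨hn1, hn2⟩ := Finset.mem_Icc.1 hn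
    have hnN := hn2.trans hm
    have hk : 0 ≤ tStep t n := by
      have := ht n hn1 hnN; unfold tStep; linarith
    have h1 := sq_sub_sq_le_gridInner_stage hL hJ e n
    have h2 := gridInner_congr (L := L) (w := stageGrid e n) (he.equation n hn1 hnN)
    rw [gridInner_add_left, gridInner_add_left, gridInner_smul_left,
      gridInner_sub_left (convecLin (hStep L J) (a n) (stageGrid e n)),
      gridInner_smul_left (θ n)] at h2
    rw [gridInner_convec_self hL hJ _ (V0 n) (VJ n), mul_zero, sub_zero,
      gridInner_sum_left (Finset.Icc 1 n)
        (fun s j => kernelMass α t n s * secondDiff (hStep L J) (stageGrid e s) j)] at h2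
    have h3 : ∑ s ∈ Finset.Icc 1 n, gridInner L J
        (fun j => kernelMass α t n s * secondDiff (hStep L J) (stageGrid e s) j) (stageGrid e n)
        = -(hStep L J * ∑ j ∈ Finset.range J, ∑ s ∈ Finset.Icc 1 n,
          kernelMass α t n s * (D j n * D j s)) := by
      rw [Finset.sum_comm, Finset.mul_sum, ← Finset.sum_neg_distrib]
      refine Finset.sum_congr rfl fun s _ => ?_
      rw [gridInner_smul_left (kernelMass α t n s) (secondDiff (hStep L J) (stageGrid e s)),
        gridInner_secondDiff hL hJ _ _ (V0 n) (VJ n), ← Finset.mul_sum]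
      simp only [hD, mul_comm ((stageGrid e s _ - _) / _)]
      ring
    have h4 := abs_le.1 (abs_gridInner_convecLin_self_le hL hJ (V0 n) (VJ n) hK (Ha n hn1 hnN))
    have h5 := gridInner_le hL hJ (R n) (stageGrid e n)
    have h6 := mul_le_mul_of_nonneg_left h4.1 hk
    rw [h3] at h2
    linarith
  have hsum := Finset.sum_le_sum step
  have htel := sum_Icc_sub (fun n => gridNorm L J (e n) ^ 2) (a := 1) (b := m)
  rcases Nat.eq_zero_or_pos m with rfl | hmpos
  · have : gridNorm L J (e 0) = 0 := by
      rw [gridNorm_congr (w := fun _ => 0) fun j _ => he.initial j]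
      simp [gridNorm]
    simp [this]
  rw [htel hmpos] at hsum
  have h0 : gridNorm L J (e (1 - 1)) = 0 := by
    rw [gridNorm_congr (w := fun _ => 0) fun j _ => he.initial j]
    simp [gridNorm]
  rw [h0, Finset.sum_sub_distrib, ← Finset.mul_sum, ← Finset.mul_sum, Finset.sum_comm] at hsum
  have hpos : 0 ≤ ∑ j ∈ Finset.range J, ∑ n ∈ Finset.Icc 1 m, ∑ s ∈ Finset.Icc 1 n,
      kernelMass α t n s * (D j n * D j s) :=
    Finset.sum_nonneg fun j _ => sum_sum_kernelMass_nonneg hα hα1 ht (D j) hm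
  have := mul_nonneg (hStep_pos hL hJ).le hpos
  linarith

/-- Stability: the error is controlled by the sum of the residuals, whatever the weights of the
quadratic term are. -/
theorem IsErrorSolution.gridNorm_le (hL : 0 < L) (hJ : 1 ≤ J) (hα : 0 < α) (hα1 : α < 1)
    (h0 : t 0 = 0) (ht : ∀ n, 1 ≤ n → n ≤ N → t (n - 1) < t n) {K T r : ℝ} (hK : 0 ≤ K)
    (hT : t N ≤ T) (hk : ∀ n, 1 ≤ n → n ≤ N → 2 * K * tStep t n ≤ 1)
    (Ha : ∀ n, 1 ≤ n → n ≤ N → ∀ j < J, |a n (j + 1) - a n j| ≤ K * hStep L J)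
    (he : IsErrorSolution L α J N t a θ R e)
    (hR : ∑ n ∈ Finset.Icc 1 N, gridNorm L J (R n) ≤ r) {m : ℕ} (hm : m ≤ N) :
    gridNorm L J (e m) ≤ 2 * r * Real.exp (2 * K * T) := by
  have hr : 0 ≤ r := (Finset.sum_nonneg fun n _ => gridNorm_nonneg L J (R n)).trans hR
  have h1 := discrete_gronwall (a := fun n => gridNorm L J (e n))
    (v := fun n => gridNorm L J (stageGrid e n)) (r := fun n => gridNorm L J (R n))
    (by positivity : 0 ≤ K / 2) h0 ht (fun n h1 h2 => by have := hk n h1 h2; linarith)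
    (fun _ => gridNorm_nonneg ..) (fun _ => gridNorm_nonneg ..)
    (by rw [gridNorm_congr (w := fun _ => 0) fun j _ => he.initial j]; simp [gridNorm])
    (fun n _ _ => gridNorm_stageGrid_le hL hJ e n) hR
    (fun m hm => he.energy hL hJ hα hα1 ht hK Ha hm) hm
  refine h1.trans ?_
  have h2 : t m ≤ T := (mesh_mono ht hm le_rfl).trans hT
  gcongr ?_ * Real.exp ?_
  nlinarith

end

/-! ### Solvability of one step -/

/-- A strongly monotone Lipschitz map of a Hilbert space is surjective. -/
theorem exists_eq_of_stronglyMonotone {E : Type*} [NormedAddCommGroup E] [InnerProductSpace ℝ E]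
    [CompleteSpace E] {F : E → E} {c Λ : ℝ} (hc : 0 < c) (hΛ : 0 ≤ Λ)
    (hmono : ∀ x y, c * ‖x - y‖ ^ 2 ≤ inner ℝ (F x - F y) (x - y))
    (hlip : ∀ x y, ‖F x - F y‖ ≤ Λ * ‖x - y‖) (b : E) : ∃ x, F x = b := by
  -- Enlarging the Lipschitz constant by c gives M > 0 and c ≤ M. The damped iteration with τ = c/M²
  -- then has squared contraction factor 1 - 2τc + τ²M² = 1 - c²/M², which lies in [0, 1).
  set M := Λ + c with hM
  have hMpos : 0 < M := by positivity
  set τ := c / M ^ 2 with hτ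
  have hτpos : 0 < τ := by positivity
  set q : ℝ := 1 - c ^ 2 / M ^ 2 with hq
  have hq1 : q < 1 := by
    have : 0 < c ^ 2 / M ^ 2 := by positivity
    linarith
  have hq0 : 0 ≤ q := by
    have : c ^ 2 / M ^ 2 ≤ 1 := by
      rw [div_le_one (by positivity)]
      exact pow_le_pow_left₀ hc.le (by linarith) 2
    linarith
  have hsq : √q < 1 := by rw [Real.sqrt_lt' one_pos]; simpa using hq1
  set S : E → E := fun x => x - τ • (F x - b) with hS
  have hcontr : ContractingWith ⟨√q, Real.sqrt_nonneg q⟩ S := by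
    refine ⟨by exact_mod_cast hsq, LipschitzWith.of_dist_le_mul fun x y => ?_⟩
    rw [dist_eq_norm, dist_eq_norm]
    change _ ≤ √q * _
    refine abs_le_of_sq_le_sq' ?_ (by positivity) |>.2
    have h1 : S x - S y = (x - y) - τ • (F x - F y) := by
      simp only [hS, smul_sub]; abel
    rw [h1, norm_sub_sq_real, mul_pow, Real.sq_sqrt hq0, inner_smul_right, norm_smul, mul_pow,
      real_inner_comm, Real.norm_eq_abs, sq_abs]
    have h2 := hmono x y
    have h3 : ‖F x - F y‖ ^ 2 ≤ M ^ 2 * ‖x - y‖ ^ 2 := by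
      rw [← mul_pow]
      refine pow_le_pow_left₀ (norm_nonneg _) ((hlip x y).trans ?_) 2
      gcongr; linarith
    have h4 : τ ^ 2 * ‖F x - F y‖ ^ 2 ≤ τ ^ 2 * (M ^ 2 * ‖x - y‖ ^ 2) := by gcongr
    have h5 : τ * (c * ‖x - y‖ ^ 2) ≤ τ * inner ℝ (F x - F y) (x - y) := by gcongr
    have h6 : τ ^ 2 * M ^ 2 = c ^ 2 / M ^ 2 := by rw [hτ]; field_simp
    have h7 : τ * c = c ^ 2 / M ^ 2 := by rw [hτ]; field_simp
    have h8 : q * ‖x - y‖ ^ 2 = ‖x - y‖ ^ 2 - 2 * (τ * c) * ‖x - y‖ ^ 2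
        + τ ^ 2 * M ^ 2 * ‖x - y‖ ^ 2 := by rw [h6, h7, hq]; ring
    rw [h8]
    linarith
  refine ⟨hcontr.fixedPoint S, ?_⟩
  have h := hcontr.fixedPoint_isFixedPt
  have h1 : τ • (F (hcontr.fixedPoint S) - b) = 0 := by
    have h2 : hcontr.fixedPoint S - τ • (F (hcontr.fixedPoint S) - b) = hcontr.fixedPoint S := h
    simpa using h2
  exact sub_eq_zero.1 ((smul_eq_zero.1 h1).resolve_left hτpos.ne')

section

variable {L : ℝ} {J : ℕ}

/-- The extension by zero of a vector indexed by the interior nodes. -/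
noncomputable def gridExtend (J : ℕ) (x : EuclideanSpace ℝ (Finset.Ico 1 J)) (j : ℕ) : ℝ :=
  if h : j ∈ Finset.Ico 1 J then x ⟨j, h⟩ else 0

theorem gridInner_eq_inner (v w : ℕ → ℝ) (x y : EuclideanSpace ℝ (Finset.Ico 1 J))
    (hx : ∀ i, x i = v i) (hy : ∀ i, y i = w i) :
    gridInner L J v w = hStep L J * inner ℝ x y := by
  rw [gridInner, PiLp.inner_apply, ← Finset.sum_coe_sort (Finset.Ico 1 J)]
  congr 1
  refine Finset.sum_congr rfl fun i _ => ?_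
  rw [hx, hy]
  simp [mul_comm]

/-- The grid inner product is h times the Euclidean one on the interior nodes, so monotonicity
transfers with the same constant. The Lipschitz bound is assumed in dual form and is recovered by
testing with the difference of images. -/
theorem exists_grid_solution (hL : 0 < L) (hJ : 1 ≤ J) {F : (ℕ → ℝ) → ℕ → ℝ} {c Λ : ℝ} (hc : 0 < c)
    (hΛ : 0 ≤ Λ)
    (hmono : ∀ x y : ℕ → ℝ, (∀ j ∉ Finset.Ico 1 J, x j = 0) → (∀ j ∉ Finset.Ico 1 J, y j = 0) →
      c * gridNorm L J (fun j => x j - y j) ^ 2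
        ≤ gridInner L J (fun j => F x j - F y j) (fun j => x j - y j))
    (hlip : ∀ x y z : ℕ → ℝ, (∀ j ∉ Finset.Ico 1 J, x j = 0) → (∀ j ∉ Finset.Ico 1 J, y j = 0) →
      (∀ j ∉ Finset.Ico 1 J, z j = 0) →
      gridInner L J (fun j => F x j - F y j) z
        ≤ Λ * gridNorm L J (fun j => x j - y j) * gridNorm L J z)
    (b : ℕ → ℝ) :
    ∃ x : ℕ → ℝ, (∀ j ∉ Finset.Ico 1 J, x j = 0) ∧ ∀ j ∈ Finset.Ico 1 J, F x j = b j := by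
  have hh := hStep_pos hL hJ
  set G : EuclideanSpace ℝ (Finset.Ico 1 J) → EuclideanSpace ℝ (Finset.Ico 1 J) :=
    fun x => WithLp.toLp 2 fun i => F (gridExtend J x) i with hG
  have hsupp : ∀ x, ∀ j ∉ Finset.Ico 1 J, gridExtend J x j = 0 := fun x j hj => by
    simp only [gridExtend, hj, dif_neg, not_false_eq_true]
  have hext : ∀ x (i : Finset.Ico 1 J), gridExtend J x i = x i := fun x i => by
    simp only [gridExtend, i.2, dif_pos]
  have hsub : ∀ x y (i : Finset.Ico 1 J),
      (x - y) i = (fun j => gridExtend J x j - gridExtend J y j) i := fun x y i => by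
    simp [hext]
  have hGsub : ∀ x y (i : Finset.Ico 1 J),
      (G x - G y) i = (fun j => F (gridExtend J x) j - F (gridExtend J y) j) i := fun x y i => by
    simp [hG]
  have hnorm : ∀ (v : ℕ → ℝ) (x : EuclideanSpace ℝ (Finset.Ico 1 J)), (∀ i, x i = v i) →
      gridNorm L J v ^ 2 = hStep L J * ‖x‖ ^ 2 := fun v x hx => by
    rw [gridNorm_sq hL hJ, gridInner_eq_inner v v x x hx hx, real_inner_self_eq_norm_sq]
  obtain ⟨x, hx⟩ := exists_eq_of_stronglyMonotone (F := G) hc hΛ (fun x y => by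
      have h1 := hmono _ _ (hsupp x) (hsupp y)
      rw [hnorm _ _ (hsub x y), gridInner_eq_inner _ _ _ _ (hGsub x y) (hsub x y)] at h1
      have h2 : hStep L J * (c * ‖x - y‖ ^ 2) ≤ hStep L J * inner ℝ (G x - G y) (x - y) := by
        linarith
      exact le_of_mul_le_mul_left h2 hh) (fun x y => by
      have h1 := hlip _ _ _ (hsupp x) (hsupp y) (hsupp (G x - G y))
      rw [gridInner_eq_inner _ _ _ _ (hGsub x y) (fun i => (hext _ i).symm),
        real_inner_self_eq_norm_sq] at h1
      have e1 : gridNorm L J (fun j => gridExtend J x j - gridExtend J y j)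
          = √(hStep L J) * ‖x - y‖ := by
        rw [← Real.sqrt_sq (gridNorm_nonneg L J _), hnorm _ _ (hsub x y), Real.sqrt_mul hh.le,
          Real.sqrt_sq (norm_nonneg _)]
      have e2 : gridNorm L J (gridExtend J (G x - G y)) = √(hStep L J) * ‖G x - G y‖ := by
        rw [← Real.sqrt_sq (gridNorm_nonneg L J _), hnorm _ _ (fun i => (hext _ i).symm),
          Real.sqrt_mul hh.le, Real.sqrt_sq (norm_nonneg _)]
      rw [e1, e2] at h1
      have h2 : hStep L J * ‖G x - G y‖ ^ 2
          ≤ hStep L J * (Λ * ‖x - y‖ * ‖G x - G y‖) := by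
        calc _ ≤ _ := h1
          _ = (√(hStep L J) * √(hStep L J)) * (Λ * ‖x - y‖ * ‖G x - G y‖) := by ring
          _ = _ := by rw [Real.mul_self_sqrt hh.le]
      have h3 := le_of_mul_le_mul_left h2 hh
      by_contra! h4
      have h5 : 0 ≤ Λ * ‖x - y‖ := by positivity
      nlinarith)
    (WithLp.toLp 2 fun i => b i)
  refine ⟨gridExtend J x, hsupp x, fun j hj => ?_⟩
  have := congrArg (fun y : EuclideanSpace ℝ (Finset.Ico 1 J) => y ⟨j, hj⟩) hx
  simpa [hG] using this

/-! ### Radial truncation -/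

/-- The factor of the radial retraction onto the ball of radius `ρ`. -/
noncomputable def truncFactor (L : ℝ) (J : ℕ) (ρ : ℝ) (w : ℕ → ℝ) : ℝ := ρ / max ρ (gridNorm L J w)

/-- The radial retraction onto the ball of radius `ρ`. -/
noncomputable def gridTrunc (L : ℝ) (J : ℕ) (ρ : ℝ) (w : ℕ → ℝ) (j : ℕ) : ℝ :=
  truncFactor L J ρ w * w j

theorem truncFactor_eq_one {ρ : ℝ} (hρ : 0 < ρ) {w : ℕ → ℝ} (hw : gridNorm L J w ≤ ρ) :
    truncFactor L J ρ w = 1 := by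
  rw [truncFactor, max_eq_left hw, div_self hρ.ne']

theorem gridNorm_gridTrunc_le {ρ : ℝ} (hρ : 0 < ρ) (w : ℕ → ℝ) :
    gridNorm L J (gridTrunc L J ρ w) ≤ ρ := by
  have hm : 0 < max ρ (gridNorm L J w) := hρ.trans_le (le_max_left _ _)
  unfold gridTrunc
  rw [gridNorm_smul, truncFactor, abs_of_pos (div_pos hρ hm), div_mul_eq_mul_div, div_le_iff₀ hm]
  exact mul_le_mul_of_nonneg_left (le_max_right _ _) hρ.le

/-- The difference splits into a rescaled v - w, with factor at most 1, and a change of factor,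
governed by the 1-Lipschitz map v ↦ max(ρ, ‖v‖). The constant 2 is crude but harmless. -/
theorem gridNorm_gridTrunc_sub_le (hL : 0 < L) (hJ : 1 ≤ J) {ρ : ℝ} (hρ : 0 < ρ) (v w : ℕ → ℝ) :
    gridNorm L J (fun j => gridTrunc L J ρ v j - gridTrunc L J ρ w j)
      ≤ 2 * gridNorm L J (fun j => v j - w j) := by
  set a := max ρ (gridNorm L J v) with ha
  set b := max ρ (gridNorm L J w) with hb
  have hρa : ρ ≤ a := le_max_left _ _
  have hρb : ρ ≤ b := le_max_left _ _
  have ha0 : 0 < a := hρ.trans_le hρa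
  have hb0 : 0 < b := hρ.trans_le hρb
  have hwb : gridNorm L J w ≤ b := le_max_right _ _
  have h1 : ∀ j, gridTrunc L J ρ v j - gridTrunc L J ρ w j
      = ρ / a * (v j - w j) + ρ * (b - a) / (a * b) * w j := fun j => by
    simp only [gridTrunc, truncFactor, ← ha, ← hb]
    field_simp; ring
  simp only [h1]
  refine (gridNorm_add_le hL hJ _ _).trans ?_
  rw [gridNorm_smul (ρ / a) (fun j => v j - w j), gridNorm_smul]
  set d := gridNorm L J (fun j => v j - w j) with hd
  have hd0 : 0 ≤ d := gridNorm_nonneg ..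
  have hab : |b - a| ≤ d := by
    have h2 : gridNorm L J v ≤ d + gridNorm L J w := by
      have := gridNorm_add_le hL hJ (fun j => v j - w j) w
      simpa using this
    have h3 : gridNorm L J w ≤ gridNorm L J v + d := by
      have := gridNorm_sub_le hL hJ v (fun j => v j - w j)
      simpa using this
    rw [abs_le]
    constructor
    · have : a ≤ b + d := max_le (by linarith) (by linarith)
      linarith
    · have : b ≤ a + d := max_le (by linarith)
        (by have := le_max_right ρ (gridNorm L J v); linarith)
      linarith
  have h4 : |ρ / a| ≤ 1 := by
    rw [abs_of_pos (div_pos hρ ha0), div_le_one ha0]; exact hρa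
  have h5 : |ρ * (b - a) / (a * b)| * gridNorm L J w ≤ d := by
    rw [abs_div, abs_mul, abs_of_pos hρ, abs_of_pos (mul_pos ha0 hb0), div_mul_eq_mul_div,
      div_le_iff₀ (mul_pos ha0 hb0)]
    calc ρ * |b - a| * gridNorm L J w ≤ a * d * b := by
          gcongr
          exact gridNorm_nonneg ..
      _ = _ := by ring
  have h6 := mul_le_mul_of_nonneg_right h4 hd0
  linarith

theorem abs_gridInner_secondDiff_le (hL : 0 < L) (hJ : 1 ≤ J) (v : ℕ → ℝ) {w : ℕ → ℝ}
    (w0 : w 0 = 0) (wJ : w J = 0) :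
    |gridInner L J (secondDiff (hStep L J) v) w| ≤ gridSemi L J v * gridSemi L J w := by
  have hh := hStep_pos hL hJ
  rw [gridInner_secondDiff hL hJ v w w0 wJ, abs_neg, gridSemi, gridSemi,
    ← Real.sqrt_mul (mul_nonneg hh.le (Finset.sum_nonneg fun _ _ => sq_nonneg _))]
  apply Real.abs_le_sqrt
  rw [mul_pow]
  have := Finset.sum_mul_sq_le_sq_mul_sq (Finset.range J)
    (fun j => (v (j + 1) - v j) / hStep L J) (fun j => (w (j + 1) - w j) / hStep L J)
  calc _ ≤ hStep L J ^ 2 * _ := mul_le_mul_of_nonneg_left this (sq_nonneg _)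
    _ = _ := by ring

/-- The nonlinear map to be inverted in one step of the scheme, with truncated quadratic term. -/
noncomputable def stepMap (L : ℝ) (J : ℕ) (m k A ρ : ℝ) (a V : ℕ → ℝ) (j : ℕ) : ℝ :=
  m * V j + k * (convecLin (hStep L J) a V j - convec (hStep L J) (gridTrunc L J ρ V) j)
    - A * secondDiff (hStep L J) V j

theorem secondDiff_sub (h : ℝ) (v w : ℕ → ℝ) (j : ℕ) :
    secondDiff h (fun i => v i - w i) j = secondDiff h v j - secondDiff h w j := by
  simp only [secondDiff]; ring

theorem gridInner_stepMap_sub (m k A ρ : ℝ) (a V W z : ℕ → ℝ) :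
    gridInner L J (fun j => stepMap L J m k A ρ a V j - stepMap L J m k A ρ a W j) z
      = m * gridInner L J (fun j => V j - W j) z
        + k * (gridInner L J (convecLin (hStep L J) a fun j => V j - W j) z
          - gridInner L J (fun j => convec (hStep L J) (gridTrunc L J ρ V) j
            - convec (hStep L J) (gridTrunc L J ρ W) j) z)
        - A * gridInner L J (secondDiff (hStep L J) fun j => V j - W j) z := by
  rw [← gridInner_smul_left, ← gridInner_sub_left, ← gridInner_smul_left, ← gridInner_smul_left,
    ← gridInner_add_left, ← gridInner_sub_left]
  congr 1
  funext j
  rw [secondDiff_sub, ← convecLin_sub]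
  simp only [stepMap]
  ring

/-- Retracted functions have norm at most K√h, hence nodal values at most K, so convection is
K-Lipschitz on them in the dual H¹ sense. The retraction contributes the factor 2. -/
theorem abs_gridInner_stepMap_convec_le (hL : 0 < L) (hJ : 1 ≤ J) {K₀ K : ℝ} (hK₀ : 0 ≤ K₀)
    (hK : 0 < K) {a V W z : ℕ → ℝ} (Ha : ∀ j ≤ J, |a j| ≤ K₀)
    (hV : ∀ j ∉ Finset.Ico 1 J, V j = 0) (hW : ∀ j ∉ Finset.Ico 1 J, W j = 0)
    (hz : ∀ j ∉ Finset.Ico 1 J, z j = 0) :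
    |gridInner L J (convecLin (hStep L J) a fun j => V j - W j) z
      - gridInner L J (fun j => convec (hStep L J) (gridTrunc L J (K * √(hStep L J)) V) j
            - convec (hStep L J) (gridTrunc L J (K * √(hStep L J)) W) j) z|
      ≤ (K₀ + 2 * K) * gridNorm L J (fun j => V j - W j) * gridSemi L J z := by
  have hρ : 0 < K * √(hStep L J) := mul_pos hK (Real.sqrt_pos.2 (hStep_pos hL hJ))
  have n0 : 0 ∉ Finset.Ico 1 J := by simp
  have nJ : J ∉ Finset.Ico 1 J := by simp
  have h1 := abs_gridInner_convecLin_le hL hJ (e := fun j => V j - W j) hK₀ (hz 0 n0) (hz J nJ)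
    (by simp [hV 0 n0, hW 0 n0]) (by simp [hV J nJ, hW J nJ]) Ha
  have h2 := abs_gridInner_convec_sub_le hL hJ (a := gridTrunc L J (K * √(hStep L J)) V)
    (b := gridTrunc L J (K * √(hStep L J)) W) hK.le (hz 0 n0) (hz J nJ)
    (by simp [gridTrunc, hV 0 n0]) (by simp [gridTrunc, hV J nJ])
    (by simp [gridTrunc, hW 0 n0]) (by simp [gridTrunc, hW J nJ])
    (fun j hj => abs_le_of_gridNorm_le hL hJ hK.le (gridNorm_gridTrunc_le hρ V) hj)
    (fun j hj => abs_le_of_gridNorm_le hL hJ hK.le (gridNorm_gridTrunc_le hρ W) hj)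
  have h3 := gridNorm_gridTrunc_sub_le hL hJ hρ V W
  have h4 := gridSemi_nonneg L J z
  refine (abs_sub _ _).trans ((add_le_add h1 h2).trans ?_)
  have h5 := mul_le_mul_of_nonneg_right (mul_le_mul_of_nonneg_left h3 hK.le) h4
  linarith

/-- Write x and y for the norm and the H¹ seminorm of V - W, and q = k(K₀ + 2K). Convection
contributes at least -qxy ≥ -(x² + q²y²)/2. Half of the mass term absorbs the first part and A y²
the second, since q² ≤ 2A. -/
theorem stepMap_monotone (hL : 0 < L) (hJ : 1 ≤ J) {m k A K₀ K : ℝ} (hK₀ : 0 ≤ K₀) (hK : 0 < K)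
    (hm : 1 ≤ m) (hk : 0 ≤ k) (hA : (k * (K₀ + 2 * K)) ^ 2 ≤ 2 * A)
    {a V W : ℕ → ℝ} (Ha : ∀ j ≤ J, |a j| ≤ K₀)
    (hV : ∀ j ∉ Finset.Ico 1 J, V j = 0) (hW : ∀ j ∉ Finset.Ico 1 J, W j = 0) :
    1 / 2 * gridNorm L J (fun j => V j - W j) ^ 2
      ≤ gridInner L J (fun j => stepMap L J m k A (K * √(hStep L J)) a V j
          - stepMap L J m k A (K * √(hStep L J)) a W j) (fun j => V j - W j) := by
  have n0 : 0 ∉ Finset.Ico 1 J := by simp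
  have nJ : J ∉ Finset.Ico 1 J := by simp
  have hE : ∀ j ∉ Finset.Ico 1 J, (fun j => V j - W j) j = 0 := fun j hj => by
    simp [hV j hj, hW j hj]
  have h1 := (abs_le.1 (abs_gridInner_stepMap_convec_le hL hJ hK₀ hK Ha hV hW hE)).1
  rw [gridInner_stepMap_sub, ← gridNorm_sq hL hJ, gridInner_secondDiff_self hL hJ _ (hE 0 n0)
    (hE J nJ)]
  set x := gridNorm L J (fun j => V j - W j)
  set y := gridSemi L J (fun j => V j - W j)
  have h2 := mul_le_mul_of_nonneg_left h1 hk
  have h3 := mul_le_mul_of_nonneg_right hm (sq_nonneg x)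
  set q := k * (K₀ + 2 * K) with hq
  have h4 : k * -((K₀ + 2 * K) * x * y) = -(q * x * y) := by rw [hq]; ring
  have h5 := mul_le_mul_of_nonneg_right hA (sq_nonneg y)
  rw [h4] at h2
  nlinarith [sq_nonneg (x - q * y)]

/-- One truncated step can be solved. -/
theorem exists_stepMap_eq (hL : 0 < L) (hJ : 1 ≤ J) {m k A K₀ K : ℝ} (hK₀ : 0 ≤ K₀) (hK : 0 < K)
    (hm : 1 ≤ m) (hk : 0 ≤ k) (hA : (k * (K₀ + 2 * K)) ^ 2 ≤ 2 * A)
    {a : ℕ → ℝ} (Ha : ∀ j ≤ J, |a j| ≤ K₀) (b : ℕ → ℝ) :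
    ∃ V : ℕ → ℝ, (∀ j ∉ Finset.Ico 1 J, V j = 0) ∧
      ∀ j ∈ Finset.Ico 1 J, stepMap L J m k A (K * √(hStep L J)) a V j = b j := by
  have n0 : 0 ∉ Finset.Ico 1 J := by simp
  have nJ : J ∉ Finset.Ico 1 J := by simp
  have hh := hStep_pos hL hJ
  have hA0 : 0 ≤ A := by have := sq_nonneg (k * (K₀ + 2 * K)); linarith
  refine exists_grid_solution hL hJ (c := 1 / 2)
    (Λ := m + k * (K₀ + 2 * K) * (2 / hStep L J) + A * (2 / hStep L J) * (2 / hStep L J))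
    (by norm_num) (by positivity)
    (fun x y hx hy => stepMap_monotone hL hJ hK₀ hK hm hk hA Ha hx hy)
    (fun x y z hx hy hz => ?_) b
  have h1 := (abs_le.1 (abs_gridInner_stepMap_convec_le hL hJ hK₀ hK Ha hx hy hz)).2
  have h2 := (abs_le.1 (abs_gridInner_secondDiff_le hL hJ (fun j => x j - y j)
    (hz 0 n0) (hz J nJ))).1
  have h3 := gridSemi_le hL hJ (w := fun j => x j - y j) (by simp [hx 0 n0, hy 0 n0])
    (by simp [hx J nJ, hy J nJ])
  have h4 := gridSemi_le hL hJ (hz 0 n0) (hz J nJ)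
  have h5 := gridInner_le hL hJ (fun j => x j - y j) z
  rw [gridInner_stepMap_sub]
  set X := gridNorm L J (fun j => x j - y j)
  set Z := gridNorm L J z
  have hX : 0 ≤ X := gridNorm_nonneg ..
  have hZ : 0 ≤ Z := gridNorm_nonneg ..
  have hs1 := gridSemi_nonneg L J (fun j => x j - y j)
  have hs2 := gridSemi_nonneg L J z
  set H := 2 / hStep L J with hH
  have hH0 : 0 < H := by positivity
  have h6 := mul_le_mul_of_nonneg_left h5 (by linarith : 0 ≤ m)
  have h7 := mul_le_mul_of_nonneg_left
    (h1.trans (mul_le_mul_of_nonneg_left h4 (by positivity))) hk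
  have h8 : gridSemi L J (fun j => x j - y j) * gridSemi L J z ≤ (H * X) * (H * Z) := by gcongr
  have h9 := mul_le_mul_of_nonneg_left ((neg_le_neg h8).trans h2) hA0
  linarith

theorem stepMap_injective (hL : 0 < L) (hJ : 1 ≤ J) {m k A K₀ K : ℝ} (hK₀ : 0 ≤ K₀) (hK : 0 < K)
    (hm : 1 ≤ m) (hk : 0 ≤ k) (hA : (k * (K₀ + 2 * K)) ^ 2 ≤ 2 * A)
    {a V W : ℕ → ℝ} (Ha : ∀ j ≤ J, |a j| ≤ K₀)
    (hV : ∀ j ∉ Finset.Ico 1 J, V j = 0) (hW : ∀ j ∉ Finset.Ico 1 J, W j = 0)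
    (H : ∀ j ∈ Finset.Ico 1 J, stepMap L J m k A (K * √(hStep L J)) a V j
      = stepMap L J m k A (K * √(hStep L J)) a W j) : V = W := by
  have h1 := stepMap_monotone hL hJ hK₀ hK hm hk hA Ha hV hW
  rw [gridInner_congr (v' := fun _ => 0) fun j hj => sub_eq_zero.2 (H j hj)] at h1
  simp only [gridInner, zero_mul, Finset.sum_const_zero, mul_zero] at h1
  funext j
  by_cases hj : j ∈ Finset.Ico 1 J
  · have h2 := hStep_mul_sq_le hL hJ (fun j => V j - W j) hj
    have h3 := hStep_pos hL hJ
    have h4 : (V j - W j) ^ 2 ≤ 0 := by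
      by_contra! hc
      nlinarith
    exact sub_eq_zero.1 (pow_eq_zero_iff two_ne_zero |>.1 (le_antisymm h4 (sq_nonneg _)))
  · rw [hV j hj, hW j hj]

end

/-! ### Spatial regularity and spatial consistency -/

/-- `f` is continuous on `[0, L]` with derivative `f'` in the interior. -/
def HasDerivInside (L : ℝ) (f f' : ℝ → ℝ) : Prop :=
  ContinuousOn f (Icc 0 L) ∧ ∀ x ∈ Ioo 0 L, HasDerivAt f (f' x) x

section

variable {L : ℝ} {f f' g₀ g₁ g₂ g₃ g₄ : ℝ → ℝ}

theorem HasDerivInside.exists_slope (H : HasDerivInside L f f') {p q : ℝ} (hp : 0 ≤ p) (hpq : p < q)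
    (hq : q ≤ L) : ∃ ξ ∈ Ioo p q, f q - f p = f' ξ * (q - p) := by
  obtain ⟨ξ, hξ, h⟩ := exists_hasDerivAt_eq_slope f f' hpq
    (H.1.mono (Icc_subset_Icc hp hq)) fun x hx => H.2 x ⟨hp.trans_lt hx.1, hx.2.trans_le hq⟩
  refine ⟨ξ, hξ, ?_⟩
  rw [h]
  have : q - p ≠ 0 := (sub_pos.2 hpq).ne'
  field_simp

theorem HasDerivInside.exists_between (H : HasDerivInside L f f') {x y : ℝ} (hx : x ∈ Icc 0 L)
    (hy : y ∈ Icc 0 L) (hxy : x ≠ y) :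
    ∃ ξ ∈ Ioo 0 L, |ξ - x| ≤ |y - x| ∧ f y - f x = f' ξ * (y - x) := by
  rcases lt_or_gt_of_ne hxy with h | h
  · obtain ⟨ξ, hξ, e⟩ := H.exists_slope hx.1 h hy.2
    refine ⟨ξ, ⟨hx.1.trans_lt hξ.1, hξ.2.trans_le hy.2⟩, ?_, e⟩
    rw [abs_of_pos (sub_pos.2 hξ.1), abs_of_pos (sub_pos.2 h)]
    linarith [hξ.2]
  · obtain ⟨ξ, hξ, e⟩ := H.exists_slope hy.1 h hx.2
    refine ⟨ξ, ⟨hy.1.trans_lt hξ.1, hξ.2.trans_le hx.2⟩, ?_, by linarith⟩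
    rw [abs_of_neg (sub_neg.2 hξ.2), abs_of_neg (sub_neg.2 h)]
    linarith [hξ.1]

theorem HasDerivInside.abs_sub_le (H : HasDerivInside L f f') {D : ℝ}
    (hD : ∀ x ∈ Icc 0 L, |f' x| ≤ D) {x y : ℝ} (hx : x ∈ Icc 0 L) (hy : y ∈ Icc 0 L) :
    |f y - f x| ≤ D * |y - x| := by
  rcases eq_or_ne x y with rfl | h
  · simp
  obtain ⟨ξ, hξ, _, e⟩ := H.exists_between hx hy h
  rw [e, abs_mul]
  gcongr
  exact hD ξ (Ioo_subset_Icc_self hξ)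

theorem HasDerivInside.abs_value_le (H : HasDerivInside L f f') {B D : ℝ} (hD0 : 0 ≤ D)
    (hD : ∀ x ∈ Icc 0 L, |f' x| ≤ D) {ξ x : ℝ} (hξ : ξ ∈ Icc 0 L) (hB : |f ξ| ≤ B)
    (hx : x ∈ Icc 0 L) : |f x| ≤ B + D * L := by
  have h1 := H.abs_sub_le hD hξ hx
  have h2 : |x - ξ| ≤ L := by
    rw [abs_le]; constructor <;> linarith [hx.1, hx.2, hξ.1, hξ.2]
  have h3 := mul_le_mul_of_nonneg_left h2 hD0
  have h4 := abs_sub_abs_le_abs_sub (f x) (f ξ)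
  linarith

/-- Mean value theorem: two small values a distance at least d apart force a small derivative in
between. -/
theorem HasDerivInside.exists_small (H : HasDerivInside L f f') {p q d B : ℝ} (hp : 0 ≤ p)
    (hq : q ≤ L) (hd : 0 < d) (hdq : d ≤ q - p) (hBp : |f p| ≤ B) (hBq : |f q| ≤ B) :
    ∃ ξ ∈ Ioo p q, |f' ξ| ≤ 2 * B / d := by
  obtain ⟨ξ, hξ, e⟩ := H.exists_slope hp (by linarith) hq
  refine ⟨ξ, hξ, ?_⟩
  rw [le_div_iff₀ hd]
  calc |f' ξ| * d ≤ |f' ξ| * (q - p) := by gcongr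
    _ = |f q - f p| := by rw [e, abs_mul, abs_of_pos (by linarith : 0 < q - p)]
    _ ≤ _ := (abs_sub _ _).trans (by linarith)

/-- Landau's inequality: bounds for a function and its fourth derivative bound the derivatives in
between. -/
theorem exists_derivative_bound (hL : 0 < L) (K₀ K₄ : ℝ) (hK₀ : 0 ≤ K₀) (hK₄ : 0 ≤ K₄) :
    ∃ C, 0 ≤ C ∧ K₀ ≤ C ∧ ∀ g₀ g₁ g₂ g₃ g₄ : ℝ → ℝ, HasDerivInside L g₀ g₁ → HasDerivInside L g₁ g₂ →
      HasDerivInside L g₂ g₃ → HasDerivInside L g₃ g₄ → (∀ x ∈ Icc 0 L, |g₀ x| ≤ K₀) →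
      (∀ x ∈ Icc 0 L, |g₄ x| ≤ K₄) →
      ∀ x ∈ Icc 0 L, |g₁ x| ≤ C ∧ |g₂ x| ≤ C ∧ |g₃ x| ≤ C := by
  -- Four intervals of length a separated by gaps of length a. Each yields a point where g₁ is
  -- small; consecutive pairs of these yield two points where g₂ is small, again at least a apart,
  -- and these yield one where g₃ is small. From there the bound on g₄ is integrated back up to g₃,
  -- g₂ and g₁.
  set a := L / 7 with ha
  have ha0 : 0 < a := by positivity
  set B₁ := 2 * K₀ / a with hB₁
  set B₂ := 2 * B₁ / a with hB₂
  set B₃ := 2 * B₂ / a with hB₃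
  set C₃ := B₃ + K₄ * L with hC₃
  set C₂ := B₂ + C₃ * L with hC₂
  set C₁ := B₁ + C₂ * L with hC₁
  have p1 : 0 ≤ C₃ := by positivity
  have p2 : 0 ≤ C₂ := by positivity
  have p3 : 0 ≤ C₁ := by positivity
  refine ⟨K₀ + C₁ + C₂ + C₃, by positivity, by linarith, ?_⟩
  intro g₀ g₁ g₂ g₃ g₄ h01 h12 h23 h34 b0 b4
  have hsub : ∀ x, 0 ≤ x → x ≤ 7 * a → |g₀ x| ≤ K₀ := fun x h1 h2 => b0 x ⟨h1, by linarith⟩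
  obtain ⟨ξ₁, m1, q1⟩ := h01.exists_small (p := 0) (q := a) (d := a) le_rfl (by linarith) ha0
    (by linarith) (hsub _ le_rfl (by linarith)) (hsub _ ha0.le (by linarith))
  obtain ⟨ξ₂, m2, q2⟩ := h01.exists_small (p := 2 * a) (q := 3 * a) (d := a) (by linarith)
    (by linarith) ha0 (by linarith) (hsub _ (by linarith) (by linarith))
    (hsub _ (by linarith) (by linarith))
  obtain ⟨ξ₃, m3, q3⟩ := h01.exists_small (p := 4 * a) (q := 5 * a) (d := a) (by linarith)
    (by linarith) ha0 (by linarith) (hsub _ (by linarith) (by linarith))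
    (hsub _ (by linarith) (by linarith))
  obtain ⟨ξ₄, m4, q4⟩ := h01.exists_small (p := 6 * a) (q := 7 * a) (d := a) (by linarith)
    (by linarith) ha0 (by linarith) (hsub _ (by linarith) (by linarith))
    (hsub _ (by linarith) (by linarith))
  obtain ⟨η₁, n1, r1⟩ := h12.exists_small (p := ξ₁) (q := ξ₂) (d := a) (by linarith [m1.1])
    (by linarith [m2.2]) ha0 (by linarith [m1.2, m2.1]) q1 q2
  obtain ⟨η₂, n2, r2⟩ := h12.exists_small (p := ξ₃) (q := ξ₄) (d := a) (by linarith [m3.1])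
    (by linarith [m4.2]) ha0 (by linarith [m3.2, m4.1]) q3 q4
  obtain ⟨ζ, l, s⟩ := h23.exists_small (p := η₁) (q := η₂) (d := a) (by linarith [m1.1, n1.1])
    (by linarith [m4.2, n2.2]) ha0 (by linarith [m2.2, m3.1, n1.2, n2.1]) r1 r2
  have c3 : ∀ x ∈ Icc 0 L, |g₃ x| ≤ C₃ := fun x hx =>
    h34.abs_value_le hK₄ b4 (ξ := ζ)
      ⟨by linarith [m1.1, n1.1, l.1], by linarith [m4.2, n2.2, l.2]⟩ s hx
  have c2 : ∀ x ∈ Icc 0 L, |g₂ x| ≤ C₂ := fun x hx =>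
    h23.abs_value_le p1 c3 (ξ := η₁)
      ⟨by linarith [m1.1, n1.1], by linarith [m2.2, n1.2]⟩ r1 hx
  have c1 : ∀ x ∈ Icc 0 L, |g₁ x| ≤ C₁ := fun x hx =>
    h12.abs_value_le p2 c2 (ξ := ξ₁) ⟨m1.1.le, by linarith [m1.2]⟩ q1 hx
  intro x hx
  exact ⟨(c1 x hx).trans (by linarith), (c2 x hx).trans (by linarith),
    (c3 x hx).trans (by linarith)⟩

theorem HasDerivInside.taylor_one (h01 : HasDerivInside L g₀ g₁) (h12 : HasDerivInside L g₁ g₂)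
    {K : ℝ} (hK : 0 ≤ K) (b2 : ∀ x ∈ Icc 0 L, |g₂ x| ≤ K) {x y : ℝ} (hx : x ∈ Icc 0 L)
    (hy : y ∈ Icc 0 L) : |g₀ y - g₀ x - g₁ x * (y - x)| ≤ K * |y - x| ^ 2 := by
  rcases eq_or_ne x y with rfl | h
  · simp
  obtain ⟨ξ, hξ, hd, e⟩ := h01.exists_between hx hy h
  have h1 := h12.abs_sub_le b2 hx (Ioo_subset_Icc_self hξ)
  rw [show g₀ y - g₀ x - g₁ x * (y - x) = (g₁ ξ - g₁ x) * (y - x) by rw [e]; ring, abs_mul, sq,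
    ← mul_assoc]
  gcongr
  exact h1.trans (by gcongr)

theorem HasDerivInside.taylor_two (h01 : HasDerivInside L g₀ g₁) (h12 : HasDerivInside L g₁ g₂)
    (h23 : HasDerivInside L g₂ g₃) {K : ℝ} (hK : 0 ≤ K) (b3 : ∀ x ∈ Icc 0 L, |g₃ x| ≤ K)
    {x y : ℝ} (hx : x ∈ Icc 0 L) (hy : y ∈ Icc 0 L) :
    |g₀ y - g₀ x - g₁ x * (y - x) - g₂ x * (y - x) ^ 2 / 2| ≤ K * |y - x| ^ 3 := by
  rcases eq_or_ne x y with rfl | h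
  · simp
  -- The derivative of the second-order remainder of g₀ is the first-order remainder of g₁. One mean
  -- value step therefore reduces to `taylor_one` applied to g₁.
  have hr : HasDerivInside L (fun z => g₀ z - g₁ x * (z - x) - g₂ x * (z - x) ^ 2 / 2)
      (fun z => g₁ z - g₁ x - g₂ x * (z - x)) := by
    refine ⟨?_, fun z hz => ?_⟩
    · exact (h01.1.sub (by fun_prop)).sub (by fun_prop)
    · have h1 : HasDerivAt (fun z : ℝ => z - x) 1 z := (hasDerivAt_id z).sub_const x
      have h2 := ((h01.2 z hz).sub (h1.const_mul (g₁ x))).sub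
        (((h1.pow 2).const_mul (g₂ x)).div_const 2)
      refine HasDerivAt.congr_deriv h2 ?_
      push_cast
      ring
  obtain ⟨ξ, hξ, hd, e⟩ := hr.exists_between hx hy h
  have h1 := h12.taylor_one h23 hK b3 hx (Ioo_subset_Icc_self hξ)
  rw [show g₀ y - g₀ x - g₁ x * (y - x) - g₂ x * (y - x) ^ 2 / 2
    = (g₁ ξ - g₁ x - g₂ x * (ξ - x)) * (y - x) by rw [← e]; ring, abs_mul, pow_succ, ← mul_assoc]
  gcongr
  exact h1.trans (by gcongr)

theorem hasDerivInside_iteratedDerivWithin (hL : 0 < L) {g : ℝ → ℝ}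
    (hg : ContDiffOn ℝ 4 g (Icc 0 L)) {m : ℕ} (hm : m < 4) :
    HasDerivInside L (iteratedDerivWithin m g (Icc 0 L))
      (iteratedDerivWithin (m + 1) g (Icc 0 L)) := by
  have hu := uniqueDiffOn_Icc hL
  have hm' : (m : WithTop ℕ∞) < 4 := by exact_mod_cast hm
  refine ⟨hg.continuousOn_iteratedDerivWithin hm'.le hu, fun x hx => ?_⟩
  have h1 := (hg.differentiableOn_iteratedDerivWithin hm' hu) x (Ioo_subset_Icc_self hx)
  have h2 := h1.hasDerivWithinAt
  rw [← iteratedDerivWithin_succ] at h2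
  exact h2.hasDerivAt (Icc_mem_nhds hx.1 hx.2)

end

/-! ### Uniform space regularity and difference quotients at the nodes -/

/-- Space regularity, uniformly in time: bounds for the function `w` and its space derivatives up
to order three. -/
structure SpaceBounds (L : ℝ) (K : ℝ) (w : ℝ → ℝ) (w₁ w₂ : ℝ → ℝ) : Prop where
  nonneg : 0 ≤ K
  zero : ∀ x ∈ Icc 0 L, |w x| ≤ K
  one : ∀ x ∈ Icc 0 L, |w₁ x| ≤ K
  two : ∀ x ∈ Icc 0 L, |w₂ x| ≤ K
  lip : ∀ x ∈ Icc 0 L, ∀ y ∈ Icc 0 L, |w y - w x| ≤ K * |y - x|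
  taylor_one : ∀ x ∈ Icc 0 L, ∀ y ∈ Icc 0 L, |w y - w x - w₁ x * (y - x)| ≤ K * |y - x| ^ 2
  taylor_two : ∀ x ∈ Icc 0 L, ∀ y ∈ Icc 0 L,
    |w y - w x - w₁ x * (y - x) - w₂ x * (y - x) ^ 2 / 2| ≤ K * |y - x| ^ 3

/-- u is bounded by compactness and its fourth derivative by assumption. Landau's inequality
supplies the intermediate derivatives with a constant independent of t. -/
theorem IsSolution.exists_spaceBounds {L T α : ℝ} {f : ℝ → ℝ → ℝ} {u₀ : ℝ → ℝ} {u : ℝ → ℝ → ℝ}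
    (hL : 0 < L) (hu : IsSolution L T α f u₀ u) :
    ∃ K, ∀ t ∈ Icc 0 T, SpaceBounds L K (fun x => u x t) (fun x => spaceDeriv L 1 u x t)
      (fun x => spaceDeriv L 2 u x t) := by
  obtain ⟨K₀, hK₀⟩ := (isCompact_Icc.prod isCompact_Icc).exists_bound_of_continuousOn hu.continuous
  obtain ⟨K₄, hK₄⟩ := hu.space_bound
  obtain ⟨C, hC0, hC1, hC⟩ := exists_derivative_bound hL |K₀| |K₄| (abs_nonneg _) (abs_nonneg _)
  refine ⟨C, fun t ht => ?_⟩
  have hd : ∀ m < 4, HasDerivInside L (fun x => spaceDeriv L m u x t)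
      (fun x => spaceDeriv L (m + 1) u x t) := fun m hm =>
    hasDerivInside_iteratedDerivWithin hL (hu.space_smooth t ht) hm
  have h01 : HasDerivInside L (fun x => u x t) (fun x => spaceDeriv L 1 u x t) := by
    have := hd 0 (by norm_num)
    simpa only [spaceDeriv, iteratedDerivWithin_zero] using this
  have h12 := hd 1 (by norm_num)
  have h23 := hd 2 (by norm_num)
  have h34 := hd 3 (by norm_num)
  have b0 : ∀ x ∈ Icc 0 L, |u x t| ≤ |K₀| := fun x hx =>
    (hK₀ (x, t) ⟨hx, ht⟩).trans (le_abs_self _)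
  have hb := hC _ _ _ _ _ h01 h12 h23 h34 b0
    fun x hx => (hK₄ x hx t ht).trans (le_abs_self _)
  exact
    { nonneg := hC0
      zero := fun x hx => (b0 x hx).trans hC1
      one := fun x hx => (hb x hx).1
      two := fun x hx => (hb x hx).2.1
      lip := fun x hx y hy => h01.abs_sub_le (fun x hx => (hb x hx).1) hx hy
      taylor_one := fun x hx y hy => h01.taylor_one h12 hC0 (fun x hx => (hb x hx).2.1) hx hy
      taylor_two := fun x hx y hy =>
        h01.taylor_two h12 h23 hC0 (fun x hx => (hb x hx).2.2) hx hy }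

theorem node_succ (L : ℝ) (J j : ℕ) : node L J (j + 1) = node L J j + hStep L J := by
  simp only [node]; push_cast; ring

theorem node_mem_Icc {L : ℝ} {J : ℕ} (hL : 0 < L) (hJ : 1 ≤ J) {j : ℕ} (hj : j ≤ J) :
    node L J j ∈ Icc 0 L := by
  have hh := hStep_pos hL hJ
  refine ⟨mul_nonneg (Nat.cast_nonneg _) hh.le, ?_⟩
  calc node L J j ≤ J * hStep L J := by unfold node; gcongr
    _ = L := mul_hStep hJ

theorem node_mem_Ioo {L : ℝ} {J : ℕ} (hL : 0 < L) {j : ℕ} (hj : j ∈ Finset.Ico 1 J) :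
    node L J j ∈ Ioo 0 L := by
  obtain ⟨h1, h2⟩ := Finset.mem_Ico.1 hj
  have hJ : 1 ≤ J := h1.trans h2.le
  have hh := hStep_pos hL hJ
  refine ⟨mul_pos (by exact_mod_cast h1) hh, ?_⟩
  calc node L J j < J * hStep L J := by unfold node; gcongr
    _ = L := mul_hStep hJ

theorem node_zero (L : ℝ) (J : ℕ) : node L J 0 = 0 := by simp [node]

theorem node_last {L : ℝ} {J : ℕ} (hJ : 1 ≤ J) : node L J J = L := mul_hStep hJ

section

variable {L K : ℝ} {J : ℕ} {w w₁ w₂ : ℝ → ℝ}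

theorem SpaceBounds.abs_succ_sub_le (H : SpaceBounds L K w w₁ w₂) (hL : 0 < L) (hJ : 1 ≤ J) {j : ℕ}
    (hj : j < J) : |w (node L J (j + 1)) - w (node L J j)| ≤ K * hStep L J := by
  have h := H.lip _ (node_mem_Icc hL hJ hj.le) _ (node_mem_Icc hL hJ (j := j + 1) hj)
  rwa [node_succ, add_sub_cancel_left, abs_of_pos (hStep_pos hL hJ), ← node_succ] at h

/-- First order in h is all that is needed, since the total residual is eventually compared with √h.
-/
theorem SpaceBounds.abs_secondDiff_sub_le (H : SpaceBounds L K w w₁ w₂) (hL : 0 < L) {j : ℕ}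
    (hj : j ∈ Finset.Ico 1 J) :
    |secondDiff (hStep L J) (fun i => w (node L J i)) j - w₂ (node L J j)|
      ≤ 2 * K * hStep L J := by
  obtain ⟨h1, h2⟩ := Finset.mem_Ico.1 hj
  have hJ : 1 ≤ J := h1.trans h2.le
  have hh := hStep_pos hL hJ
  obtain ⟨i, rfl⟩ : ∃ i, j = i + 1 := ⟨j - 1, by omega⟩
  have hx := node_mem_Icc hL hJ h2.le
  have t1 := H.taylor_two _ hx _ (node_mem_Icc hL hJ (j := i + 1 + 1) h2)
  have t2 := H.taylor_two _ hx _ (node_mem_Icc hL hJ (j := i) (by omega))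
  rw [node_succ L J (i + 1), add_sub_cancel_left, abs_of_pos hh] at t1
  rw [show node L J i - node L J (i + 1) = -hStep L J by rw [node_succ]; ring, abs_neg,
    abs_of_pos hh] at t2
  simp only [secondDiff, Nat.add_sub_cancel]
  rw [node_succ L J (i + 1), ← abs_of_pos (pow_pos hh 2),
    show (w (node L J (i + 1) + hStep L J) - 2 * w (node L J (i + 1)) + w (node L J i))
      / |hStep L J ^ 2| - w₂ (node L J (i + 1))
      = (w (node L J (i + 1) + hStep L J) - 2 * w (node L J (i + 1)) + w (node L J i)
        - hStep L J ^ 2 * w₂ (node L J (i + 1))) / |hStep L J ^ 2| by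
      rw [abs_of_pos (pow_pos hh 2)]; field_simp, abs_div, abs_abs,
    div_le_iff₀ (by positivity), abs_of_pos (pow_pos hh 2), abs_le]
  rw [abs_le] at t1 t2
  constructor <;> nlinarith [t1.1, t1.2, t2.1, t2.2]

theorem SpaceBounds.abs_centralDiff_sub_le (H : SpaceBounds L K w w₁ w₂) (hL : 0 < L) {j : ℕ}
    (hj : j ∈ Finset.Ico 1 J) :
    |centralDiff (hStep L J) (fun i => w (node L J i)) j - w₁ (node L J j)| ≤ K * hStep L J := by
  obtain ⟨h1, h2⟩ := Finset.mem_Ico.1 hj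
  have hJ : 1 ≤ J := h1.trans h2.le
  have hh := hStep_pos hL hJ
  obtain ⟨i, rfl⟩ : ∃ i, j = i + 1 := ⟨j - 1, by omega⟩
  have hx := node_mem_Icc hL hJ h2.le
  have t1 := H.taylor_one _ hx _ (node_mem_Icc hL hJ (j := i + 1 + 1) h2)
  have t2 := H.taylor_one _ hx _ (node_mem_Icc hL hJ (j := i) (by omega))
  rw [node_succ L J (i + 1), add_sub_cancel_left, abs_of_pos hh] at t1
  rw [show node L J i - node L J (i + 1) = -hStep L J by rw [node_succ]; ring, abs_neg,
    abs_of_pos hh] at t2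
  simp only [centralDiff, Nat.add_sub_cancel]
  rw [node_succ L J (i + 1),
    show (w (node L J (i + 1) + hStep L J) - w (node L J i)) / (2 * hStep L J)
      - w₁ (node L J (i + 1)) = (w (node L J (i + 1) + hStep L J) - w (node L J i)
        - 2 * hStep L J * w₁ (node L J (i + 1))) / (2 * hStep L J) by field_simp,
    abs_div, abs_of_pos (by positivity : 0 < 2 * hStep L J), div_le_iff₀ (by positivity), abs_le]
  rw [abs_le] at t1 t2
  constructor <;> nlinarith [t1.1, t1.2, t2.1, t2.2]

theorem SpaceBounds.abs_centralDiff_le (H : SpaceBounds L K w w₁ w₂) (hL : 0 < L) {j : ℕ}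
    (hj : j ∈ Finset.Ico 1 J) :
    |centralDiff (hStep L J) (fun i => w (node L J i)) j| ≤ K := by
  obtain ⟨h1, h2⟩ := Finset.mem_Ico.1 hj
  have hJ : 1 ≤ J := h1.trans h2.le
  have hh := hStep_pos hL hJ
  obtain ⟨i, rfl⟩ : ∃ i, j = i + 1 := ⟨j - 1, by omega⟩
  have t1 := abs_le.1 (H.abs_succ_sub_le hL hJ h2)
  have t2 := abs_le.1 (H.abs_succ_sub_le hL hJ (j := i) (by omega))
  simp only [centralDiff, Nat.add_sub_cancel]
  rw [abs_div, abs_of_pos (by positivity : 0 < 2 * hStep L J), div_le_iff₀ (by positivity), abs_le]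
  constructor <;> linarith [t1.1, t1.2, t2.1, t2.2]

theorem SpaceBounds.abs_localMean_le (H : SpaceBounds L K w w₁ w₂) (hL : 0 < L) {j : ℕ}
    (hj : j ∈ Finset.Ico 1 J) : |localMean (fun i => w (node L J i)) j| ≤ K := by
  obtain ⟨h1, h2⟩ := Finset.mem_Ico.1 hj
  have hJ : 1 ≤ J := h1.trans h2.le
  have t1 := abs_le.1 (H.zero _ (node_mem_Icc hL hJ (j := j - 1) (by omega)))
  have t2 := abs_le.1 (H.zero _ (node_mem_Icc hL hJ h2.le))
  have t3 := abs_le.1 (H.zero _ (node_mem_Icc hL hJ (j := j + 1) h2))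
  simp only [localMean]
  rw [abs_le]
  constructor <;> linarith [t1.1, t1.2, t2.1, t2.2, t3.1, t3.2]

theorem SpaceBounds.abs_localMean_sub_le (H : SpaceBounds L K w w₁ w₂) (hL : 0 < L) {j : ℕ}
    (hj : j ∈ Finset.Ico 1 J) :
    |localMean (fun i => w (node L J i)) j - w (node L J j)| ≤ K * hStep L J := by
  obtain ⟨h1, h2⟩ := Finset.mem_Ico.1 hj
  have hJ : 1 ≤ J := h1.trans h2.le
  have hh := mul_nonneg H.nonneg (hStep_pos hL hJ).le
  obtain ⟨i, rfl⟩ : ∃ i, j = i + 1 := ⟨j - 1, by omega⟩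
  have t1 := abs_le.1 (H.abs_succ_sub_le hL hJ h2)
  have t2 := abs_le.1 (H.abs_succ_sub_le hL hJ (j := i) (by omega))
  simp only [localMean, Nat.add_sub_cancel]
  rw [abs_le]
  constructor <;> linarith [t1.1, t1.2, t2.1, t2.2]

theorem SpaceBounds.abs_convec_sub_le (H : SpaceBounds L K w w₁ w₂) (hL : 0 < L) {j : ℕ}
    (hj : j ∈ Finset.Ico 1 J) :
    |convec (hStep L J) (fun i => w (node L J i)) j - w (node L J j) * w₁ (node L J j)|
      ≤ 2 * K ^ 2 * hStep L J := by
  obtain ⟨h1, h2⟩ := Finset.mem_Ico.1 hj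
  have hJ : 1 ≤ J := h1.trans h2.le
  have hh := mul_nonneg H.nonneg (hStep_pos hL hJ).le
  have t1 := H.abs_localMean_sub_le hL hj
  have t2 := H.abs_centralDiff_sub_le hL hj
  have t3 := H.abs_centralDiff_le hL hj
  have t4 := H.zero _ (node_mem_Icc hL hJ h2.le)
  set p := localMean (fun i => w (node L J i)) j
  set q := centralDiff (hStep L J) (fun i => w (node L J i)) j
  rw [convec, show p * q - w (node L J j) * w₁ (node L J j) = (p - w (node L J j)) * q
    + w (node L J j) * (q - w₁ (node L J j)) by ring]
  refine (abs_add_le _ _).trans ?_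
  rw [abs_mul, abs_mul]
  have t5 := mul_le_mul t1 t3 (abs_nonneg _) hh
  have t6 := mul_le_mul t4 t2 (abs_nonneg _) H.nonneg
  linarith

end

/-! ### Regularity in time -/

theorem timeDeriv_one (T : ℝ) (v : ℝ → ℝ → ℝ) (x t : ℝ) :
    timeDeriv T 1 v x t = derivWithin (fun s => v x s) (Ioc 0 T) t := by
  rw [timeDeriv, iteratedDerivWithin_one]

/-- A function whose derivative is `O(s^(σ-2))`, `σ > 0`, on `(0, T]` is integrable. -/
theorem intervalIntegrable_of_abs_derivWithin_le {T σ C : ℝ} (hT : 0 < T) (hσ : 0 < σ)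
    {g : ℝ → ℝ} (hg : DifferentiableOn ℝ g (Ioc 0 T))
    (H : ∀ s ∈ Ioc 0 T, |derivWithin g (Ioc 0 T) s| ≤ C * s ^ (σ - 2)) :
    IntervalIntegrable g MeasureTheory.volume 0 T := by
  -- Lowering the exponent to some ρ in (0, 1) makes the antiderivative of s^(ρ-2) a genuine power
  -- that is integrable at 0. The logarithmic case σ = 1 and the case σ > 1 then need no separate
  -- treatment.
  set ρ := min σ (1 / 2) with hρ
  have hρ0 : 0 < ρ := lt_min hσ (by norm_num)
  have hρ1 : ρ < 1 := (min_le_right _ _).trans_lt (by norm_num)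
  have hC : 0 ≤ C := by
    have h1 := (abs_nonneg _).trans (H T ⟨hT, le_rfl⟩)
    exact nonneg_of_mul_nonneg_left h1 (Real.rpow_pos_of_pos hT _)
  set D := C * T ^ (σ - ρ) with hD
  have hD0 : 0 ≤ D := by positivity
  have H' : ∀ s ∈ Ioo 0 T, HasDerivAt g (derivWithin g (Ioc 0 T) s) s ∧
      |derivWithin g (Ioc 0 T) s| ≤ D * s ^ (ρ - 2) := by
    intro s hs
    have hs' : s ∈ Ioc 0 T := Ioo_subset_Ioc_self hs
    refine ⟨((hg s hs').hasDerivWithinAt).hasDerivAt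
      (Filter.mem_of_superset (Ioo_mem_nhds hs.1 hs.2) Ioo_subset_Ioc_self), (H s hs').trans ?_⟩
    rw [hD, mul_assoc, show σ - 2 = (σ - ρ) + (ρ - 2) by ring, Real.rpow_add hs.1]
    have : σ - ρ ≥ 0 := sub_nonneg.2 (min_le_left _ _)
    gcongr
    · exact Real.rpow_nonneg hs.1.le _
    · exact hs.1.le
    · exact hs.2.le
  set B : ℝ → ℝ := fun s => -(D / (1 - ρ)) * s ^ (ρ - 1) with hB
  have hBd : ∀ s ∈ Ioo 0 T, HasDerivAt B (D * s ^ (ρ - 2)) s := by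
    intro s hs
    have h1 := (Real.hasDerivAt_rpow_const (p := ρ - 1) (Or.inl hs.1.ne')).const_mul
      (-(D / (1 - ρ)))
    refine h1.congr_deriv ?_
    have : 1 - ρ ≠ 0 := by linarith
    rw [show ρ - 1 - 1 = ρ - 2 by ring]
    field_simp
    ring
  have hBc : ContinuousOn B (Ioc 0 T) := fun s hs =>
    ((Real.continuousAt_rpow_const s _ (Or.inl hs.1.ne')).const_mul _).continuousWithinAt
  have hint : interior (Ioc 0 T) = Ioo 0 T := interior_Ioc
  -- Comparing g with the antiderivative B by monotonicity bounds |g(s)| by |g(T)| plus a multiple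
  -- of s^(ρ-1), without integrating g'.
  have m1 : MonotoneOn (fun s => g s + B s) (Ioc 0 T) := by
    refine monotoneOn_of_deriv_nonneg (convex_Ioc 0 T) (hg.continuousOn.add hBc) ?_ ?_ <;>
      rw [hint] <;> intro s hs
    · exact ((H' s hs).1.add (hBd s hs)).differentiableAt.differentiableWithinAt
    · have e : deriv (fun s => g s + B s) s = _ := ((H' s hs).1.add (hBd s hs)).deriv
      rw [e]
      linarith [(abs_le.1 (H' s hs).2).1]
  have m2 : AntitoneOn (fun s => g s - B s) (Ioc 0 T) := by
    refine antitoneOn_of_deriv_nonpos (convex_Ioc 0 T) (hg.continuousOn.sub hBc) ?_ ?_ <;>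
      rw [hint] <;> intro s hs
    · exact ((H' s hs).1.sub (hBd s hs)).differentiableAt.differentiableWithinAt
    · have e : deriv (fun s => g s - B s) s = _ := ((H' s hs).1.sub (hBd s hs)).deriv
      rw [e]
      linarith [(abs_le.1 (H' s hs).2).2]
  rw [intervalIntegrable_iff_integrableOn_Ioc_of_le hT.le]
  have hgi : MeasureTheory.IntegrableOn (fun s => |g T| + D / (1 - ρ) * s ^ (ρ - 1)) (Ioc 0 T) := by
    rw [← intervalIntegrable_iff_integrableOn_Ioc_of_le hT.le]
    exact intervalIntegrable_const.add
      ((intervalIntegral.intervalIntegrable_rpow' (by linarith)).const_mul _)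
  refine hgi.mono' (hg.continuousOn.aestronglyMeasurable measurableSet_Ioc) ?_
  filter_upwards [MeasureTheory.ae_restrict_mem measurableSet_Ioc] with s hs
  have hTm : T ∈ Ioc 0 T := ⟨hT, le_rfl⟩
  have h1 := m1 hs hTm hs.2
  have h2 := m2 hs hTm hs.2
  have h3 : B T ≤ 0 := by
    have : 0 ≤ D / (1 - ρ) * T ^ (ρ - 1) :=
      mul_nonneg (div_nonneg hD0 (by linarith)) (Real.rpow_nonneg hT.le _)
    simp only [hB]; linarith
  simp only [hB] at h1 h2 h3
  rw [Real.norm_eq_abs, abs_le]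
  constructor <;> linarith [neg_abs_le (g T), le_abs_self (g T)]

/-- The assumption on the time derivatives of `v`, in the form of pointwise bounds. -/
theorem nodalNorm_timeDeriv_le {L T σ M : ℝ} {v : ℝ → ℝ → ℝ}
    (hreg : ∀ J : ℕ, 1 ≤ J → ∀ t ∈ Ioc 0 T,
      t * nodalNorm L J (fun x => timeDeriv T 1 v x t)
        + t ^ 2 * nodalNorm L J (fun x => timeDeriv T 2 v x t) ≤ M * t ^ (σ - 1))
    {J : ℕ} (hJ : 1 ≤ J) {t : ℝ} (ht : t ∈ Ioc 0 T) :
    nodalNorm L J (fun x => timeDeriv T 1 v x t) ≤ M * t ^ (σ - 2) ∧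
      nodalNorm L J (fun x => timeDeriv T 2 v x t) ≤ M * t ^ (σ - 3) := by
  have h := hreg J hJ t ht
  have ht0 : 0 < t := ht.1
  have n1 : 0 ≤ nodalNorm L J (fun x => timeDeriv T 1 v x t) := gridNorm_nonneg ..
  have n2 : 0 ≤ nodalNorm L J (fun x => timeDeriv T 2 v x t) := gridNorm_nonneg ..
  have e1 : t ^ (σ - 1) = t ^ (σ - 2) * t := by
    rw [← Real.rpow_add_one ht0.ne']; congr 1; ring
  have e2 : t ^ (σ - 2) = t ^ (σ - 3) * t := by
    rw [← Real.rpow_add_one ht0.ne']; congr 1; ring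
  have p1 : 0 ≤ t ^ 2 * nodalNorm L J (fun x => timeDeriv T 2 v x t) := by positivity
  have p2 : 0 ≤ t * nodalNorm L J (fun x => timeDeriv T 1 v x t) := by positivity
  constructor
  · refine le_of_mul_le_mul_left ?_ ht0
    rw [e1] at h; linarith
  · refine le_of_mul_le_mul_left ?_ (pow_pos ht0 2)
    rw [e1, e2] at h; linarith

theorem nonneg_of_timeDeriv_bound {L T σ M : ℝ} (hT : 0 < T) {v : ℝ → ℝ → ℝ}
    (hreg : ∀ J : ℕ, 1 ≤ J → ∀ t ∈ Ioc 0 T,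
      t * nodalNorm L J (fun x => timeDeriv T 1 v x t)
        + t ^ 2 * nodalNorm L J (fun x => timeDeriv T 2 v x t) ≤ M * t ^ (σ - 1)) : 0 ≤ M := by
  have h := (nodalNorm_timeDeriv_le hreg le_rfl (⟨hT, le_rfl⟩ : T ∈ Ioc 0 T)).1
  exact nonneg_of_mul_nonneg_left ((gridNorm_nonneg ..).trans h) (Real.rpow_pos_of_pos hT _)

/-- The inverse inequality turns the norm bound into a pointwise one at each node. Its constant
depends on h, but only integrability is extracted. -/
theorem intervalIntegrable_node {L T σ M : ℝ} (hL : 0 < L) (hT : 0 < T) (hσ : 0 < σ)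
    {v : ℝ → ℝ → ℝ} (hv : TwiceDiffInTime L T v)
    (hreg : ∀ J : ℕ, 1 ≤ J → ∀ t ∈ Ioc 0 T,
      t * nodalNorm L J (fun x => timeDeriv T 1 v x t)
        + t ^ 2 * nodalNorm L J (fun x => timeDeriv T 2 v x t) ≤ M * t ^ (σ - 1))
    {J j : ℕ} (hj : j ∈ Finset.Ico 1 J) :
    IntervalIntegrable (fun s => v (node L J j) s) MeasureTheory.volume 0 T := by
  obtain ⟨h1, h2⟩ := Finset.mem_Ico.1 hj
  have hJ : 1 ≤ J := h1.trans h2.le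
  have hh := hStep_pos hL hJ
  refine intervalIntegrable_of_abs_derivWithin_le (C := M / √(hStep L J)) hT hσ
    (hv _ (node_mem_Ioo hL hj)).1 fun s hs => ?_
  have h3 := (nodalNorm_timeDeriv_le hreg hJ hs).1
  have hM := nonneg_of_timeDeriv_bound hT hreg
  have hs0 : 0 < s := hs.1
  rw [← timeDeriv_one]
  refine abs_le_of_gridNorm_le (w := fun j => timeDeriv T 1 v (node L J j) s) hL hJ
    (by positivity) (h3.trans (le_of_eq ?_)) hj
  have := (Real.sqrt_pos.2 hh).ne'
  field_simp

/-- Lipschitz continuity in time, in the discrete norm. -/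
theorem gridNorm_time_sub_le {L T σ M : ℝ} (hL : 0 < L) (hT : 0 < T) (hσ2 : σ ≤ 2)
    {v : ℝ → ℝ → ℝ} (hv : TwiceDiffInTime L T v)
    (hreg : ∀ J : ℕ, 1 ≤ J → ∀ t ∈ Ioc 0 T,
      t * nodalNorm L J (fun x => timeDeriv T 1 v x t)
        + t ^ 2 * nodalNorm L J (fun x => timeDeriv T 2 v x t) ≤ M * t ^ (σ - 1))
    {J : ℕ} (hJ : 1 ≤ J) {a b r s : ℝ} (ha : 0 < a) (hb : b ≤ T) (hr : r ∈ Icc a b)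
    (hs : s ∈ Icc a b) :
    gridNorm L J (fun j => v (node L J j) r - v (node L J j) s)
      ≤ M * ((b - a) * a ^ (σ - 2)) := by
  have hM := nonneg_of_timeDeriv_bound hT hreg
  have hab : 0 ≤ b - a := by linarith [hr.1, hr.2]
  refine gridNorm_le_of_inner hL hJ (by positivity) fun w => ?_
  have hd : ∀ ζ ∈ Icc a b, HasDerivWithinAt (fun ζ => gridInner L J (fun j => v (node L J j) ζ) w)
      (gridInner L J (fun j => timeDeriv T 1 v (node L J j) ζ) w) (Icc a b) ζ := by
    intro ζ hζ
    have hζ' : ζ ∈ Ioc 0 T := ⟨ha.trans_le hζ.1, hζ.2.trans hb⟩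
    refine HasDerivWithinAt.const_mul _ (HasDerivWithinAt.fun_sum fun j hj => ?_)
    refine HasDerivWithinAt.mul_const ?_ _
    beta_reduce
    rw [timeDeriv_one]
    exact (((hv _ (node_mem_Ioo hL hj)).1 ζ hζ').hasDerivWithinAt).mono
      fun y hy => ⟨ha.trans_le hy.1, hy.2.trans hb⟩
  have hbd : ∀ ζ ∈ Icc a b, ‖gridInner L J (fun j => timeDeriv T 1 v (node L J j) ζ) w‖
      ≤ M * a ^ (σ - 2) * gridNorm L J w := by
    intro ζ hζ
    have hζ' : ζ ∈ Ioc 0 T := ⟨ha.trans_le hζ.1, hζ.2.trans hb⟩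
    refine (abs_gridInner_le hL hJ _ _).trans ?_
    have h1 := (nodalNorm_timeDeriv_le hreg hJ hζ').1
    have h2 : ζ ^ (σ - 2) ≤ a ^ (σ - 2) :=
      Real.rpow_le_rpow_of_nonpos ha hζ.1 (by linarith)
    exact mul_le_mul_of_nonneg_right (h1.trans (mul_le_mul_of_nonneg_left h2 hM))
      (gridNorm_nonneg ..)
  have h := (convex_Icc a b).norm_image_sub_le_of_norm_hasDerivWithin_le hd hbd hs hr
  rw [gridInner_sub_left]
  have h2 : ‖r - s‖ ≤ b - a := by
    rw [Real.norm_eq_abs, abs_le]; constructor <;> linarith [hr.1, hr.2, hs.1, hs.2]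
  have h3 : 0 ≤ M * a ^ (σ - 2) * gridNorm L J w :=
    mul_nonneg (by positivity) (gridNorm_nonneg ..)
  calc _ ≤ _ := le_abs_self _
    _ ≤ M * a ^ (σ - 2) * gridNorm L J w * ‖r - s‖ := h
    _ ≤ M * a ^ (σ - 2) * gridNorm L J w * (b - a) := by gcongr
    _ = _ := by ring

/-! ### The fractional integral and its discretisation -/

section

variable {α T K : ℝ} {Φ : ℝ → ℝ}

theorem intervalIntegrable_abelKernel_mul (hα : 0 < α) (hc : ContinuousOn Φ (Ioc 0 T))
    (hK : ∀ ζ ∈ Ioc 0 T, |Φ ζ| ≤ K) {τ a b : ℝ} (ha : 0 ≤ a) (hab : a ≤ b) (hb : b ≤ T) :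
    IntervalIntegrable (fun ζ => abelKernel α (τ - ζ) * Φ ζ) MeasureTheory.volume a b := by
  have h1 := intervalIntegrable_abelKernel_sub hα τ a b
  rw [intervalIntegrable_iff_integrableOn_Ioc_of_le hab] at h1 ⊢
  have hsub : Ioc a b ⊆ Ioc 0 T := Ioc_subset_Ioc ha hb
  refine MeasureTheory.Integrable.mul_bdd (c := K) h1
    ((hc.mono hsub).aestronglyMeasurable measurableSet_Ioc) ?_
  filter_upwards [MeasureTheory.ae_restrict_mem measurableSet_Ioc] with ζ hζ
  exact hK ζ (hsub hζ)

theorem abs_integral_abelKernel_mul_le (hα : 0 < α) {d τ a b : ℝ}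
    (hd : ∀ ζ ∈ Ioc a b, |Φ ζ| ≤ d) (hab : a ≤ b) (hb : b ≤ τ) :
    |∫ ζ in a..b, abelKernel α (τ - ζ) * Φ ζ| ≤ d * ∫ ζ in a..b, abelKernel α (τ - ζ) := by
  rw [← intervalIntegral.integral_const_mul, ← Real.norm_eq_abs]
  refine intervalIntegral.norm_integral_le_of_norm_le hab ?_
    ((intervalIntegrable_abelKernel_sub hα τ a b).const_mul _)
  filter_upwards with ζ hζ
  have h1 := abelKernel_nonneg hα (by linarith [hζ.2] : 0 ≤ τ - ζ)
  rw [Real.norm_eq_abs, abs_mul, abs_of_nonneg h1, mul_comm]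
  exact mul_le_mul_of_nonneg_right (hd ζ hζ) h1

/-- Measurability in τ comes from viewing the convolution as a partial integral of a jointly
measurable function. The bound is K times the primitive of the kernel. -/
theorem intervalIntegrable_fracIntegral (hα : 0 < α) (hT : 0 < T) (hc : ContinuousOn Φ (Ioc 0 T))
    (hK : ∀ ζ ∈ Ioc 0 T, |Φ ζ| ≤ K) :
    IntervalIntegrable (fracIntegral α Φ) MeasureTheory.volume 0 T := by
  rw [intervalIntegrable_iff_integrableOn_Ioc_of_le hT.le]
  set μ := MeasureTheory.volume.restrict (Ioc 0 T) with hμ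
  have hΦ : MeasureTheory.AEStronglyMeasurable Φ μ := hc.aestronglyMeasurable measurableSet_Ioc
  set G : ℝ × ℝ → ℝ := fun p =>
    ({p : ℝ × ℝ | p.2 ≤ p.1}.indicator (fun p => abelKernel α (p.1 - p.2)) p) * Φ p.2 with hG
  have hGm : MeasureTheory.AEStronglyMeasurable G (μ.prod μ) := by
    refine MeasureTheory.AEStronglyMeasurable.mul ?_ hΦ.comp_snd
    have h1 : Measurable fun p : ℝ × ℝ => abelKernel α (p.1 - p.2) := by
      unfold abelKernel; fun_prop
    exact (h1.indicator (measurableSet_le measurable_snd measurable_fst)).aestronglyMeasurable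
  have h2 := hGm.integral_prod_right'
  have h3 : ∀ τ ∈ Ioc 0 T, ∫ ζ, G (τ, ζ) ∂μ = fracIntegral α Φ τ := by
    intro τ hτ
    rw [fracIntegral, intervalIntegral.integral_of_le hτ.1.le]
    have e : (fun ζ => G (τ, ζ))
        = (Iic τ).indicator fun ζ => abelKernel α (τ - ζ) * Φ ζ := by
      funext ζ
      by_cases h : ζ ≤ τ <;> simp [hG, indicator, h]
    rw [e, MeasureTheory.integral_indicator measurableSet_Iic, hμ,
      MeasureTheory.Measure.restrict_restrict measurableSet_Iic]
    congr 2
    ext ζ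
    simp only [mem_inter_iff, mem_Iic, mem_Ioc]
    constructor
    · rintro ⟨h1, h2, _⟩; exact ⟨h2, h1⟩
    · rintro ⟨h1, h2⟩; exact ⟨h2, h1, h2.trans hτ.2⟩
  have h4 : MeasureTheory.AEStronglyMeasurable (fracIntegral α Φ) μ := by
    refine h2.congr ?_
    filter_upwards [MeasureTheory.ae_restrict_mem measurableSet_Ioc] with τ hτ using h3 τ hτ
  have hK0 : 0 ≤ K := (abs_nonneg _).trans (hK T ⟨hT, le_rfl⟩)
  refine MeasureTheory.Integrable.mono' (g := fun _ => K * abelPrim α T)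
    (MeasureTheory.integrable_const _) h4 ?_
  filter_upwards [MeasureTheory.ae_restrict_mem measurableSet_Ioc] with τ hτ
  have h5 := abs_integral_abelKernel_mul_le hα (Φ := Φ) (d := K) (τ := τ) (a := 0) (b := τ)
    (fun ζ hζ => hK ζ ⟨hζ.1, hζ.2.trans hτ.2⟩) hτ.1.le le_rfl
  refine h5.trans (mul_le_mul_of_nonneg_left ?_ hK0)
  rw [integral_abelKernel_sub hα hτ.1.le le_rfl, sub_zero, sub_self τ, abelPrim_of_nonpos hα le_rfl, sub_zero]
  exact abelPrim_mono hα hτ.2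

theorem sum_Icc_one_eq_sum_range (g : ℕ → ℝ) (n : ℕ) :
    ∑ s ∈ Finset.Icc 1 n, g s = ∑ i ∈ Finset.range n, g (i + 1) := by
  induction n with
  | zero => simp
  | succ n ih => rw [Finset.sum_Icc_succ_top (by omega), ih, Finset.sum_range_succ]

/-- The quadrature error for a function that deviates at most by `d s` from `c s` in the `s`-th
mesh interval. -/
theorem abs_integral_fracIntegral_sub_le (hα : 0 < α) (hT : 0 < T)
    (hc : ContinuousOn Φ (Ioc 0 T)) (hK : ∀ ζ ∈ Ioc 0 T, |Φ ζ| ≤ K) {t : ℕ → ℝ} {N : ℕ}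
    (ht : ∀ n, 1 ≤ n → n ≤ N → t (n - 1) < t n) (h0 : t 0 = 0) (hN : t N ≤ T) {c d : ℕ → ℝ}
    {n : ℕ} (h1 : 1 ≤ n) (hn : n ≤ N)
    (hd : ∀ s ∈ Finset.Icc 1 n, ∀ ζ ∈ Ioc (t (s - 1)) (t s), |Φ ζ - c s| ≤ d s) :
    |(∫ τ in (t (n - 1))..(t n), fracIntegral α Φ τ)
      - ∑ s ∈ Finset.Icc 1 n, kernelMass α t n s * c s|
      ≤ ∑ s ∈ Finset.Icc 1 n, kernelMass α t n s * d s := by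
  have hlt := ht n h1 hn
  have hpos : 0 ≤ t (n - 1) := by rw [← h0]; exact mesh_mono ht (by omega) (by omega)
  have htn : t n ≤ T := (mesh_mono ht hn le_rfl).trans hN
  set b : ℕ → ℝ → ℝ := fun s τ => ∫ ζ in (t (s - 1))..(min τ (t s)), abelKernel α (τ - ζ) with hb
  have hsn : ∀ s ∈ Finset.Icc 1 n, t (s - 1) ≤ t (n - 1) := fun s hs => by
    obtain ⟨h2, h3⟩ := Finset.mem_Icc.1 hs
    exact mesh_mono ht (by omega) (by omega)
  have hbi : ∀ s ∈ Finset.Icc 1 n,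
      IntervalIntegrable (b s) MeasureTheory.volume (t (n - 1)) (t n) := by
    intro s hs
    have h2 : Continuous fun τ => abelPrim α (τ - t (s - 1)) - abelPrim α (τ - t s) :=
      ((continuous_abelPrim hα).comp (continuous_id.sub continuous_const)).sub
        ((continuous_abelPrim hα).comp (continuous_id.sub continuous_const))
    refine (h2.intervalIntegrable _ _).congr ?_
    intro τ hτ
    rw [uIoc_of_le hlt.le] at hτ
    exact (integral_abelKernel_sub_min hα ((hsn s hs).trans hτ.1.le)).symm
  have hfi : IntervalIntegrable (fracIntegral α Φ) MeasureTheory.volume (t (n - 1)) (t n) := by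
    refine (intervalIntegrable_fracIntegral hα hT hc hK).mono_set ?_
    rw [uIcc_of_le hlt.le, uIcc_of_le hT.le]
    exact Icc_subset_Icc hpos htn
  have hsc : IntervalIntegrable (fun τ => ∑ s ∈ Finset.Icc 1 n, b s τ * c s)
      MeasureTheory.volume (t (n - 1)) (t n) := by
    have := IntervalIntegrable.sum (Finset.Icc 1 n) fun s hs => (hbi s hs).mul_const (c s)
    simpa [Finset.sum_fn] using this
  have hsd : IntervalIntegrable (fun τ => ∑ s ∈ Finset.Icc 1 n, b s τ * d s)
      MeasureTheory.volume (t (n - 1)) (t n) := by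
    have := IntervalIntegrable.sum (Finset.Icc 1 n) fun s hs => (hbi s hs).mul_const (d s)
    simpa [Finset.sum_fn] using this
  have hic : ∀ c : ℕ → ℝ, ∑ s ∈ Finset.Icc 1 n, kernelMass α t n s * c s
      = ∫ τ in (t (n - 1))..(t n), ∑ s ∈ Finset.Icc 1 n, b s τ * c s := by
    intro c
    rw [intervalIntegral.integral_finsetSum fun s hs => (hbi s hs).mul_const (c s)]
    refine Finset.sum_congr rfl fun s _ => ?_
    rw [intervalIntegral.integral_mul_const]
    rfl
  rw [hic c, hic d, ← intervalIntegral.integral_sub hfi hsc, ← Real.norm_eq_abs]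
  refine intervalIntegral.norm_integral_le_of_norm_le hlt.le ?_ hsd
  filter_upwards with τ hτ
  have hτT : τ ≤ T := hτ.2.trans htn
  have hτ0 : 0 ≤ τ := hpos.trans hτ.1.le
  have hp : ∀ s ∈ Finset.Icc 1 n, t (s - 1) ≤ min τ (t s) := fun s hs => by
    obtain ⟨h2, h3⟩ := Finset.mem_Icc.1 hs
    exact le_min ((hsn s hs).trans hτ.1.le) (ht s h2 (h3.trans hn)).le
  have hnn : ∀ s ∈ Finset.Icc 1 n, 0 ≤ t (s - 1) := fun s hs => by
    obtain ⟨h2, h3⟩ := Finset.mem_Icc.1 hs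
    rw [← h0]; exact mesh_mono ht (by omega) (by omega)
  have hii : ∀ s ∈ Finset.Icc 1 n, IntervalIntegrable (fun ζ => abelKernel α (τ - ζ) * Φ ζ)
      MeasureTheory.volume (t (s - 1)) (min τ (t s)) := fun s hs =>
    intervalIntegrable_abelKernel_mul hα hc hK (hnn s hs) (hp s hs) ((min_le_left _ _).trans hτT)
  have hdec : fracIntegral α Φ τ = ∑ s ∈ Finset.Icc 1 n,
      ∫ ζ in (t (s - 1))..(min τ (t s)), abelKernel α (τ - ζ) * Φ ζ := by
    -- For i < n the node t_i lies to the left of τ, so replacing t_i by min(τ, t_i) changes only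
    -- the last breakpoint, which becomes τ.
    have hmin : ∀ i < n, min τ (t i) = t i := fun i hi =>
      min_eq_right (by
        have := hsn (i + 1) (by simp; omega)
        simp only [Nat.add_sub_cancel] at this
        exact this.trans hτ.1.le)
    have h2 := intervalIntegral.sum_integral_adjacent_intervals
      (f := fun ζ => abelKernel α (τ - ζ) * Φ ζ) (μ := MeasureTheory.volume)
      (a := fun i => min τ (t i)) (n := n) fun i hi => by
        have := hii (i + 1) (by simp; omega)
        simp only [Nat.add_sub_cancel] at this
        rw [hmin i hi]
        exact this
    rw [sum_Icc_one_eq_sum_range, fracIntegral]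
    simp only [h0, min_eq_right hτ0, min_eq_left hτ.2] at h2
    rw [← h2]
    refine Finset.sum_congr rfl fun i hi => ?_
    rw [Nat.add_sub_cancel, hmin i (Finset.mem_range.1 hi)]
  rw [hdec, ← Finset.sum_sub_distrib]
  refine (Finset.abs_sum_le_sum_abs _ _).trans (Finset.sum_le_sum fun s hs => ?_)
  have e : (∫ ζ in (t (s - 1))..(min τ (t s)), abelKernel α (τ - ζ) * Φ ζ) - b s τ * c s
      = ∫ ζ in (t (s - 1))..(min τ (t s)), abelKernel α (τ - ζ) * (Φ ζ - c s) := by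
    simp only [hb, mul_sub]
    rw [intervalIntegral.integral_sub (hii s hs)
      ((intervalIntegrable_abelKernel_sub hα τ _ _).mul_const _),
      intervalIntegral.integral_mul_const]
  rw [e, mul_comm (b s τ)]
  exact abs_integral_abelKernel_mul_le hα
    (fun ζ hζ => hd s hs ζ ⟨hζ.1, hζ.2.trans (min_le_right _ _)⟩) (hp s hs) (min_le_left _ _)

end

/-! ### Graded meshes -/

section

variable {T σ γ cγ Cγ k : ℝ} {N : ℕ} {t : ℕ → ℝ}

theorem IsGradedMesh.pos (H : IsGradedMesh T γ cγ Cγ k N t) {n : ℕ} (h1 : 1 ≤ n) (hn : n ≤ N) :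
    0 < t n := by
  have h2 := H.increasing 1 le_rfl (h1.trans hn)
  simp only [Nat.sub_self, H.zero] at h2
  exact h2.trans_le (mesh_mono H.increasing h1 hn)

theorem IsGradedMesh.le_T (H : IsGradedMesh T γ cγ Cγ k N t) {n : ℕ} (hn : n ≤ N) : t n ≤ T :=
  (mesh_mono H.increasing hn le_rfl).trans H.le_final

theorem IsGradedMesh.tStep_pos (H : IsGradedMesh T γ cγ Cγ k N t) {n : ℕ} (h1 : 1 ≤ n)
    (hn : n ≤ N) : 0 < tStep t n := sub_pos.2 (H.increasing n h1 hn)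

theorem IsGradedMesh.const_pos (H : IsGradedMesh T γ cγ Cγ k N t) (hN : 1 ≤ N) : 0 < Cγ := by
  have h1 := (H.tStep_pos le_rfl hN).trans_le (H.step_le 1 le_rfl hN)
  have h2 : 0 < min 1 (t 1 ^ (1 - 1 / γ)) :=
    lt_min one_pos (Real.rpow_pos_of_pos (H.pos le_rfl hN) _)
  by_contra! hc
  have := mul_nonpos_of_nonpos_of_nonneg (mul_nonpos_of_nonpos_of_nonneg hc H.k_pos.le) h2.le
  linarith

theorem IsGradedMesh.tStep_le (H : IsGradedMesh T γ cγ Cγ k N t) {n : ℕ} (h1 : 1 ≤ n)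
    (hn : n ≤ N) : tStep t n ≤ Cγ * k := by
  refine (H.step_le n h1 hn).trans ?_
  have := mul_pos (H.const_pos (h1.trans hn)) H.k_pos
  exact mul_le_of_le_one_right this.le (min_le_left _ _)

theorem IsGradedMesh.tStep_le_rpow (H : IsGradedMesh T γ cγ Cγ k N t) (hγ : γ = 2 / σ) {n : ℕ}
    (h1 : 1 ≤ n) (hn : n ≤ N) : tStep t n ≤ Cγ * k * t n ^ (1 - σ / 2) := by
  refine (H.step_le n h1 hn).trans ?_
  have := mul_pos (H.const_pos (h1.trans hn)) H.k_pos
  rw [show 1 - 1 / γ = 1 - σ / 2 by rw [hγ, one_div_div]]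
  exact mul_le_mul_of_nonneg_left (min_le_right _ _) this.le

/-- The size of the deviation of the solution from its stage value in the `n`-th mesh interval. -/
noncomputable def meshDev (σ : ℝ) (t : ℕ → ℝ) (n : ℕ) : ℝ :=
  if n = 1 then 1 + t 1 ^ (σ - 1) else tStep t n * t (n - 1) ^ (σ - 2)

theorem IsGradedMesh.meshDev_nonneg (H : IsGradedMesh T γ cγ Cγ k N t) {n : ℕ} (h1 : 1 ≤ n)
    (hn : n ≤ N) : 0 ≤ meshDev σ t n := by
  unfold meshDev
  split_ifs with h
  · have := Real.rpow_nonneg (H.pos le_rfl (h1.trans hn)).le (σ - 1)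
    linarith
  · exact mul_nonneg (H.tStep_pos h1 hn).le
      (Real.rpow_nonneg (H.pos (by omega) (by omega)).le _)

/-- Concavity of y ↦ y^p, in the form of Bernoulli's inequality at x/y. -/
theorem mul_sub_le_rpow_sub_rpow {p x y : ℝ} (hp : 0 < p) (hp1 : p ≤ 1) (hx : 0 < x) (hxy : x ≤ y) :
    p * ((y - x) * y ^ (p - 1)) ≤ y ^ p - x ^ p := by
  have hy : 0 < y := hx.trans_le hxy
  have h1 := rpow_one_add_le_one_add_mul_self (s := x / y - 1)
    (by have := div_pos hx hy; linarith) hp.le hp1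
  rw [show 1 + (x / y - 1) = x / y by ring, Real.div_rpow hx.le hy.le,
    div_le_iff₀ (Real.rpow_pos_of_pos hy p)] at h1
  rw [Real.rpow_sub_one hy.ne']
  have h2 : p * ((y - x) * (y ^ p / y)) = -(p * (x / y - 1) * y ^ p) := by
    field_simp; ring
  rw [h2]
  linarith

/-- Here the grading γ = 2/σ acts: one factor k_n ≤ C k t_n^(1-σ/2) turns k_n² t_{n-1}^(σ-2) into a
multiple of k · k_n t_n^(σ/2-1). By concavity this is at most a multiple of k times the increment of
t^(σ/2), so the sum telescopes. In the first interval k_1 = t_1 ≤ Ck and t_1^σ ≤ (Ck)². -/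
theorem IsGradedMesh.sum_tStep_mul_meshDev_le (H : IsGradedMesh T γ cγ Cγ k N t) (hσ : 0 < σ)
    (hσ2 : σ ≤ 2) (hγ : γ = 2 / σ) (hk1 : k ≤ 1) (hN : 1 ≤ N) :
    ∑ n ∈ Finset.Icc 1 N, tStep t n * meshDev σ t n
      ≤ (Cγ + Cγ ^ 2 + Cγ ^ (3 - σ) * (2 / σ) * T ^ (σ / 2)) * k := by
  have hC := H.const_pos hN
  have hk := H.k_pos
  have ht1 := H.pos le_rfl hN
  have hσ2' : 0 < σ / 2 := by positivity
  have hfirst : tStep t 1 * meshDev σ t 1 ≤ (Cγ + Cγ ^ 2) * k := by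
    have e1 : tStep t 1 = t 1 := by simp [tStep, H.zero]
    have h1 := H.tStep_le le_rfl hN
    have h2 := H.tStep_le_rpow hγ le_rfl hN
    rw [e1] at h1 h2
    have h3 : t 1 ^ (σ / 2) ≤ Cγ * k := by
      have e : t 1 = t 1 ^ (σ / 2) * t 1 ^ (1 - σ / 2) := by
        rw [← Real.rpow_add ht1]; simp
      have h4 : t 1 ^ (σ / 2) * t 1 ^ (1 - σ / 2) ≤ Cγ * k * t 1 ^ (1 - σ / 2) := by
        rw [← e]; exact h2
      exact le_of_mul_le_mul_right h4 (Real.rpow_pos_of_pos ht1 _)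
    have h5 : t 1 * t 1 ^ (σ - 1) = (t 1 ^ (σ / 2)) ^ 2 := by
      rw [← Real.rpow_natCast, ← Real.rpow_mul ht1.le, mul_comm, ← Real.rpow_add_one ht1.ne']
      congr 1; push_cast; ring
    have h6 : (t 1 ^ (σ / 2)) ^ 2 ≤ (Cγ * k) ^ 2 :=
      pow_le_pow_left₀ (Real.rpow_nonneg ht1.le _) h3 2
    have h7 : (Cγ * k) ^ 2 ≤ Cγ ^ 2 * k := by
      rw [mul_pow]
      have : k ^ 2 ≤ k := by nlinarith
      gcongr
    rw [e1, meshDev, if_pos rfl, mul_add, h5]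
    linarith
  have hlater : ∀ n ∈ Finset.Ioc 1 N, tStep t n * meshDev σ t n
      ≤ Cγ ^ (3 - σ) * k * (2 / σ) * (t n ^ (σ / 2) - t (n - 1) ^ (σ / 2)) := by
    intro n hn
    obtain ⟨h1, h2⟩ := Finset.mem_Ioc.1 hn
    have p0 := H.pos (n := n - 1) (by omega) (by omega)
    have p1 := H.pos (n := n) (by omega) h2
    have ps := H.tStep_pos (n := n) (by omega) h2
    have hmv := mul_sub_le_rpow_sub_rpow hσ2' (by linarith) p0 (H.increasing n (by omega) h2).le
    -- The bounded ratio t_n/t_{n-1} allows the singular weight to be moved from the left end of the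
    -- interval to the right end.
    have h3 : t (n - 1) ^ (σ - 2) ≤ Cγ ^ (2 - σ) * t n ^ (σ - 2) := by
      have h4 : (t n / Cγ) ≤ t (n - 1) := by
        rw [div_le_iff₀ hC]; linarith [H.ratio_le n (by omega) h2]
      have h5 := Real.rpow_le_rpow_of_nonpos (div_pos p1 hC) h4 (by linarith : σ - 2 ≤ 0)
      rw [Real.div_rpow p1.le hC.le] at h5
      refine h5.trans (le_of_eq ?_)
      rw [show 2 - σ = -(σ - 2) by ring, Real.rpow_neg hC.le]
      field_simp
    have h6 := H.tStep_le_rpow hγ (by omega : 1 ≤ n) h2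
    rw [meshDev, if_neg (by omega)]
    have hc2 : 0 ≤ Cγ ^ (2 - σ) := Real.rpow_nonneg hC.le _
    have hp2 : 0 ≤ t n ^ (σ - 2) := Real.rpow_nonneg p1.le _
    calc tStep t n * (tStep t n * t (n - 1) ^ (σ - 2))
        ≤ tStep t n * ((Cγ * k * t n ^ (1 - σ / 2)) * (Cγ ^ (2 - σ) * t n ^ (σ - 2))) := by
          gcongr
      _ = (Cγ ^ (2 - σ) * Cγ) * k * (tStep t n * (t n ^ (1 - σ / 2) * t n ^ (σ - 2))) := by ring
      _ = Cγ ^ (3 - σ) * k * (2 / σ) * (σ / 2 * (tStep t n * t n ^ (σ / 2 - 1))) := by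
          rw [← Real.rpow_add_one hC.ne', ← Real.rpow_add p1,
            show 2 - σ + 1 = 3 - σ by ring, show 1 - σ / 2 + (σ - 2) = σ / 2 - 1 by ring]
          field_simp
      _ ≤ _ := by
          have : 0 ≤ Cγ ^ (3 - σ) * k * (2 / σ) := by positivity
          exact mul_le_mul_of_nonneg_left hmv this
  rw [← Finset.add_sum_Ioc_eq_sum_Icc hN]
  have hsum := Finset.sum_le_sum hlater
  rw [← Finset.mul_sum] at hsum
  have htel : ∑ n ∈ Finset.Ioc 1 N, (t n ^ (σ / 2) - t (n - 1) ^ (σ / 2)) ≤ T ^ (σ / 2) := by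
    have h1 := sum_Icc_sub (fun n => t n ^ (σ / 2)) hN
    rw [← Finset.add_sum_Ioc_eq_sum_Icc hN] at h1
    simp only [Nat.sub_self, H.zero, Real.zero_rpow hσ2'.ne', sub_zero] at h1
    have h2 : t N ^ (σ / 2) ≤ T ^ (σ / 2) :=
      Real.rpow_le_rpow (H.pos hN le_rfl).le H.le_final hσ2'.le
    have h3 := Real.rpow_nonneg ht1.le (σ / 2)
    linarith
  have h8 : Cγ ^ (3 - σ) * k * (2 / σ) * ∑ n ∈ Finset.Ioc 1 N, (t n ^ (σ / 2) - t (n - 1) ^ (σ / 2))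
      ≤ Cγ ^ (3 - σ) * k * (2 / σ) * T ^ (σ / 2) := by
    gcongr
  linarith

end

/-! ### Consistency of the scheme -/

/-- A classical solution with the assumed regularity in time and with quantified bounds in space. -/
structure IsRegularSolution (L T α σ M K : ℝ) (f : ℝ → ℝ → ℝ) (u₀ : ℝ → ℝ) (u : ℝ → ℝ → ℝ) :
    Prop where
  L_pos : 0 < L
  T_pos : 0 < T
  α_pos : 0 < α
  σ_pos : 0 < σ
  σ_le : σ ≤ 2
  sol : IsSolution L T α f u₀ u
  bounds : ∀ t ∈ Icc 0 T, SpaceBounds L K (fun x => u x t) (fun x => spaceDeriv L 1 u x t)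
    (fun x => spaceDeriv L 2 u x t)
  u_diff : TwiceDiffInTime L T (spaceDeriv L 2 u)
  f_diff : TwiceDiffInTime L T f
  u_reg : ∀ J : ℕ, 1 ≤ J → ∀ t ∈ Ioc 0 T,
    t * nodalNorm L J (fun x => timeDeriv T 1 (spaceDeriv L 2 u) x t)
      + t ^ 2 * nodalNorm L J (fun x => timeDeriv T 2 (spaceDeriv L 2 u) x t) ≤ M * t ^ (σ - 1)
  f_reg : ∀ J : ℕ, 1 ≤ J → ∀ t ∈ Ioc 0 T,
    t * nodalNorm L J (fun x => timeDeriv T 1 f x t)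
      + t ^ 2 * nodalNorm L J (fun x => timeDeriv T 2 f x t) ≤ M * t ^ (σ - 1)

/-- The nodal values of the solution at the mesh times. -/
noncomputable def exactGrid (L : ℝ) (J : ℕ) (t : ℕ → ℝ) (u : ℝ → ℝ → ℝ) (n j : ℕ) : ℝ :=
  u (node L J j) (t n)

/-- The residual of the solution in the `n`-th equation of the scheme, multiplied by the step. -/
noncomputable def residual (L α : ℝ) (J : ℕ) (t : ℕ → ℝ) (u : ℝ → ℝ → ℝ) (F : ℕ → ℕ → ℝ)
    (n j : ℕ) : ℝ :=
  exactGrid L J t u n j - exactGrid L J t u (n - 1) j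
    + tStep t n * convec (hStep L J) (stageGrid (exactGrid L J t u) n) j
    - ∑ s ∈ Finset.Icc 1 n,
        kernelMass α t n s * secondDiff (hStep L J) (stageGrid (exactGrid L J t u) s) j
    - tStep t n * F n j

theorem abs_stage_le {W : ℕ → ℝ} {n : ℕ} {B : ℝ} (h1 : |W n| ≤ B) (h2 : |W (n - 1)| ≤ B) :
    |stage W n| ≤ B := by
  unfold stage tMean
  split_ifs with h
  · rwa [h] at h1
  · rw [abs_le] at h1 h2 ⊢
    constructor <;> linarith [h1.1, h1.2, h2.1, h2.2]

theorem secondDiff_stageGrid (h : ℝ) (e : ℕ → ℕ → ℝ) (n j : ℕ) :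
    secondDiff h (stageGrid e n) j = stage (fun m => secondDiff h (e m) j) n := by
  simp only [secondDiff, stageGrid, stage, tMean]
  split_ifs <;> ring

theorem localMean_stageGrid (e : ℕ → ℕ → ℝ) (n j : ℕ) :
    localMean (stageGrid e n) j = stage (fun m => localMean (e m) j) n := by
  simp only [localMean, stageGrid, stage, tMean]
  split_ifs <;> ring

section

variable {L T α σ M K : ℝ} {f : ℝ → ℝ → ℝ} {u₀ : ℝ → ℝ} {u : ℝ → ℝ → ℝ}
  {γ cγ Cγ Cf k : ℝ} {J N : ℕ} {t : ℕ → ℝ} {F : ℕ → ℕ → ℝ}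

theorem IsRegularSolution.M_nonneg (S : IsRegularSolution L T α σ M K f u₀ u) : 0 ≤ M :=
  nonneg_of_timeDeriv_bound S.T_pos S.u_reg

theorem IsRegularSolution.K_nonneg (S : IsRegularSolution L T α σ M K f u₀ u) : 0 ≤ K :=
  (S.bounds 0 ⟨le_rfl, S.T_pos.le⟩).nonneg

theorem IsRegularSolution.continuousOn_time (S : IsRegularSolution L T α σ M K f u₀ u) {x : ℝ}
    (hx : x ∈ Icc 0 L) : ContinuousOn (fun s => u x s) (Icc 0 T) := by
  have h : ContinuousOn (fun s : ℝ => ((x, s) : ℝ × ℝ)) (Icc 0 T) := by fun_prop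
  exact S.sol.continuous.comp h fun s hs => ⟨hx, hs⟩

theorem IsRegularSolution.continuousOn_convec (S : IsRegularSolution L T α σ M K f u₀ u)
    {j : ℕ} (hj : j ∈ Finset.Ico 1 J) :
    ContinuousOn (fun s => convec (hStep L J) (fun i => u (node L J i) s) j) (Icc 0 T) := by
  obtain ⟨h1, h2⟩ := Finset.mem_Ico.1 hj
  have hJ : 1 ≤ J := h1.trans h2.le
  have c0 := S.continuousOn_time (node_mem_Icc S.L_pos hJ (j := j - 1) (by omega))
  have c1 := S.continuousOn_time (node_mem_Icc S.L_pos hJ h2.le)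
  have c2 := S.continuousOn_time (node_mem_Icc S.L_pos hJ (j := j + 1) h2)
  unfold convec localMean centralDiff
  exact (((c0.add c1).add c2).div_const _).mul ((c2.sub c0).div_const _)

theorem IsRegularSolution.continuousOn_uxx (S : IsRegularSolution L T α σ M K f u₀ u) {j : ℕ}
    (hj : j ∈ Finset.Ico 1 J) :
    ContinuousOn (fun ζ => spaceDeriv L 2 u (node L J j) ζ) (Ioc 0 T) :=
  ((S.u_diff _ (node_mem_Ioo S.L_pos hj)).1).continuousOn

theorem IsRegularSolution.abs_uxx_le (S : IsRegularSolution L T α σ M K f u₀ u) {j : ℕ}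
    (hj : j ∈ Finset.Ico 1 J) {ζ : ℝ} (hζ : ζ ∈ Icc 0 T) :
    |spaceDeriv L 2 u (node L J j) ζ| ≤ K :=
  (S.bounds ζ hζ).two _ (Ioo_subset_Icc_self (node_mem_Ioo S.L_pos hj))

theorem IsGradedMesh.mem_Icc (H : IsGradedMesh T γ cγ Cγ k N t) {n : ℕ} (hn : n ≤ N) :
    t n ∈ Icc 0 T :=
  ⟨by rw [← H.zero]; exact mesh_mono H.increasing (Nat.zero_le _) hn, H.le_T hn⟩

/-- Deviation of `u_xx` from its stage values. -/
theorem IsRegularSolution.gridNorm_uxx_sub_stage_le (S : IsRegularSolution L T α σ M K f u₀ u)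
    (H : IsGradedMesh T γ cγ Cγ k N t) (hJ : 1 ≤ J) {n : ℕ} (h1 : 1 ≤ n) (hn : n ≤ N) {ζ : ℝ}
    (hζ : ζ ∈ Icc (t (n - 1)) (t n)) (hζ0 : 0 < ζ) :
    gridNorm L J (fun j => spaceDeriv L 2 u (node L J j) ζ
        - stage (fun m => spaceDeriv L 2 u (node L J j) (t m)) n)
      ≤ (2 * √L * K + M) * meshDev σ t n := by
  have hM := S.M_nonneg
  have hK := S.K_nonneg
  have hd := H.meshDev_nonneg (σ := σ) h1 hn
  by_cases h : n = 1
  · subst h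
    have h2 : gridNorm L J (fun j => spaceDeriv L 2 u (node L J j) ζ
        - stage (fun m => spaceDeriv L 2 u (node L J j) (t m)) 1) ≤ √L * (2 * K) := by
      refine gridNorm_le_of_abs_le S.L_pos hJ (by positivity) fun j hj => ?_
      have a1 := S.abs_uxx_le hj (ζ := ζ) ⟨hζ0.le, hζ.2.trans (H.le_T hn)⟩
      have a2 := S.abs_uxx_le hj (H.mem_Icc hn)
      simp only [stage, if_true]
      exact (abs_sub _ _).trans (by linarith)
    have h3 : 1 ≤ meshDev σ t 1 := by
      have := Real.rpow_nonneg (H.pos le_rfl hn).le (σ - 1)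
      simp only [meshDev, if_true]; linarith
    have h4 : 0 ≤ 2 * √L * K + M := by positivity
    nlinarith
  · have p0 := H.pos (n := n - 1) (by omega) (by omega)
    have hle := (H.increasing n h1 hn).le
    have g1 := gridNorm_time_sub_le S.L_pos S.T_pos S.σ_le S.u_diff S.u_reg hJ p0 (H.le_T hn) hζ
      (right_mem_Icc.2 hle)
    have g2 := gridNorm_time_sub_le S.L_pos S.T_pos S.σ_le S.u_diff S.u_reg hJ p0 (H.le_T hn) hζ
      (left_mem_Icc.2 hle)
    have e : (fun j => spaceDeriv L 2 u (node L J j) ζ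
        - stage (fun m => spaceDeriv L 2 u (node L J j) (t m)) n)
        = fun j => (1 / 2 : ℝ) * ((spaceDeriv L 2 u (node L J j) ζ
            - spaceDeriv L 2 u (node L J j) (t n))
          + (spaceDeriv L 2 u (node L J j) ζ - spaceDeriv L 2 u (node L J j) (t (n - 1)))) := by
      funext j; simp only [stage, h, if_false, tMean]; ring
    rw [e, gridNorm_smul (1 / 2 : ℝ) (fun j => (spaceDeriv L 2 u (node L J j) ζ
            - spaceDeriv L 2 u (node L J j) (t n))
          + (spaceDeriv L 2 u (node L J j) ζ - spaceDeriv L 2 u (node L J j) (t (n - 1)))),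
      abs_of_pos (by norm_num : (0 : ℝ) < 1 / 2)]
    have g3 := gridNorm_add_le S.L_pos hJ
      (fun j => spaceDeriv L 2 u (node L J j) ζ - spaceDeriv L 2 u (node L J j) (t n))
      (fun j => spaceDeriv L 2 u (node L J j) ζ - spaceDeriv L 2 u (node L J j) (t (n - 1)))
    have e2 : meshDev σ t n = (t n - t (n - 1)) * t (n - 1) ^ (σ - 2) := by
      rw [meshDev, if_neg h, tStep]
    rw [← e2] at g1 g2
    have : 0 ≤ 2 * √L * K * meshDev σ t n := by positivity
    linarith

theorem IsRegularSolution.abs_secondDiff_stage_sub_le (S : IsRegularSolution L T α σ M K f u₀ u)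
    (H : IsGradedMesh T γ cγ Cγ k N t) {n : ℕ} (hn : n ≤ N) {j : ℕ} (hj : j ∈ Finset.Ico 1 J) :
    |secondDiff (hStep L J) (stageGrid (exactGrid L J t u) n) j
      - stage (fun m => spaceDeriv L 2 u (node L J j) (t m)) n| ≤ 2 * K * hStep L J := by
  rw [secondDiff_stageGrid, ← stage_sub]
  exact abs_stage_le ((S.bounds _ (H.mem_Icc hn)).abs_secondDiff_sub_le S.L_pos hj)
    ((S.bounds _ (H.mem_Icc (by omega))).abs_secondDiff_sub_le S.L_pos hj)

theorem IsRegularSolution.stageGrid_boundary (S : IsRegularSolution L T α σ M K f u₀ u)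
    (H : IsGradedMesh T γ cγ Cγ k N t) (hJ : 1 ≤ J) {n : ℕ} (h1 : 1 ≤ n) (hn : n ≤ N) :
    stageGrid (exactGrid L J t u) n 0 = 0 ∧ stageGrid (exactGrid L J t u) n J = 0 := by
  have h : ∀ m, 1 ≤ m → m ≤ N → u 0 (t m) = 0 ∧ u L (t m) = 0 := fun m hm hm' =>
    S.sol.boundary _ ⟨H.pos hm hm', H.le_T hm'⟩
  simp only [stageGrid, stage, tMean, exactGrid, node_zero, node_last hJ]
  split_ifs with hc
  · exact h 1 le_rfl (by omega)
  · have a1 := h n h1 hn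
    have a2 := h (n - 1) (by omega) (by omega)
    rw [a1.1, a1.2, a2.1, a2.2]; simp

/-- Deviation of the convective term from its stage values. -/
theorem IsRegularSolution.gridNorm_convec_sub_stage_le (S : IsRegularSolution L T α σ M K f u₀ u)
    (H : IsGradedMesh T γ cγ Cγ k N t) (hJ : 1 ≤ J) {n : ℕ} (h1 : 1 ≤ n) (hn : n ≤ N) {ζ : ℝ}
    (hζ : ζ ∈ Icc (t (n - 1)) (t n)) (hζ0 : 0 < ζ) :
    gridNorm L J (fun j => convec (hStep L J) (fun i => u (node L J i) ζ) j
        - convec (hStep L J) (stageGrid (exactGrid L J t u) n) j)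
      ≤ (K * L + K) * L * ((2 * √L * K + M) * meshDev σ t n + 4 * √L * K * hStep L J) := by
  have hM := S.M_nonneg
  have hK := S.K_nonneg
  have hL := S.L_pos
  have hh := hStep_pos hL hJ
  have hζT : ζ ∈ Icc 0 T := ⟨hζ0.le, hζ.2.trans (H.le_T hn)⟩
  obtain ⟨b0, bJ⟩ := S.stageGrid_boundary H hJ h1 hn
  have hb := S.sol.boundary ζ ⟨hζ0, hζT.2⟩
  -- The deviation of convection is controlled by that of the second difference, which is u_xx up to
  -- O(h) at both the time ζ and the stage. Only the time regularity of u_xx therefore enters.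
  refine (gridNorm_convec_sub_le hL hJ hK hK (a := fun i => u (node L J i) ζ)
    (b := stageGrid (exactGrid L J t u) n) (by rw [b0, node_zero]; exact hb.1)
    (by rw [bJ, node_last hJ]; exact hb.2)
    (fun j hj => (S.bounds ζ hζT).abs_centralDiff_le hL hj) (fun j hj => ?_)).trans ?_
  · rw [localMean_stageGrid]
    exact abs_stage_le ((S.bounds _ (H.mem_Icc hn)).abs_localMean_le hL hj)
      ((S.bounds _ (H.mem_Icc (by omega))).abs_localMean_le hL hj)
  · refine mul_le_mul_of_nonneg_left ?_ (by positivity)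
    have e : ∀ j, secondDiff (hStep L J)
        (fun j => u (node L J j) ζ - stageGrid (exactGrid L J t u) n j) j
        = (spaceDeriv L 2 u (node L J j) ζ
            - stage (fun m => spaceDeriv L 2 u (node L J j) (t m)) n)
          + ((secondDiff (hStep L J) (fun i => u (node L J i) ζ) j
              - spaceDeriv L 2 u (node L J j) ζ)
            - (secondDiff (hStep L J) (stageGrid (exactGrid L J t u) n) j
              - stage (fun m => spaceDeriv L 2 u (node L J j) (t m)) n)) := fun j => by
      rw [secondDiff_sub]; ring
    rw [gridNorm_congr fun j _ => e j]
    refine (gridNorm_add_le hL hJ _ _).trans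
      (add_le_add (S.gridNorm_uxx_sub_stage_le H hJ h1 hn hζ hζ0) ?_)
    refine (gridNorm_le_of_abs_le hL hJ (b := 4 * K * hStep L J) (by positivity)
      fun j hj => ?_).trans (le_of_eq (by ring))
    have a1 := (S.bounds ζ hζT).abs_secondDiff_sub_le hL hj
    have a2 := S.abs_secondDiff_stage_sub_le H hn hj
    exact (abs_sub _ _).trans (by linarith)

theorem intervalIntegrable_mono_mesh (H : IsGradedMesh T γ cγ Cγ k N t) {g : ℝ → ℝ}
    (hg : IntervalIntegrable g MeasureTheory.volume 0 T) {n : ℕ} (h1 : 1 ≤ n) (hn : n ≤ N) :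
    IntervalIntegrable g MeasureTheory.volume (t (n - 1)) (t n) := by
  have h2 := H.mem_Icc (n := n - 1) (by omega)
  have h3 := H.mem_Icc hn
  refine hg.mono_set ?_
  rw [uIcc_of_le (H.increasing n h1 hn).le, uIcc_of_le (h2.1.trans h2.2)]
  exact Icc_subset_Icc h2.1 h3.2

/-- The convective part of the residual. -/
theorem IsRegularSolution.gridNorm_convec_residual_le
    (S : IsRegularSolution L T α σ M K f u₀ u)
    (H : IsGradedMesh T γ cγ Cγ k N t) (hJ : 1 ≤ J) {n : ℕ} (h1 : 1 ≤ n) (hn : n ≤ N) :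
    gridNorm L J (fun j => tStep t n * convec (hStep L J) (stageGrid (exactGrid L J t u) n) j
        - ∫ τ in (t (n - 1))..(t n), convec (hStep L J) (fun i => u (node L J i) τ) j)
      ≤ (K * L + K) * L * ((2 * √L * K + M) * meshDev σ t n + 4 * √L * K * hStep L J)
        * tStep t n := by
  have hL := S.L_pos
  have hM := S.M_nonneg
  have hK := S.K_nonneg
  have hh := hStep_pos hL hJ
  have hk := H.tStep_pos h1 hn
  have hlt := H.increasing n h1 hn
  have hd := H.meshDev_nonneg (σ := σ) h1 hn
  set B := (K * L + K) * L * ((2 * √L * K + M) * meshDev σ t n + 4 * √L * K * hStep L J) with hB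
  have hB0 : 0 ≤ B := by positivity
  refine gridNorm_le_of_inner hL hJ (by positivity) fun w => ?_
  set a := stageGrid (exactGrid L J t u) n with ha
  have hci : ∀ j ∈ Finset.Ico 1 J, IntervalIntegrable
      (fun τ => convec (hStep L J) (fun i => u (node L J i) τ) j) MeasureTheory.volume
      (t (n - 1)) (t n) := fun j hj => by
    refine intervalIntegrable_mono_mesh H ?_ h1 hn
    exact ContinuousOn.intervalIntegrable (by
      rw [uIcc_of_le S.T_pos.le]; exact S.continuousOn_convec hj)
  have e : gridInner L J (fun j => tStep t n * convec (hStep L J) a j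
        - ∫ τ in (t (n - 1))..(t n), convec (hStep L J) (fun i => u (node L J i) τ) j) w
      = -∫ τ in (t (n - 1))..(t n), gridInner L J
        (fun j => convec (hStep L J) (fun i => u (node L J i) τ) j - convec (hStep L J) a j) w := by
    simp only [gridInner]
    rw [intervalIntegral.integral_const_mul, intervalIntegral.integral_finsetSum fun j hj =>
      (((hci j hj).sub intervalIntegrable_const).mul_const _), ← mul_neg, ← Finset.sum_neg_distrib]
    congr 1
    refine Finset.sum_congr rfl fun j hj => ?_
    rw [intervalIntegral.integral_mul_const, intervalIntegral.integral_sub (hci j hj)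
      intervalIntegrable_const, intervalIntegral.integral_const, smul_eq_mul, tStep]
    ring
  rw [e]
  refine (neg_le_abs _).trans ?_
  rw [← Real.norm_eq_abs]
  refine (intervalIntegral.norm_integral_le_of_norm_le_const (C := B * gridNorm L J w)
    fun τ hτ => ?_).trans (le_of_eq ?_)
  · rw [uIoc_of_le hlt.le] at hτ
    have hτ0 : 0 < τ := (H.mem_Icc (n := n - 1) (by omega)).1.trans_lt hτ.1
    exact (abs_gridInner_le hL hJ _ _).trans (mul_le_mul_of_nonneg_right
      (S.gridNorm_convec_sub_stage_le H hJ h1 hn ⟨hτ.1.le, hτ.2⟩ hτ0) (gridNorm_nonneg ..))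
  · rw [abs_of_pos (sub_pos.2 hlt), tStep]; ring

/-- The memory part of the residual. -/
theorem IsRegularSolution.gridNorm_memory_residual_le
    (S : IsRegularSolution L T α σ M K f u₀ u)
    (H : IsGradedMesh T γ cγ Cγ k N t) (hJ : 1 ≤ J) {n : ℕ} (h1 : 1 ≤ n) (hn : n ≤ N) :
    gridNorm L J (fun j => (∫ τ in (t (n - 1))..(t n),
          fracIntegral α (fun ζ => spaceDeriv L 2 u (node L J j) ζ) τ)
        - ∑ s ∈ Finset.Icc 1 n, kernelMass α t n s
          * stage (fun m => spaceDeriv L 2 u (node L J j) (t m)) s)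
      ≤ (2 * √L * K + M) * ∑ s ∈ Finset.Icc 1 n, kernelMass α t n s * meshDev σ t s := by
  have hL := S.L_pos
  have hM := S.M_nonneg
  have hK := S.K_nonneg
  have hlt := H.increasing n h1 hn
  have hsum0 : 0 ≤ ∑ s ∈ Finset.Icc 1 n, kernelMass α t n s * meshDev σ t s :=
    Finset.sum_nonneg fun s hs => by
      obtain ⟨a1, a2⟩ := Finset.mem_Icc.1 hs
      exact mul_nonneg (kernelMass_nonneg S.α_pos H.increasing a1 a2 hn)
        (H.meshDev_nonneg a1 (a2.trans hn))
  refine gridNorm_le_of_inner hL hJ (by positivity) fun w => ?_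
  set φ : ℕ → ℝ → ℝ := fun j ζ => spaceDeriv L 2 u (node L J j) ζ with hφ
  -- Pairing with w before applying the quadrature estimate keeps the deviation bound in the
  -- discrete norm; bounding it node by node would cost a factor h^(-1/2).
  set Φ : ℝ → ℝ := fun ζ => gridInner L J (fun j => φ j ζ) w with hΦ
  have hΦc : ContinuousOn Φ (Ioc 0 T) := by
    refine ContinuousOn.mul continuousOn_const (continuousOn_finsetSum _ fun j hj => ?_)
    exact (S.continuousOn_uxx hj).mul continuousOn_const
  have hΦb : ∀ ζ ∈ Ioc 0 T, |Φ ζ| ≤ √L * K * gridNorm L J w := fun ζ hζ =>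
    (abs_gridInner_le hL hJ _ _).trans (mul_le_mul_of_nonneg_right
      (gridNorm_le_of_abs_le hL hJ hK fun j hj => S.abs_uxx_le hj (Ioc_subset_Icc_self hζ))
      (gridNorm_nonneg ..))
  have hfi : ∀ j ∈ Finset.Ico 1 J, IntervalIntegrable (fracIntegral α (φ j))
      MeasureTheory.volume (t (n - 1)) (t n) := fun j hj =>
    intervalIntegrable_mono_mesh H (intervalIntegrable_fracIntegral S.α_pos S.T_pos
      (S.continuousOn_uxx hj) fun ζ hζ => S.abs_uxx_le hj (Ioc_subset_Icc_self hζ)) h1 hn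
  have hlin : ∀ τ ∈ Icc 0 T, fracIntegral α Φ τ
      = gridInner L J (fun j => fracIntegral α (φ j) τ) w := by
    intro τ hτ
    have e1 : ∀ ζ, abelKernel α (τ - ζ) * Φ ζ
        = hStep L J * ∑ j ∈ Finset.Ico 1 J, abelKernel α (τ - ζ) * φ j ζ * w j := fun ζ => by
      simp only [hΦ, gridInner, Finset.mul_sum]
      exact Finset.sum_congr rfl fun j _ => by ring
    simp only [fracIntegral, gridInner, e1]
    rw [intervalIntegral.integral_const_mul, intervalIntegral.integral_finsetSum fun j hj =>
      (intervalIntegrable_abelKernel_mul S.α_pos (S.continuousOn_uxx hj)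
        (fun ζ hζ => S.abs_uxx_le hj (Ioc_subset_Icc_self hζ)) le_rfl hτ.1 hτ.2).mul_const _]
    simp only [intervalIntegral.integral_mul_const]
    rfl
  have hint : ∫ τ in (t (n - 1))..(t n), fracIntegral α Φ τ
      = gridInner L J (fun j => ∫ τ in (t (n - 1))..(t n), fracIntegral α (φ j) τ) w := by
    rw [intervalIntegral.integral_congr (g := fun τ =>
      gridInner L J (fun j => fracIntegral α (φ j) τ) w) fun τ hτ => by
        rw [uIcc_of_le hlt.le] at hτ
        exact hlin τ ⟨(H.mem_Icc (n := n - 1) (by omega)).1.trans hτ.1, hτ.2.trans (H.le_T hn)⟩]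
    simp only [gridInner]
    rw [intervalIntegral.integral_const_mul, intervalIntegral.integral_finsetSum fun j hj =>
      (hfi j hj).mul_const _]
    simp only [intervalIntegral.integral_mul_const]
  have hq := abs_integral_fracIntegral_sub_le S.α_pos S.T_pos hΦc hΦb H.increasing H.zero
    H.le_final (c := fun s => gridInner L J (fun j => stage (fun m => φ j (t m)) s) w)
    (d := fun s => (2 * √L * K + M) * meshDev σ t s * gridNorm L J w) h1 hn fun s hs ζ hζ => by
      obtain ⟨a1, a2⟩ := Finset.mem_Icc.1 hs
      have hζ0 : 0 < ζ := (H.mem_Icc (n := s - 1) (by omega)).1.trans_lt hζ.1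
      simp only [hΦ]
      rw [← gridInner_sub_left]
      exact (abs_gridInner_le hL hJ _ _).trans (mul_le_mul_of_nonneg_right
        (S.gridNorm_uxx_sub_stage_le H hJ a1 (a2.trans hn) ⟨hζ.1.le, hζ.2⟩ hζ0)
        (gridNorm_nonneg ..))
  rw [hint] at hq
  rw [gridInner_sub_left, gridInner_sum_left (Finset.Icc 1 n)
    (fun s j => kernelMass α t n s * stage (fun m => φ j (t m)) s)]
  simp only [gridInner_smul_left]
  refine ((le_abs_self _).trans hq).trans (le_of_eq ?_)
  rw [Finset.mul_sum, Finset.sum_mul]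
  exact Finset.sum_congr rfl fun s _ => by ring

/-- The source part of the residual. -/
theorem IsRegularSolution.gridNorm_source_residual_le
    (S : IsRegularSolution L T α σ M K f u₀ u)
    (H : IsGradedMesh T γ cγ Cγ k N t) (hJ : 1 ≤ J) (HF : IsSourceApprox L T Cf f J N t F)
    {n : ℕ} (h1 : 1 ≤ n) (hn : n ≤ N) :
    gridNorm L J (fun j => F n j * tStep t n - ∫ s in (t (n - 1))..(t n), f (node L J j) s)
      ≤ |Cf| * M * (1 / σ + Cγ) * (tStep t n * meshDev σ t n) := by
  have hM := S.M_nonneg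
  have hσ := S.σ_pos
  have hC := H.const_pos (h1.trans hn)
  have hk := H.tStep_pos h1 hn
  have hlt := H.increasing n h1 hn
  have hd := H.meshDev_nonneg (σ := σ) h1 hn
  by_cases h : n = 1
  · subst h
    have p1 := H.pos le_rfl hn
    have hI : |∫ s in (t 0)..(t 1), s * nodalNorm L J (fun x => timeDeriv T 1 f x s)|
        ≤ M * (t 1 ^ σ / σ) := by
      have e : ∫ s in (0 : ℝ)..(t 1), M * s ^ (σ - 1) = M * (t 1 ^ σ / σ) := by
        rw [intervalIntegral.integral_const_mul, integral_rpow (Or.inl (by linarith))]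
        simp [Real.zero_rpow hσ.ne']
      rw [H.zero, ← e, ← Real.norm_eq_abs]
      refine intervalIntegral.norm_integral_le_of_norm_le p1.le ?_
        ((intervalIntegral.intervalIntegrable_rpow' (by linarith)).const_mul _)
      filter_upwards with s hs
      have h2 := S.f_reg J hJ s ⟨hs.1, hs.2.trans (H.le_T hn)⟩
      have n1 : 0 ≤ nodalNorm L J (fun x => timeDeriv T 1 f x s) := gridNorm_nonneg ..
      have n2 : 0 ≤ nodalNorm L J (fun x => timeDeriv T 2 f x s) := gridNorm_nonneg ..
      rw [Real.norm_of_nonneg (mul_nonneg hs.1.le n1)]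
      have : 0 ≤ s ^ 2 * nodalNorm L J (fun x => timeDeriv T 2 f x s) := by positivity
      linarith
    have e1 : tStep t 1 = t 1 := by simp [tStep, H.zero]
    -- This is where the summand t_1^(σ-1) of the first deviation is needed: the source residual on
    -- the first interval is of size t_1^σ.
    have e2 : t 1 ^ σ ≤ tStep t 1 * meshDev σ t 1 := by
      rw [e1, meshDev, if_pos rfl, mul_add, mul_comm (t 1) (t 1 ^ _), ← Real.rpow_add_one p1.ne',
        sub_add_cancel]
      linarith
    calc _ ≤ _ := HF.first
      _ ≤ |Cf| * |∫ s in (t 0)..(t 1), s * nodalNorm L J (fun x => timeDeriv T 1 f x s)| := by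
          rw [← abs_mul]; exact le_abs_self _
      _ ≤ |Cf| * (M * (t 1 ^ σ / σ)) := by gcongr
      _ = |Cf| * M * (1 / σ) * t 1 ^ σ := by ring
      _ ≤ |Cf| * M * (1 / σ + Cγ) * (tStep t 1 * meshDev σ t 1) := by
          gcongr
          linarith
  · have p0 := H.pos (n := n - 1) (by omega) (by omega)
    have hI : |∫ s in (t (n - 1))..(t n), nodalNorm L J (fun x => timeDeriv T 2 f x s)|
        ≤ M * t (n - 1) ^ (σ - 3) * tStep t n := by
      rw [← Real.norm_eq_abs, tStep]
      refine (intervalIntegral.norm_integral_le_of_norm_le_const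
        (C := M * t (n - 1) ^ (σ - 3)) fun s hs => ?_).trans
        (le_of_eq (by rw [abs_of_pos (sub_pos.2 hlt)]))
      rw [uIoc_of_le hlt.le] at hs
      have n2 : 0 ≤ nodalNorm L J (fun x => timeDeriv T 2 f x s) := gridNorm_nonneg ..
      rw [Real.norm_of_nonneg n2]
      refine (nodalNorm_timeDeriv_le S.f_reg hJ ⟨p0.trans hs.1, hs.2.trans (H.le_T hn)⟩).2.trans ?_
      have h3 : s ^ (σ - 3) ≤ t (n - 1) ^ (σ - 3) :=
        Real.rpow_le_rpow_of_nonpos p0 hs.1.le (by linarith [S.σ_le])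
      gcongr
    have e1 : t (n - 1) ^ (σ - 2) = t (n - 1) ^ (σ - 3) * t (n - 1) := by
      rw [← Real.rpow_add_one p0.ne']; congr 1; ring
    -- One of the three factors k_n is traded for t_{n-1}, so that k_n³ t_{n-1}^(σ-3) becomes a
    -- multiple of k_n² t_{n-1}^(σ-2).
    have h4 : tStep t n ≤ Cγ * t (n - 1) := by
      have := H.ratio_le n (by omega) hn
      unfold tStep; linarith
    have h5 := Real.rpow_nonneg p0.le (σ - 3)
    calc _ ≤ _ := HF.later n (by omega) hn
      _ ≤ |Cf| * tStep t n ^ 2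
          * |∫ s in (t (n - 1))..(t n), nodalNorm L J (fun x => timeDeriv T 2 f x s)| := by
          refine (le_abs_self _).trans (le_of_eq ?_)
          rw [abs_mul, abs_mul, abs_of_nonneg (sq_nonneg (tStep t n))]
      _ ≤ |Cf| * tStep t n ^ 2 * (M * t (n - 1) ^ (σ - 3) * tStep t n) := by gcongr
      _ ≤ |Cf| * tStep t n ^ 2 * (M * t (n - 1) ^ (σ - 3) * (Cγ * t (n - 1))) := by gcongr
      _ = |Cf| * M * Cγ * (tStep t n * meshDev σ t n) := by
          rw [meshDev, if_neg h, e1]; ring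
      _ ≤ _ := by
          gcongr
          have : 0 < 1 / σ := by positivity
          linarith

/-- Integration of the equation over a mesh interval. -/
theorem IsRegularSolution.abs_integrated_equation_le (S : IsRegularSolution L T α σ M K f u₀ u)
    (H : IsGradedMesh T γ cγ Cγ k N t) {n : ℕ} (h1 : 1 ≤ n) (hn : n ≤ N)
    {j : ℕ} (hj : j ∈ Finset.Ico 1 J) :
    |exactGrid L J t u n j - exactGrid L J t u (n - 1) j
      - (∫ τ in (t (n - 1))..(t n), f (node L J j) τ)
      - (∫ τ in (t (n - 1))..(t n), fracIntegral α (fun ζ => spaceDeriv L 2 u (node L J j) ζ) τ)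
      + ∫ τ in (t (n - 1))..(t n), convec (hStep L J) (fun i => u (node L J i) τ) j|
      ≤ 2 * K ^ 2 * hStep L J * tStep t n := by
  have hL := S.L_pos
  have hlt := H.increasing n h1 hn
  have hp0 := (H.mem_Icc (n := n - 1) (by omega)).1
  have hqT := H.le_T hn
  have hx := node_mem_Ioo hL hj
  set x := node L J j with hxdef
  set p := t (n - 1) with hp
  set q := t n with hq
  have fi : IntervalIntegrable (fun s => f x s) MeasureTheory.volume p q :=
    intervalIntegrable_mono_mesh H
      (intervalIntegrable_node hL S.T_pos S.σ_pos S.f_diff S.f_reg hj) h1 hn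
  have gi : IntervalIntegrable (fracIntegral α fun ζ => spaceDeriv L 2 u x ζ)
      MeasureTheory.volume p q :=
    intervalIntegrable_mono_mesh H (intervalIntegrable_fracIntegral S.α_pos S.T_pos
      (S.continuousOn_uxx hj) fun ζ hζ => S.abs_uxx_le hj (Ioc_subset_Icc_self hζ)) h1 hn
  have ci : IntervalIntegrable (fun τ => convec (hStep L J) (fun i => u (node L J i) τ) j)
      MeasureTheory.volume p q :=
    intervalIntegrable_mono_mesh H (ContinuousOn.intervalIntegrable (by
      rw [uIcc_of_le S.T_pos.le]; exact S.continuousOn_convec hj)) h1 hn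
  have hderiv : ∀ τ ∈ Ioo p q, HasDerivAt (fun s => u x s) (deriv (fun s => u x s) τ) τ ∧
      deriv (fun s => u x s) τ = f x τ - u x τ * spaceDeriv L 1 u x τ
        + fracIntegral α (fun ζ => spaceDeriv L 2 u x ζ) τ := by
    intro τ hτ
    have hτ0 : 0 < τ := hp0.trans_lt hτ.1
    have hτT : τ < T := hτ.2.trans_le hqT
    have h2 : HasDerivAt (fun s => u x s) (timeDeriv T 1 u x τ) τ := by
      rw [timeDeriv_one]
      exact ((S.sol.time_diff x hx τ ⟨hτ0, hτT.le⟩).hasDerivWithinAt).hasDerivAt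
        (Filter.mem_of_superset (Ioo_mem_nhds hτ0 hτT) Ioo_subset_Ioc_self)
    rw [h2.deriv]
    refine ⟨h2, ?_⟩
    have := S.sol.equation x hx τ ⟨hτ0, hτT.le⟩
    linarith
  have hbd : ∀ τ ∈ Ioo p q, |deriv (fun s => u x s) τ - f x τ
      - fracIntegral α (fun ζ => spaceDeriv L 2 u x ζ) τ
      + convec (hStep L J) (fun i => u (node L J i) τ) j| ≤ 2 * K ^ 2 * hStep L J := by
    intro τ hτ
    have h3 := (S.bounds τ ⟨hp0.trans hτ.1.le, hτ.2.le.trans hqT⟩).abs_convec_sub_le hL hj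
    rw [(hderiv τ hτ).2]
    refine (le_of_eq ?_).trans h3
    congr 1
    ring
  -- If q = T, the hypotheses give only a one-sided time derivative at q. The right end is therefore
  -- left out as a null set.
  have hne : ∀ᵐ τ : ℝ, τ ≠ q := by
    have := MeasureTheory.compl_mem_ae_iff.2
      (MeasureTheory.measure_singleton (μ := (MeasureTheory.volume : MeasureTheory.Measure ℝ)) q)
    exact this
  -- Integrability of u_t follows from the equation: up to a bounded error it is a combination of
  -- the source, the memory term and discrete convection. Since u is continuous up to t = 0, the
  -- fundamental theorem also covers the first interval.
  have ui : IntervalIntegrable (deriv fun s => u x s) MeasureTheory.volume p q := by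
    have hb : IntervalIntegrable (fun τ => (|f x τ| + |fracIntegral α
        (fun ζ => spaceDeriv L 2 u x ζ) τ|
        + |convec (hStep L J) (fun i => u (node L J i) τ) j|) + 2 * K ^ 2 * hStep L J)
        MeasureTheory.volume p q :=
      ((fi.abs.add gi.abs).add ci.abs).add intervalIntegrable_const
    rw [intervalIntegrable_iff_integrableOn_Ioc_of_le hlt.le] at hb ⊢
    refine hb.mono' (measurable_deriv _).aestronglyMeasurable ?_
    filter_upwards [MeasureTheory.ae_restrict_mem measurableSet_Ioc,
      MeasureTheory.ae_restrict_of_ae hne] with τ hτ hτq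
    have h4 := abs_le.1 (hbd τ ⟨hτ.1, lt_of_le_of_ne hτ.2 hτq⟩)
    rw [Real.norm_eq_abs, abs_le]
    constructor <;> linarith [neg_abs_le (f x τ), le_abs_self (f x τ),
      neg_abs_le (fracIntegral α (fun ζ => spaceDeriv L 2 u x ζ) τ),
      le_abs_self (fracIntegral α (fun ζ => spaceDeriv L 2 u x ζ) τ),
      neg_abs_le (convec (hStep L J) (fun i => u (node L J i) τ) j),
      le_abs_self (convec (hStep L J) (fun i => u (node L J i) τ) j)]
  have hftc := intervalIntegral.integral_eq_sub_of_hasDerivAt_of_le hlt.le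
    ((S.continuousOn_time (Ioo_subset_Icc_self hx)).mono (Icc_subset_Icc hp0 hqT))
    (fun τ hτ => (hderiv τ hτ).1) ui
  have e : exactGrid L J t u n j - exactGrid L J t u (n - 1) j
      = ∫ τ in p..q, deriv (fun s => u x s) τ := hftc.symm
  rw [e, ← intervalIntegral.integral_sub ui fi, ← intervalIntegral.integral_sub (ui.sub fi) gi,
    ← intervalIntegral.integral_add ((ui.sub fi).sub gi) ci, ← Real.norm_eq_abs]
  refine (intervalIntegral.norm_integral_le_of_norm_le_const_ae
    (C := 2 * K ^ 2 * hStep L J) ?_).trans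
    (le_of_eq (by rw [abs_of_pos (sub_pos.2 hlt), tStep]))
  filter_upwards [hne] with τ hτq hτ
  rw [uIoc_of_le hlt.le] at hτ
  exact hbd τ ⟨hτ.1, lt_of_le_of_ne hτ.2 hτq⟩

/-- Inserting the integrals of source, memory and convection over the mesh interval splits the
residual into five parts: source approximation A, quadrature of memory B, stage error of convection
C, space error of convection D and space error of the second difference E. -/
theorem IsRegularSolution.gridNorm_residual_le (S : IsRegularSolution L T α σ M K f u₀ u)
    (H : IsGradedMesh T γ cγ Cγ k N t) (hJ : 1 ≤ J) (HF : IsSourceApprox L T Cf f J N t F)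
    {n : ℕ} (h1 : 1 ≤ n) (hn : n ≤ N) :
    gridNorm L J (residual L α J t u F n)
      ≤ |Cf| * M * (1 / σ + Cγ) * (tStep t n * meshDev σ t n)
        + (2 * √L * K + M) * ∑ s ∈ Finset.Icc 1 n, kernelMass α t n s * meshDev σ t s
        + (K * L + K) * L * ((2 * √L * K + M) * meshDev σ t n + 4 * √L * K * hStep L J)
          * tStep t n
        + √L * (2 * K ^ 2 * hStep L J * tStep t n)
        + √L * (2 * K * hStep L J * (abelPrim α T * tStep t n)) := by
  have hL := S.L_pos
  have hK := S.K_nonneg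
  have hh := hStep_pos hL hJ
  have hk := H.tStep_pos h1 hn
  set φ : ℕ → ℝ → ℝ := fun j ζ => spaceDeriv L 2 u (node L J j) ζ with hφ
  set a := exactGrid L J t u with ha
  set A : ℕ → ℝ := fun j => F n j * tStep t n - ∫ s in (t (n - 1))..(t n), f (node L J j) s
  set B : ℕ → ℝ := fun j => (∫ τ in (t (n - 1))..(t n), fracIntegral α (φ j) τ)
    - ∑ s ∈ Finset.Icc 1 n, kernelMass α t n s * stage (fun m => φ j (t m)) s
  set C : ℕ → ℝ := fun j => tStep t n * convec (hStep L J) (stageGrid a n) j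
    - ∫ τ in (t (n - 1))..(t n), convec (hStep L J) (fun i => u (node L J i) τ) j
  set D : ℕ → ℝ := fun j => a n j - a (n - 1) j
      - (∫ τ in (t (n - 1))..(t n), f (node L J j) τ)
      - (∫ τ in (t (n - 1))..(t n), fracIntegral α (φ j) τ)
      + ∫ τ in (t (n - 1))..(t n), convec (hStep L J) (fun i => u (node L J i) τ) j
  set E : ℕ → ℝ := fun j => ∑ s ∈ Finset.Icc 1 n, kernelMass α t n s
    * (secondDiff (hStep L J) (stageGrid a s) j - stage (fun m => φ j (t m)) s)
  have e : ∀ j, residual L α J t u F n j = (((B j + C j) + D j) - A j) - E j := fun j => by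
    simp only [A, B, C, D, E, residual, mul_sub, Finset.sum_sub_distrib, ← ha]
    ring
  have hA := S.gridNorm_source_residual_le H hJ HF h1 hn
  have hB := S.gridNorm_memory_residual_le H hJ h1 hn
  have hC := S.gridNorm_convec_residual_le H hJ h1 hn
  have hD : gridNorm L J D ≤ √L * (2 * K ^ 2 * hStep L J * tStep t n) :=
    gridNorm_le_of_abs_le hL hJ (by positivity) fun j hj =>
      S.abs_integrated_equation_le H h1 hn hj
  have hE : gridNorm L J E ≤ √L * (2 * K * hStep L J * (abelPrim α T * tStep t n)) := by
    have hP := abelPrim_nonneg S.α_pos T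
    refine gridNorm_le_of_abs_le hL hJ (by positivity) fun j hj => ?_
    calc |E j| ≤ ∑ s ∈ Finset.Icc 1 n, |kernelMass α t n s
            * (secondDiff (hStep L J) (stageGrid a s) j - stage (fun m => φ j (t m)) s)| :=
          Finset.abs_sum_le_sum_abs _ _
      _ ≤ ∑ s ∈ Finset.Icc 1 n, 2 * K * hStep L J * kernelMass α t n s := by
          refine Finset.sum_le_sum fun s hs => ?_
          obtain ⟨a1, a2⟩ := Finset.mem_Icc.1 hs
          have h0 := kernelMass_nonneg S.α_pos H.increasing a1 a2 hn
          rw [abs_mul, abs_of_nonneg h0, mul_comm]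
          exact mul_le_mul_of_nonneg_right
            (S.abs_secondDiff_stage_sub_le H (a2.trans hn) hj) h0
      _ ≤ _ := by
          rw [← Finset.mul_sum]
          gcongr
          exact sum_kernelMass_row_le S.α_pos H.increasing H.zero H.le_final h1 hn
  rw [gridNorm_congr fun j _ => e j]
  have g1 := gridNorm_sub_le hL hJ (fun j => ((B j + C j) + D j) - A j) E
  have g2 := gridNorm_sub_le hL hJ (fun j => (B j + C j) + D j) A
  have g3 := gridNorm_add_le hL hJ (fun j => B j + C j) D
  have g4 := gridNorm_add_le hL hJ B C
  linarith

/-- The constant of the consistency estimate. -/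
theorem IsRegularSolution.exists_sum_residual_le (S : IsRegularSolution L T α σ M K f u₀ u)
    (hγ : γ = 2 / σ) (hC : 0 < Cγ) (Cf : ℝ) :
    ∃ C, 0 ≤ C ∧ ∀ (J N : ℕ) (t : ℕ → ℝ) (F : ℕ → ℕ → ℝ) (k cγ : ℝ), 1 ≤ J → 1 ≤ N → k ≤ 1 →
      IsGradedMesh T γ cγ Cγ k N t → IsSourceApprox L T Cf f J N t F →
      ∑ n ∈ Finset.Icc 1 N, gridNorm L J (residual L α J t u F n) ≤ C * (hStep L J + k) := by
  have hL := S.L_pos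
  have hT := S.T_pos
  have hK := S.K_nonneg
  have hM := S.M_nonneg
  have hσ := S.σ_pos
  have hP := abelPrim_nonneg S.α_pos T
  set P := abelPrim α T with hPdef
  set cE := Cγ + Cγ ^ 2 + Cγ ^ (3 - σ) * (2 / σ) * T ^ (σ / 2) with hcE
  set c1 := |Cf| * M * (1 / σ + Cγ) with hc1
  set c2 := 2 * √L * K + M with hc2
  set c3 := (K * L + K) * L with hc3
  have hcE0 : 0 ≤ cE := by positivity
  have h10 : 0 ≤ c1 := by positivity
  have h20 : 0 ≤ c2 := by positivity
  have h30 : 0 ≤ c3 := by positivity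
  set D1 := c1 + c2 * P + c3 * c2 with hD1
  set D2 := c3 * (4 * √L * K) + √L * (2 * K ^ 2) + √L * (2 * K * P) with hD2
  have hD10 : 0 ≤ D1 := by positivity
  have hD20 : 0 ≤ D2 := by positivity
  refine ⟨D1 * cE + D2 * T, by positivity, ?_⟩
  intro J N t F k cγ hJ hN hk1 H HF
  have hh := hStep_pos hL hJ
  have hk := H.k_pos
  have hE := H.sum_tStep_mul_meshDev_le hσ S.σ_le hγ hk1 hN
  set E := ∑ n ∈ Finset.Icc 1 N, tStep t n * meshDev σ t n with hEdef
  have hsteps : ∑ n ∈ Finset.Icc 1 N, tStep t n ≤ T := by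
    have := sum_Icc_sub t hN
    simp only [Nat.sub_self, H.zero, sub_zero] at this
    exact this.le.trans H.le_final
  have hmem : ∑ n ∈ Finset.Icc 1 N, ∑ s ∈ Finset.Icc 1 n, kernelMass α t n s * meshDev σ t s
      ≤ P * E := by
    -- Summing over n first puts the column bound of the weights to use: the s-th deviation is
    -- counted with total weight at most P k_s.
    rw [Finset.sum_comm' (t' := Finset.Icc 1 N) (s' := fun s => Finset.Icc s N)
      (by intro x y; simp only [Finset.mem_Icc]; omega), hEdef, Finset.mul_sum]
    refine Finset.sum_le_sum fun s hs => ?_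
    obtain ⟨a1, a2⟩ := Finset.mem_Icc.1 hs
    rw [← Finset.sum_mul, ← mul_assoc]
    exact mul_le_mul_of_nonneg_right
      (sum_kernelMass_col_le S.α_pos H.increasing H.zero H.le_final a1 a2 le_rfl)
      (H.meshDev_nonneg a1 a2)
  have hR := Finset.sum_le_sum fun n (hn : n ∈ Finset.Icc 1 N) =>
    S.gridNorm_residual_le H hJ HF (Finset.mem_Icc.1 hn).1 (Finset.mem_Icc.1 hn).2
  refine hR.trans ?_
  have e : ∑ n ∈ Finset.Icc 1 N, (c1 * (tStep t n * meshDev σ t n)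
        + c2 * ∑ s ∈ Finset.Icc 1 n, kernelMass α t n s * meshDev σ t s
        + c3 * (c2 * meshDev σ t n + 4 * √L * K * hStep L J) * tStep t n
        + √L * (2 * K ^ 2 * hStep L J * tStep t n)
        + √L * (2 * K * hStep L J * (P * tStep t n)))
      = (c1 + c3 * c2) * E
        + c2 * ∑ n ∈ Finset.Icc 1 N, ∑ s ∈ Finset.Icc 1 n, kernelMass α t n s * meshDev σ t s
        + D2 * hStep L J * ∑ n ∈ Finset.Icc 1 N, tStep t n := by
    rw [hEdef, Finset.mul_sum, Finset.mul_sum, Finset.mul_sum, ← Finset.sum_add_distrib,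
      ← Finset.sum_add_distrib]
    refine Finset.sum_congr rfl fun n _ => ?_
    rw [hD2]; ring
  rw [e]
  have b1 := mul_le_mul_of_nonneg_left hmem h20
  have b2 := mul_le_mul_of_nonneg_left hsteps (by positivity : 0 ≤ D2 * hStep L J)
  have b3 := mul_le_mul_of_nonneg_left hE hD10
  have b4 : 0 ≤ D1 * cE * hStep L J := by positivity
  have b5 : 0 ≤ D2 * T * k := by positivity
  have b6 : D1 * E = c1 * E + c2 * (P * E) + c3 * c2 * E := by rw [hD1]; ring
  linarith

end

/-! ### Existence and uniqueness -/

section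

variable {L T α σ M K : ℝ} {f : ℝ → ℝ → ℝ} {u₀ : ℝ → ℝ} {u : ℝ → ℝ → ℝ}
  {γ cγ Cγ Cf k : ℝ} {J N : ℕ} {t : ℕ → ℝ} {F : ℕ → ℕ → ℝ}

theorem convec_congr {w w' : ℕ → ℝ} (h : ℝ) (H : ∀ i ≤ J, w i = w' i) {j : ℕ}
    (hj : j ∈ Finset.Ico 1 J) : convec h w j = convec h w' j := by
  obtain ⟨h1, h2⟩ := Finset.mem_Ico.1 hj
  simp only [convec, localMean, centralDiff, H (j - 1) (by omega), H j h2.le, H (j + 1) h2]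

theorem secondDiff_congr {w w' : ℕ → ℝ} (h : ℝ) (H : ∀ i ≤ J, w i = w' i) {j : ℕ}
    (hj : j ∈ Finset.Ico 1 J) : secondDiff h w j = secondDiff h w' j := by
  obtain ⟨h1, h2⟩ := Finset.mem_Ico.1 hj
  simp only [secondDiff, H (j - 1) (by omega), H j h2.le, H (j + 1) h2]

theorem convec_smul (h c : ℝ) (w : ℕ → ℝ) (j : ℕ) :
    convec h (fun i => c * w i) j = c ^ 2 * convec h w j := by
  simp only [convec, localMean, centralDiff]; ring

theorem convec_gridTrunc (h ρ : ℝ) (w : ℕ → ℝ) (j : ℕ) :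
    convec h (gridTrunc L J ρ w) j = truncFactor L J ρ w ^ 2 * convec h w j :=
  convec_smul h _ w j

/-- The scheme, multiplied by the time step and written in terms of the stage values. -/
theorem isSchemeSolution_iff (ht : ∀ n, 1 ≤ n → n ≤ N → t (n - 1) < t n) (hN : 1 ≤ N)
    {U : ℕ → ℕ → ℝ} :
    IsSchemeSolution L α u₀ J N t F U ↔
      (∀ n, 1 ≤ n → n ≤ N → ∀ j ∈ Finset.Ico 1 J,
        U n j - U (n - 1) j + tStep t n * convec (hStep L J) (stageGrid U n) j
          = ∑ s ∈ Finset.Icc 1 n, kernelMass α t n s * secondDiff (hStep L J) (stageGrid U s) j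
            + tStep t n * F n j) ∧
      (∀ j ∈ Finset.Ico 1 J, U 0 j = u₀ (node L J j)) ∧
      (∀ n, 1 ≤ n → n ≤ N → U n 0 = 0 ∧ U n J = 0) := by
  have key : ∀ n, 1 ≤ n → n ≤ N → ∀ j,
      ((U n j - U (n - 1) j) / tStep t n + convec (hStep L J) (stageGrid U n) j
        = discFracIntegral α t (fun m => secondDiff (hStep L J) (U m) j) n + F n j
      ↔ U n j - U (n - 1) j + tStep t n * convec (hStep L J) (stageGrid U n) j
          = ∑ s ∈ Finset.Icc 1 n, kernelMass α t n s * secondDiff (hStep L J) (stageGrid U s) j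
            + tStep t n * F n j) := by
    intro n h1 hn j
    have hk : tStep t n ≠ 0 := (sub_pos.2 (ht n h1 hn)).ne'
    simp only [secondDiff_stageGrid]
    rw [← tStep_mul_discFracIntegral ht _ h1 hn, ← mul_add]
    constructor
    · intro h
      rw [← h]; field_simp
    · intro h
      apply mul_left_cancel₀ hk
      rw [← h]; field_simp
  have st : ∀ n, 2 ≤ n → (fun i => tMean (fun m => U m i) n) = stageGrid U n := fun n hn => by
    funext i; simp only [stageGrid, stage, if_neg (by omega : ¬n = 1)]
  have st1 : stageGrid U 1 = U 1 := by funext i; simp [stageGrid, stage]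
  constructor
  · intro S
    refine ⟨fun n h1 hn j hj => (key n h1 hn j).1 ?_,
      fun j hj => S.initial j (Finset.mem_Ico.1 hj).1 (Finset.mem_Ico.1 hj).2, S.boundary⟩
    obtain ⟨j1, j2⟩ := Finset.mem_Ico.1 hj
    rcases eq_or_lt_of_le h1 with rfl | h2
    · rw [st1]; exact S.first j j1 j2
    · rw [← st n h2]; exact S.later n h2 hn j j1 j2
  · rintro ⟨h, hi, hb⟩
    refine ⟨fun j j1 j2 => ?_, fun n h2 hn j j1 j2 => ?_,
      fun j j1 j2 => hi j (Finset.mem_Ico.2 ⟨j1, j2⟩), hb⟩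
    · have := (key 1 le_rfl hN j).2 (h 1 le_rfl hN j (Finset.mem_Ico.2 ⟨j1, j2⟩))
      rwa [st1] at this
    · have := (key n (by omega) hn j).2 (h n (by omega) hn j (Finset.mem_Ico.2 ⟨j1, j2⟩))
      rwa [← st n h2] at this

/-- The error of a grid function, extended by zero. -/
noncomputable def gridError (L : ℝ) (J : ℕ) (t : ℕ → ℝ) (u : ℝ → ℝ → ℝ) (U : ℕ → ℕ → ℝ)
    (n j : ℕ) : ℝ :=
  if j ∈ Finset.Ico 1 J then exactGrid L J t u n j - U n j else 0

theorem stageGrid_sub_congr {a e U : ℕ → ℕ → ℝ}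
    (H : ∀ n, 1 ≤ n → n ≤ N → ∀ j ≤ J, U n j = a n j - e n j) {n : ℕ} (h1 : 1 ≤ n) (hn : n ≤ N)
    {j : ℕ} (hj : j ≤ J) : stageGrid U n j = stageGrid a n j - stageGrid e n j := by
  rw [stageGrid, stageGrid, stageGrid, ← stage_sub]
  exact stage_congr h1 fun m hm hmn => H m hm (hmn.trans hn) j hj

/-- The error equations are equivalent to the scheme. -/
theorem scheme_equation_iff {a e U R : ℕ → ℕ → ℝ} {A : ℕ → ℕ → ℝ} {h : ℝ}
    (H : ∀ n, 1 ≤ n → n ≤ N → ∀ j ≤ J, U n j = a n j - e n j)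
    {n : ℕ} (h1 : 1 ≤ n) (hn : n ≤ N) {j : ℕ} (hj : j ∈ Finset.Ico 1 J)
    (H0 : U (n - 1) j = a (n - 1) j - e (n - 1) j)
    (hR : R n j = a n j - a (n - 1) j + tStep t n * convec h (stageGrid a n) j
      - ∑ s ∈ Finset.Icc 1 n, A n s * secondDiff h (stageGrid a s) j - tStep t n * F n j) :
    (U n j - U (n - 1) j + tStep t n * convec h (stageGrid U n) j
        = ∑ s ∈ Finset.Icc 1 n, A n s * secondDiff h (stageGrid U s) j + tStep t n * F n j)
    ↔ e n j - e (n - 1) j + tStep t n * (convecLin h (stageGrid a n) (stageGrid e n) j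
        - 1 * convec h (stageGrid e n) j)
      = ∑ s ∈ Finset.Icc 1 n, A n s * secondDiff h (stageGrid e s) j + R n j := by
  have e1 : convec h (stageGrid U n) j
      = convec h (fun i => stageGrid a n i - stageGrid e n i) j :=
    convec_congr h (fun i hi => stageGrid_sub_congr H h1 hn hi) hj
  have e2 : ∑ s ∈ Finset.Icc 1 n, A n s * secondDiff h (stageGrid U s) j
      = ∑ s ∈ Finset.Icc 1 n, A n s * secondDiff h (stageGrid a s) j
        - ∑ s ∈ Finset.Icc 1 n, A n s * secondDiff h (stageGrid e s) j := by
    rw [← Finset.sum_sub_distrib]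
    refine Finset.sum_congr rfl fun s hs => ?_
    obtain ⟨a1, a2⟩ := Finset.mem_Icc.1 hs
    rw [secondDiff_congr h (fun i hi => stageGrid_sub_congr H a1 (a2.trans hn) hi) hj,
      secondDiff_sub h (stageGrid a s) (stageGrid e s)]
    ring
  rw [e1, e2, H n h1 hn j (Finset.mem_Ico.1 hj).2.le, H0, hR, convecLin]
  constructor <;> intro h <;> linarith

/-- The equation of one step in terms of the step map. -/
theorem equation_iff_stepMap {a R e : ℕ → ℕ → ℝ} {ρ : ℝ} {n : ℕ} (h1 : 1 ≤ n) (j : ℕ) :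
    (e n j - e (n - 1) j + tStep t n * (convecLin (hStep L J) (a n) (stageGrid e n) j
        - truncFactor L J ρ (stageGrid e n) ^ 2 * convec (hStep L J) (stageGrid e n) j)
      = ∑ s ∈ Finset.Icc 1 n, kernelMass α t n s * secondDiff (hStep L J) (stageGrid e s) j + R n j)
    ↔ stepMap L J (stageMul n) (tStep t n) (kernelMass α t n n) ρ (a n) (stageGrid e n) j
      = stageMul n * e (n - 1) j + ∑ s ∈ Finset.Icc 1 (n - 1),
        kernelMass α t n s * secondDiff (hStep L J) (stageGrid e s) j + R n j := by
  have e1 := stageMul_mul_stage_sub (fun m => e m j) n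
  change stageMul n * (stageGrid e n j - e (n - 1) j) = _ at e1
  obtain ⟨q, rfl⟩ : ∃ q, n = q + 1 := ⟨n - 1, by omega⟩
  rw [Finset.sum_Icc_succ_top (by omega), stepMap, convec_gridTrunc, ← e1]
  simp only [Nat.add_sub_cancel]
  constructor <;> intro h <;> linarith

/-- The error system with truncated quadratic term has a solution. -/
theorem exists_isErrorSolution (hL : 0 < L) (hJ : 1 ≤ J)
    (ht : ∀ n, 1 ≤ n → n ≤ N → t (n - 1) < t n) {K₀ K₁ : ℝ} (hK₀ : 0 ≤ K₀) (hK₁ : 0 < K₁)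
    (hA : ∀ n, 1 ≤ n → n ≤ N → (tStep t n * (K₀ + 2 * K₁)) ^ 2 ≤ 2 * kernelMass α t n n)
    {a : ℕ → ℕ → ℝ} (Ha : ∀ n, 1 ≤ n → n ≤ N → ∀ j ≤ J, |a n j| ≤ K₀) (R : ℕ → ℕ → ℝ) :
    ∃ e, IsErrorSolution L α J N t a
      (fun n => truncFactor L J (K₁ * √(hStep L J)) (stageGrid e n) ^ 2) R e := by
  set ρ := K₁ * √(hStep L J) with hρ
  suffices h : ∀ m ≤ N, ∃ e : ℕ → ℕ → ℝ, (∀ j, e 0 j = 0) ∧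
      (∀ n, ∀ j ∉ Finset.Ico 1 J, e n j = 0) ∧ ∀ n, 1 ≤ n → n ≤ m → ∀ j ∈ Finset.Ico 1 J,
        stepMap L J (stageMul n) (tStep t n) (kernelMass α t n n) ρ (a n) (stageGrid e n) j
          = stageMul n * e (n - 1) j + ∑ s ∈ Finset.Icc 1 (n - 1),
            kernelMass α t n s * secondDiff (hStep L J) (stageGrid e s) j + R n j by
    obtain ⟨e, h1, h2, h3⟩ := h N le_rfl
    exact ⟨e, h1, h2, fun n hn1 hn j hj => (equation_iff_stepMap hn1 j).2 (h3 n hn1 hn j hj)⟩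
  intro m
  induction m with
  | zero => exact fun _ => ⟨fun _ _ => 0, by simp, by simp, fun n h1 h2 => by omega⟩
  | succ m ih =>
    intro hm
    obtain ⟨e, h1, h2, h3⟩ := ih (by omega)
    obtain ⟨V, hV, hVe⟩ := exists_stepMap_eq hL hJ hK₀ hK₁ (one_le_stageMul (m + 1))
      (sub_pos.2 (ht (m + 1) (by omega) hm)).le (hA (m + 1) (by omega) hm)
      (Ha (m + 1) (by omega) hm) (fun j => stageMul (m + 1) * e m j + ∑ s ∈ Finset.Icc 1 m,
            kernelMass α t (m + 1) s * secondDiff (hStep L J) (stageGrid e s) j + R (m + 1) j)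
    -- The new level is recovered from the computed stage value V by inverting
    -- `stageMul_mul_stage_sub`.
    set e' : ℕ → ℕ → ℝ := Function.update e (m + 1)
      (fun j => e m j + stageMul (m + 1) * (V j - e m j)) with he'
    have old : ∀ i ≤ m, e' i = e i := fun i hi => Function.update_of_ne (by omega) _ _
    have new : ∀ j, e' (m + 1) j = e m j + stageMul (m + 1) * (V j - e m j) := fun j => by
      rw [he', Function.update_self]
    have oldst : ∀ s, 1 ≤ s → s ≤ m → stageGrid e' s = stageGrid e s := fun s hs hs' => by
      funext j
      exact stage_congr hs fun i _ hi => by rw [old i (hi.trans hs')]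
    have newst : stageGrid e' (m + 1) = V := by
      funext j
      have := stageMul_mul_stage_sub (fun i => e' i j) (m + 1)
      simp only [Nat.add_sub_cancel, new, old m le_rfl] at this
      have h4 := one_le_stageMul (m + 1)
      have h5 : stageMul (m + 1) * (stage (fun i => e' i j) (m + 1) - V j) = 0 := by linarith
      exact sub_eq_zero.1 ((mul_eq_zero.1 h5).resolve_left (by linarith))
    refine ⟨e', fun j => by rw [old 0 (by omega), h1], fun n j hj => ?_, fun n hn1 hn j hj => ?_⟩
    · rcases eq_or_ne n (m + 1) with rfl | hne
      · rw [new, h2 m j hj, hV j hj]; ring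
      · rw [he', Function.update_of_ne hne, h2 n j hj]
    · have hsum : ∑ s ∈ Finset.Icc 1 (n - 1),
          kernelMass α t n s * secondDiff (hStep L J) (stageGrid e' s) j
          = ∑ s ∈ Finset.Icc 1 (n - 1),
          kernelMass α t n s * secondDiff (hStep L J) (stageGrid e s) j :=
        Finset.sum_congr rfl fun s hs => by
          obtain ⟨a1, a2⟩ := Finset.mem_Icc.1 hs
          rw [oldst s a1 (by omega)]
      rw [hsum, old (n - 1) (by omega)]
      rcases eq_or_lt_of_le hn with rfl | hlt
      · rw [newst]; exact hVe j hj
      · rw [oldst n hn1 (by omega)]; exact h3 n hn1 (by omega) j hj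

/-- The error system with truncated quadratic term has at most one solution. -/
theorem IsErrorSolution.unique (hL : 0 < L) (hJ : 1 ≤ J)
    (ht : ∀ n, 1 ≤ n → n ≤ N → t (n - 1) < t n) {K₀ K₁ : ℝ} (hK₀ : 0 ≤ K₀) (hK₁ : 0 < K₁)
    (hA : ∀ n, 1 ≤ n → n ≤ N → (tStep t n * (K₀ + 2 * K₁)) ^ 2 ≤ 2 * kernelMass α t n n)
    {a R e e' : ℕ → ℕ → ℝ} (Ha : ∀ n, 1 ≤ n → n ≤ N → ∀ j ≤ J, |a n j| ≤ K₀)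
    (he : IsErrorSolution L α J N t a
      (fun n => truncFactor L J (K₁ * √(hStep L J)) (stageGrid e n) ^ 2) R e)
    (he' : IsErrorSolution L α J N t a
      (fun n => truncFactor L J (K₁ * √(hStep L J)) (stageGrid e' n) ^ 2) R e')
    {n : ℕ} (hn : n ≤ N) : e n = e' n := by
  induction n using Nat.strong_induction_on with
  | _ n ih =>
    rcases Nat.eq_zero_or_pos n with rfl | h1
    · funext j; rw [he.initial, he'.initial]
    have hst : ∀ s, 1 ≤ s → s < n → stageGrid e s = stageGrid e' s := fun s hs hs' => by
      funext j
      exact stage_congr hs fun i _ hi => by rw [ih i (by omega) (by omega)]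
    have hstn : stageGrid e n = stageGrid e' n := by
      have hk : 0 ≤ tStep t n := (sub_pos.2 (ht n h1 hn)).le
      refine stepMap_injective hL hJ hK₀ hK₁ (one_le_stageMul n) hk (hA n h1 hn)
        (Ha n h1 hn) (fun j hj => stageGrid_support he.support n hj)
        (fun j hj => stageGrid_support he'.support n hj) fun j hj => ?_
      rw [(equation_iff_stepMap h1 j).1 (he.equation n h1 hn j hj),
        (equation_iff_stepMap h1 j).1 (he'.equation n h1 hn j hj), ih (n - 1) (by omega) (by omega)]
      congr 2
      refine Finset.sum_congr rfl fun s hs => ?_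
      obtain ⟨a1, a2⟩ := Finset.mem_Icc.1 hs
      rw [hst s a1 (by omega)]
    funext j
    have e1 := stageMul_mul_stage_sub (fun m => e m j) n
    have e2 := stageMul_mul_stage_sub (fun m => e' m j) n
    have e3 : stage (fun m => e m j) n = stage (fun m => e' m j) n := congrFun hstn j
    have e4 : e (n - 1) j = e' (n - 1) j := by rw [ih (n - 1) (by omega) (by omega)]
    rw [e3] at e1
    simp only [e4] at e1 e2
    linarith

/-- Existence and uniqueness under explicit smallness conditions. -/
theorem IsRegularSolution.existsUnique_scheme (S : IsRegularSolution L T α σ M K f u₀ u)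
    (hα1 : α < 1) (H : IsGradedMesh T γ cγ Cγ k N t) (hJ : 1 ≤ J) (hN : 1 ≤ N) {r K₁ : ℝ}
    (hK₁ : 0 < K₁)
    (hR : ∑ n ∈ Finset.Icc 1 N, gridNorm L J (residual L α J t u F n) ≤ r)
    (hr : 2 * r * Real.exp (2 * K * T) ≤ K₁ * √(hStep L J))
    (hk : 2 * K * (Cγ * k) ≤ 1)
    (hA : ∀ n, 1 ≤ n → n ≤ N → (tStep t n * (K + 2 * K₁)) ^ 2 ≤ 2 * kernelMass α t n n) :
    ∃ U : ℕ → ℕ → ℝ, IsSchemeSolution L α u₀ J N t F U ∧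
      ∀ V : ℕ → ℕ → ℝ, IsSchemeSolution L α u₀ J N t F V →
        ∀ n, n ≤ N → ∀ j, 1 ≤ j → j < J → V n j = U n j := by
  have hL := S.L_pos
  have hK := S.K_nonneg
  have hh := hStep_pos hL hJ
  have ht := H.increasing
  set ρ := K₁ * √(hStep L J) with hρ
  have hρ0 : 0 < ρ := mul_pos hK₁ (Real.sqrt_pos.2 hh)
  set a := exactGrid L J t u with ha
  set R := residual L α J t u F with hRdef
  have hab : ∀ n, n ≤ N → ∀ j ≤ J, |a n j| ≤ K := fun n hn j hj =>
    (S.bounds _ (H.mem_Icc hn)).zero _ (node_mem_Icc hL hJ hj)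
  have Ha : ∀ n, 1 ≤ n → n ≤ N → ∀ j ≤ J, |stageGrid a n j| ≤ K := fun n h1 hn j hj =>
    abs_stage_le (hab n hn j hj) (hab (n - 1) (by omega) j hj)
  have Hd : ∀ n, 1 ≤ n → n ≤ N → ∀ j < J,
      |stageGrid a n (j + 1) - stageGrid a n j| ≤ K * hStep L J := fun n h1 hn j hj => by
    rw [stageGrid, stageGrid, ← stage_sub]
    exact abs_stage_le ((S.bounds _ (H.mem_Icc hn)).abs_succ_sub_le hL hJ hj)
      ((S.bounds _ (H.mem_Icc (n := n - 1) (by omega))).abs_succ_sub_le hL hJ hj)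
  have hks : ∀ n, 1 ≤ n → n ≤ N → 2 * K * tStep t n ≤ 1 := fun n h1 hn =>
    (mul_le_mul_of_nonneg_left (H.tStep_le h1 hn) (by positivity)).trans hk
  -- The stability bound is independent of θ, so it puts the solutions of the truncated and the
  -- untruncated error systems alike into the ball where the truncation factor is 1.
  have small : ∀ {θ : ℕ → ℝ} {e : ℕ → ℕ → ℝ}, IsErrorSolution L α J N t (stageGrid a) θ R e →
      ∀ n, 1 ≤ n → n ≤ N → truncFactor L J ρ (stageGrid e n) = 1 := by
    intro θ e he n h1 hn
    have hb : ∀ m ≤ N, gridNorm L J (e m) ≤ ρ := fun m hm =>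
      (he.gridNorm_le hL hJ S.α_pos hα1 H.zero ht hK H.le_final hks Hd hR hm).trans hr
    exact truncFactor_eq_one hρ0 ((gridNorm_stageGrid_le hL hJ e n).trans
      (max_le (hb n hn) (hb (n - 1) (by omega))))
  have switch : ∀ {θ θ' : ℕ → ℝ} {e : ℕ → ℕ → ℝ}, IsErrorSolution L α J N t (stageGrid a) θ R e →
      (∀ n, 1 ≤ n → n ≤ N → θ n = θ' n) → IsErrorSolution L α J N t (stageGrid a) θ' R e :=
    fun he hθ => ⟨he.initial, he.support, fun n h1 hn j hj => by
      rw [← hθ n h1 hn]; exact he.equation n h1 hn j hj⟩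
  have bdry : ∀ n, 1 ≤ n → n ≤ N → a n 0 = 0 ∧ a n J = 0 := fun n h1 hn => by
    simp only [ha, exactGrid, node_zero, node_last hJ]
    exact S.sol.boundary _ ⟨H.pos h1 hn, H.le_T hn⟩
  have init : ∀ j ∈ Finset.Ico 1 J, a 0 j = u₀ (node L J j) := fun j hj => by
    simp only [ha, exactGrid, H.zero]
    exact S.sol.initial _ (Ioo_subset_Icc_self (node_mem_Ioo hL hj))
  have toError : ∀ {V : ℕ → ℕ → ℝ}, IsSchemeSolution L α u₀ J N t F V →
      IsErrorSolution L α J N t (stageGrid a)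
        (fun n => truncFactor L J ρ (stageGrid (gridError L J t u V) n) ^ 2) R
        (gridError L J t u V) := by
    intro V hV
    obtain ⟨v1, v2, v3⟩ := (isSchemeSolution_iff ht hN).1 hV
    have hint : ∀ n, ∀ j ∈ Finset.Ico 1 J, V n j = a n j - gridError L J t u V n j :=
      fun n j hj => by simp only [gridError, if_pos hj, ha]; ring
    have hV' : ∀ n, 1 ≤ n → n ≤ N → ∀ j ≤ J, V n j = a n j - gridError L J t u V n j := by
      intro n h1 hn j hj
      by_cases hjm : j ∈ Finset.Ico 1 J
      · exact hint n j hjm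
      · have hj' : j = 0 ∨ j = J := by
          simp only [Finset.mem_Ico] at hjm; omega
        rw [gridError, if_neg hjm]
        rcases hj' with rfl | rfl
        · rw [(v3 n h1 hn).1, (bdry n h1 hn).1, sub_zero]
        · rw [(v3 n h1 hn).2, (bdry n h1 hn).2, sub_zero]
    have he : IsErrorSolution L α J N t (stageGrid a) (fun _ => 1) R (gridError L J t u V) := by
      refine ⟨fun j => ?_, fun n j hj => by rw [gridError, if_neg hj], fun n h1 hn j hj => ?_⟩
      · by_cases hj : j ∈ Finset.Ico 1 J
        · rw [gridError, if_pos hj, v2 j hj, ← init j hj, sub_self]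
        · rw [gridError, if_neg hj]
      -- The previous level may be 0, where V is prescribed only at interior nodes. Agreement there
      -- is supplied at the node j alone.
      · exact (scheme_equation_iff hV' h1 hn hj (hint (n - 1) j hj) rfl).1 (v1 n h1 hn j hj)
    exact switch he fun n h1 hn => by rw [small he n h1 hn, one_pow]
  obtain ⟨e, he⟩ := exists_isErrorSolution hL hJ ht hK hK₁ hA Ha R
  have he1 : IsErrorSolution L α J N t (stageGrid a) (fun _ => 1) R e :=
    switch he fun n h1 hn => by rw [small he n h1 hn, one_pow]
  set U : ℕ → ℕ → ℝ := fun n j => a n j - e n j with hU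
  have hUs : IsSchemeSolution L α u₀ J N t F U := by
    refine (isSchemeSolution_iff ht hN).2 ⟨fun n h1 hn j hj => ?_, fun j hj => ?_,
      fun n h1 hn => ?_⟩
    · exact (scheme_equation_iff (R := R) (fun _ _ _ _ _ => rfl) h1 hn hj rfl rfl).2
        (he1.equation n h1 hn j hj)
    · simp only [hU, he.initial j, sub_zero]; exact init j hj
    · simp only [hU, he.support n 0 (by simp), he.support n J (by simp), sub_zero]
      exact bdry n h1 hn
  refine ⟨U, hUs, fun V hV n hn j j1 j2 => ?_⟩
  have hj : j ∈ Finset.Ico 1 J := Finset.mem_Ico.2 ⟨j1, j2⟩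
  have h1 := congrFun (IsErrorSolution.unique hL hJ ht hK hK₁ hA Ha (toError hV) (toError hUs) hn) j
  simp only [gridError, if_pos hj] at h1
  linarith

end

end PIDE

/-! ### Choice of the constants -/

theorem theorem4p4 (L T α σ γ M Cf cγ Cγ : ℝ)
    (hL : 0 < L) (hT : 0 < T) (hα : 0 < α) (hα1 : α < 1)
    (hσ : 0 < σ) (hγ1 : 1 ≤ γ) (hγ : γ = 2 / σ) (hcγ : 0 < cγ)
    (f : ℝ → ℝ → ℝ) (u₀ : ℝ → ℝ) (u : ℝ → ℝ → ℝ)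
    (hu : PIDE.IsSolution L T α f u₀ u)
    (hu_diff : PIDE.TwiceDiffInTime L T (PIDE.spaceDeriv L 2 u))
    (hf_diff : PIDE.TwiceDiffInTime L T f)
    (hu_reg : ∀ J : ℕ, 1 ≤ J → ∀ t ∈ Set.Ioc 0 T,
      t * PIDE.nodalNorm L J (fun x => PIDE.timeDeriv T 1 (PIDE.spaceDeriv L 2 u) x t)
        + t ^ 2 * PIDE.nodalNorm L J (fun x => PIDE.timeDeriv T 2 (PIDE.spaceDeriv L 2 u) x t)
        ≤ M * t ^ (σ - 1))
    (hf_reg : ∀ J : ℕ, 1 ≤ J → ∀ t ∈ Set.Ioc 0 T,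
      t * PIDE.nodalNorm L J (fun x => PIDE.timeDeriv T 1 f x t)
        + t ^ 2 * PIDE.nodalNorm L J (fun x => PIDE.timeDeriv T 2 f x t)
        ≤ M * t ^ (σ - 1))
    (κ : ℝ → ℝ) (hκ : κ =o[𝓝[>] (0 : ℝ)] fun h => h ^ (1 / 2 : ℝ)) :
    ∃ h₀ : ℝ, 0 < h₀ ∧
      ∀ J : ℕ, 1 ≤ J → PIDE.hStep L J ≤ h₀ →
      ∀ k : ℝ, k ≤ κ (PIDE.hStep L J) →
      ∀ N : ℕ, 1 ≤ N → ∀ t : ℕ → ℝ, PIDE.IsGradedMesh T γ cγ Cγ k N t →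
      ∀ F : ℕ → ℕ → ℝ, PIDE.IsSourceApprox L T Cf f J N t F →
        ∃ U : ℕ → ℕ → ℝ, PIDE.IsSchemeSolution L α u₀ J N t F U ∧
          ∀ V : ℕ → ℕ → ℝ, PIDE.IsSchemeSolution L α u₀ J N t F V →
            ∀ n, n ≤ N → ∀ j, 1 ≤ j → j < J → V n j = U n j := by
  by_cases hC : 0 < Cγ
  swap
  -- An admissible mesh with N ≥ 1 has a positive first step, which forces Cγ > 0; otherwise there
  -- is nothing to prove.
  · exact ⟨1, one_pos, fun J _ _ k _ N hN t H => absurd (H.const_pos hN) hC⟩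
  have hσ2 : σ ≤ 2 := by
    rw [hγ, le_div_iff₀ hσ] at hγ1; linarith
  obtain ⟨K, hK⟩ := hu.exists_spaceBounds hL
  have S : PIDE.IsRegularSolution L T α σ M K f u₀ u :=
    ⟨hL, hT, hα, hσ, hσ2, hu, hK, hu_diff, hf_diff, hu_reg, hf_reg⟩
  have hK0 := S.K_nonneg
  obtain ⟨C, hC0, hres⟩ := S.exists_sum_residual_le hγ hC Cf
  -- Stability bounds the error by 2C(h + k)e^(2KT), and h + k ≤ 2√h. The summand 1 only makes the
  -- radius positive.
  set K₁ := 4 * C * Real.exp (2 * K * T) + 1 with hK₁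
  have hK₁0 : 0 < K₁ := by positivity
  have hΓ : 0 < Real.Gamma (α + 2) := Real.Gamma_pos_of_pos (by linarith)
  set D := (K + 2 * K₁) ^ 2 * Real.Gamma (α + 2) with hD
  have hD0 : 0 < D := by positivity
  -- An upper bound for the time steps. The first entry yields the Gronwall condition 2K Cγ k ≤ 1.
  -- The second is x^(1-α) ≤ 2/D solved for x, which is the monotonicity condition (x(K + 2K₁))² ≤
  -- 2x^(α+1)/Γ(α+2).
  set b := min (1 / (2 * K + 1)) ((2 / D) ^ (1 / (1 - α))) with hb
  have hb0 : 0 < b := lt_min (by positivity) (Real.rpow_pos_of_pos (by positivity) _)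
  set k₀ := min 1 (b / Cγ) with hk₀
  have hk₀0 : 0 < k₀ := lt_min one_pos (by positivity)
  -- The little-o hypothesis enters with constant 1, as k ≤ √h. Bounding h by k₀² then also makes k
  -- at most k₀.
  obtain ⟨δ, hδ, hδκ⟩ := mem_nhdsGT_iff_exists_Ioo_subset.1 (hκ.bound one_pos)
  have hδ0 : 0 < δ := hδ
  refine ⟨min (δ / 2) (min 1 (k₀ ^ 2)), by positivity, ?_⟩
  intro J hJ hhJ k hk N hN t H F HF
  have hh := PIDE.hStep_pos hL hJ
  set h := PIDE.hStep L J with hdef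
  have hk0 := H.k_pos
  have hh1 : h ≤ 1 := hhJ.trans ((min_le_right _ _).trans (min_le_left _ _))
  have hh2 : h ≤ k₀ ^ 2 := hhJ.trans ((min_le_right _ _).trans (min_le_right _ _))
  have hh3 : h < δ := by
    have : h ≤ δ / 2 := hhJ.trans (min_le_left _ _)
    linarith
  have hkh : k ≤ √h := by
    have h1 := hδκ (⟨hh, hh3⟩ : h ∈ Set.Ioo 0 δ)
    simp only [Set.mem_ofPred_eq, one_mul, Real.norm_eq_abs, ← Real.sqrt_eq_rpow] at h1
    rw [abs_of_nonneg (Real.sqrt_nonneg h)] at h1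
    exact hk.trans ((le_abs_self _).trans h1)
  have hkk₀ : k ≤ k₀ := hkh.trans (by
    rw [← Real.sqrt_sq hk₀0.le]; exact Real.sqrt_le_sqrt hh2)
  have hCk : Cγ * k ≤ b := by
    have h1 : k ≤ b / Cγ := hkk₀.trans (min_le_right _ _)
    rw [le_div_iff₀ hC] at h1; linarith
  have hhs : h ≤ √h := by
    have h1 : √h ≤ 1 := by rw [Real.sqrt_le_one]; exact hh1
    nlinarith [Real.mul_self_sqrt hh.le, Real.sqrt_nonneg h]
  refine S.existsUnique_scheme hα1 H hJ hN hK₁0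
    (hres J N t F k cγ hJ hN (hkk₀.trans (min_le_left _ _)) H HF) ?_ ?_ fun n h1 hn => ?_
  · rw [← hdef]
    have h1 : h + k ≤ 2 * √h := by linarith
    calc 2 * (C * (h + k)) * Real.exp (2 * K * T)
        ≤ 2 * (C * (2 * √h)) * Real.exp (2 * K * T) := by gcongr
      _ = 4 * C * Real.exp (2 * K * T) * √h := by ring
      _ ≤ K₁ * √h := by gcongr; rw [hK₁]; linarith
  · have h1 : Cγ * k ≤ 1 / (2 * K + 1) := hCk.trans (min_le_left _ _)
    rw [le_div_iff₀ (by positivity)] at h1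
    have : 0 < Cγ * k := by positivity
    linarith
  · have hs := H.tStep_pos h1 hn
    have hsb : PIDE.tStep t n ≤ (2 / D) ^ (1 / (1 - α)) :=
      (H.tStep_le h1 hn).trans (hCk.trans (min_le_right _ _))
    rw [PIDE.kernelMass_self hα H.increasing h1 hn]
    set x := PIDE.tStep t n with hx
    have h2 : x ^ (1 - α) ≤ 2 / D := by
      have h3 := Real.rpow_le_rpow hs.le hsb (by linarith : 0 ≤ 1 - α)
      rwa [← Real.rpow_mul (by positivity), one_div_mul_cancel (by linarith), Real.rpow_one] at h3
    rw [le_div_iff₀ hD0] at h2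
    have h4 : x ^ 2 = x ^ (1 - α) * x ^ (α + 1) := by
      rw [← Real.rpow_add hs, ← Real.rpow_natCast]; congr 1; push_cast; ring
    have h5 : 0 ≤ x ^ (α + 1) := Real.rpow_nonneg hs.le _
    rw [mul_div_assoc', le_div_iff₀ hΓ, mul_pow, h4]
    calc x ^ (1 - α) * x ^ (α + 1) * (K + 2 * K₁) ^ 2 * Real.Gamma (α + 2)
        = x ^ (1 - α) * D * x ^ (α + 1) := by rw [hD]; ring
      _ ≤ 2 * x ^ (α + 1) := by gcongr
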